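/- **Setting.** Formulas are formulas of first-order logic with equality in the language $\{0,\mathsf S,+,\times\}$, and $\vdash$ refers to intuitionistic predicate logic with equality. We write $s<t$ for $\exists x\,(s+\mathsf Sx=t)$. The $\Delta_0$-formulas are obtained from atomic formulas (including $\bot$) by $\wedge,\vee,\to$ and the bounded quantifiers $\exists x\,(x<t\wedge A)$, $\forall x\,(x<t\to A)$, where $x$ is not in $t$; a $\Sigma_1$-formula is a formula $\exists x\,A$ with $A\in\Delta_0$. $\mathsf{iI}\Sigma_1$ is the intuitionistic theory with the axioms $\neg(\mathsf Sx=0)$, $\mathsf Sx=\mathsf Sy\to x=y$, the recursion equations for $+$ and $\times$, and induction for $\Sigma_1$-formulas. A *theory* $T$ is given by a $\Sigma_1$-formula $\mathsf{Ax}_T(x)$; its axioms are the formulas $A$ with $\mathbb N\models \mathsf{Ax}_T(\ulcorner A\urcorner)$, and $\vdash_T A$ means that $A$ is derivable from these axioms. $T$ is *$\Sigma_1$-sound* if every $\Sigma_1$-sentence provable in $T$ is true in $\mathbb N$. For a $\Sigma_1$-formula $P(x)$ with no free variable other than $x$ and a sentence $A$, write $\Box_P A$ for $P(\ulcorner A\urcorner)$.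 $P$ is a *provability predicate* for $T$ if for all sentences $A,B$ and all $\Sigma_1$-sentences $S$: (a) $\vdash_T A$ implies $\mathbb N\models\Box_P A$; (b) $\vdash_{\mathsf{iI}\Sigma_1}\Box_P(A\to B)\to(\Box_P A\to\Box_P B)$; (c) $\vdash_{\mathsf{iI}\Sigma_1}S\to\Box_P S$. A pair $(P,Q)$ of such formulas, with $\Box=\Box_P$ and $\triangle=\Box_Q$, is a *good pair* for $T$ if (i) $P$ and $Q$ are provability predicates for $T$; (ii) $\mathbb N\models\Box A$ implies $\vdash_T A$ for all sentences $A$; (iii) $\vdash_T(\triangle A\to A)\to A$ for all sentences $A$ (the strong Löb principle for $Q$, equivalent to the completeness principle $\vdash_T A\to\triangle A$ for all sentences $A$); (iv) $\vdash_T\Box\triangle S\to\Box S$ for all $\Sigma_1$-sentences $S$. The modal language has countably many proposition letters, $\bot,\wedge,\vee,\to$ and $\Box$. $\mathsf{iGLC}$ is the smallest set of modal sentences that contains all instances of intuitionistic propositional tautologies and all sentences $\Box(A\to B)\to(\Box A\to\Box B)$, $\Box(\Box A\to A)\to\Box A$ and $A\to\Box A$, and is closed under modus ponens and under the rule $A/\Box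 A$. A *realization* $\sigma$ assigns an arithmetical sentence to each proposition letter; it is a *$\Sigma_1$-realization* if all these sentences are $\Sigma_1$. It extends to modal sentences by $\sigma_P(p)=\sigma(p)$, by commuting with $\bot,\wedge,\vee,\to$, and by $\sigma_P(\Box B)=\Box_P(\sigma_P(B))$. The *logic* (resp. *$\Sigma_1$-logic*) *for $P$ with respect to $T$* is the set of modal sentences $A$ with $\vdash_T\sigma_P(A)$ for all realizations (resp. all $\Sigma_1$-realizations) $\sigma$. **Theorem.** Let $T$ be a $\Sigma_1$-sound theory that extends $\mathsf{iI}\Sigma_1$. Suppose that $(P,Q)$ is a good pair for $T$ and that $\vdash_T A\to\Box_P A$ for all sentences $A$. Then the logic for $P$ with respect to $T$ and the $\Sigma_1$-logic for $P$ with respect to $T$ are both equal to the set of theorems of $\mathsf{iGLC}$. -/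

import Mathlib

namespace IntArith

/-! ## The language of arithmetic

Terms and formulas of `{0, S, +, ×}` with equality, all intuitionistic connectives being primitive.
Variables are de Bruijn indices: a quantifier binds index `0`, and free variables are indices. -/

/-- Terms of the language of arithmetic. -/
inductive Tm : Type
  | var : ℕ → Tm
  | zero : Tm
  | succ : Tm → Tm
  | add : Tm → Tm → Tm
  | mul : Tm → Tm → Tm

/-- Formulas of the language of arithmetic. -/
inductive Fml : Type
  | bot : Fml
  | eq : Tm → Tm → Fml
  | and : Fml → Fml → Fml
  | or : Fml → Fml → Fml
  | imp : Fml → Fml → Fml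
  | all : Fml → Fml
  | ex : Fml → Fml

/-- The numeral `S ... S 0` of `n`. -/
def num : ℕ → Tm
  | 0 => Tm.zero
  | n + 1 => Tm.succ (num n)

/-- Simultaneous substitution in a term. -/
def Tm.subst (σ : ℕ → Tm) : Tm → Tm
  | .var i => σ i
  | .zero => .zero
  | .succ t => .succ (t.subst σ)
  | .add s t => .add (s.subst σ) (t.subst σ)
  | .mul s t => .mul (s.subst σ) (t.subst σ)

/-- Renaming that makes room for a new variable with index `0`. -/
def Tm.shift (t : Tm) : Tm := t.subst fun i => .var (i + 1)

/-- The substitution that acts like `σ` below a quantifier. -/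
def up (σ : ℕ → Tm) : ℕ → Tm
  | 0 => .var 0
  | i + 1 => (σ i).shift

/-- Capture-avoiding simultaneous substitution in a formula. -/
def Fml.subst (σ : ℕ → Tm) : Fml → Fml
  | .bot => .bot
  | .eq s t => .eq (s.subst σ) (t.subst σ)
  | .and A B => .and (A.subst σ) (B.subst σ)
  | .or A B => .or (A.subst σ) (B.subst σ)
  | .imp A B => .imp (A.subst σ) (B.subst σ)
  | .all A => .all (A.subst (up σ))
  | .ex A => .ex (A.subst (up σ))

/-- Renaming that makes room for a new free variable with index `0`. -/
def Fml.shift (A : Fml) : Fml := A.subst fun i => .var (i + 1)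

/-- The substitution `[t/x]`, where `x` is the variable with index `0`, which disappears: the other
variables move down by one. -/
def instSubst (t : Tm) : ℕ → Tm
  | 0 => t
  | i + 1 => .var i

/-- `A[t/x]`, where `x` is the variable with index `0`, which disappears. -/
def Fml.inst (A : Fml) (t : Tm) : Fml := A.subst (instSubst t)

/-- The substitution `[S x/x]`, where `x` is the variable with index `0`, which stays. -/
def succSubst : ℕ → Tm
  | 0 => .succ (.var 0)
  | i + 1 => .var (i + 1)

/-- All variables of the term have an index smaller than `n`. -/
def Tm.FreeBelow (n : ℕ) : Tm → Prop
  | .var i => i < n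
  | .zero => True
  | .succ t => t.FreeBelow n
  | .add s t => s.FreeBelow n ∧ t.FreeBelow n
  | .mul s t => s.FreeBelow n ∧ t.FreeBelow n

/-- All free variables of the formula have an index smaller than `n`. -/
def Fml.FreeBelow : ℕ → Fml → Prop
  | _, .bot => True
  | n, .eq s t => s.FreeBelow n ∧ t.FreeBelow n
  | n, .and A B => A.FreeBelow n ∧ B.FreeBelow n
  | n, .or A B => A.FreeBelow n ∧ B.FreeBelow n
  | n, .imp A B => A.FreeBelow n ∧ B.FreeBelow n
  | n, .all A => A.FreeBelow (n + 1)
  | n, .ex A => A.FreeBelow (n + 1)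

/-- Sentences are formulas without free variables. -/
def Fml.IsSentence (A : Fml) : Prop := A.FreeBelow 0

/-! ## The standard model -/

/-- Value of a term in `ℕ` under the assignment `e`. -/
def Tm.eval (e : ℕ → ℕ) : Tm → ℕ
  | .var i => e i
  | .zero => 0
  | .succ t => t.eval e + 1
  | .add s t => s.eval e + t.eval e
  | .mul s t => s.eval e * t.eval e

/-- The assignment that sends the variable with index `0` to `a` and is `e` on the others. -/
def consAssign (a : ℕ) (e : ℕ → ℕ) : ℕ → ℕ
  | 0 => a
  | i + 1 => e i

/-- Truth of a formula in `ℕ` under the assignment `e`. -/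
def Fml.eval : (ℕ → ℕ) → Fml → Prop
  | _, .bot => False
  | e, .eq s t => s.eval e = t.eval e
  | e, .and A B => A.eval e ∧ B.eval e
  | e, .or A B => A.eval e ∨ B.eval e
  | e, .imp A B => A.eval e → B.eval e
  | e, .all A => ∀ a, A.eval (consAssign a e)
  | e, .ex A => ∃ a, A.eval (consAssign a e)

/-- `ℕ ⊨ A`. -/
def TrueInN (A : Fml) : Prop := ∀ e, A.eval e

/-! ## `Δ₀`-formulas and `Σ₁`-formulas -/

/-- `s < t`, that is, `∃ x (s + S x = t)` with `x` not in `s`, `t`. -/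
def ltF (s t : Tm) : Fml := .ex (.eq (.add s.shift (.succ (.var 0))) t.shift)

/-- `Δ₀`-formulas; a bound of a quantifier is a term not containing the quantified variable. -/
inductive IsDelta0 : Fml → Prop
  | bot : IsDelta0 .bot
  | eq (s t : Tm) : IsDelta0 (.eq s t)
  | and {A B : Fml} : IsDelta0 A → IsDelta0 B → IsDelta0 (.and A B)
  | or {A B : Fml} : IsDelta0 A → IsDelta0 B → IsDelta0 (.or A B)
  | imp {A B : Fml} : IsDelta0 A → IsDelta0 B → IsDelta0 (.imp A B)
  | bex (t : Tm) {A : Fml} : IsDelta0 A → IsDelta0 (.ex (.and (ltF (.var 0) t.shift) A))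
  | ball (t : Tm) {A : Fml} : IsDelta0 A → IsDelta0 (.all (.imp (ltF (.var 0) t.shift) A))

/-- `Σ₁`-formulas: one existential quantifier in front of a `Δ₀`-formula. -/
def IsSigma1 (S : Fml) : Prop := ∃ A, IsDelta0 A ∧ S = .ex A

/-! ## Gödel numbers

A term is coded as a pair `(k, c)`, where `k` is the number of successor symbols in front of it and
`c` codes what comes after them; all other syntax is coded by tagged pairs. -/

/-- Gödel number of a term. -/
def Tm.code : Tm → ℕ
  | .zero => Nat.pair 0 (Nat.pair 0 0)
  | .var i => Nat.pair 0 (Nat.pair 1 i)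
  | .add s t => Nat.pair 0 (Nat.pair 2 (Nat.pair s.code t.code))
  | .mul s t => Nat.pair 0 (Nat.pair 3 (Nat.pair s.code t.code))
  | .succ t => Nat.pair ((Nat.unpair t.code).1 + 1) (Nat.unpair t.code).2

/-- Gödel number of a formula. -/
def Fml.code : Fml → ℕ
  | .bot => Nat.pair 0 0
  | .eq s t => Nat.pair 1 (Nat.pair s.code t.code)
  | .and A B => Nat.pair 2 (Nat.pair A.code B.code)
  | .or A B => Nat.pair 3 (Nat.pair A.code B.code)
  | .imp A B => Nat.pair 4 (Nat.pair A.code B.code)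
  | .all A => Nat.pair 5 A.code
  | .ex A => Nat.pair 6 A.code

/-- `P(⌜A⌝)`: the numeral of the Gödel number of `A` put for the variable with index `0` in `P`. -/
def boxOf (P A : Fml) : Fml := P.inst (num A.code)

/-! ## Intuitionistic predicate logic with equality -/

/-- Natural deduction for intuitionistic predicate logic with equality: `Derives Ax Γ A` says that
`A` is derivable from the open assumptions `Γ` and the formulas in `Ax`. Formulas in `Ax` may have
free variables; they are rules without premises, and put no restriction on eigenvariables. -/
inductive Derives (Ax : Set Fml) : List Fml → Fml → Prop
  | ax {Γ : List Fml} {A : Fml} : A ∈ Ax → Derives Ax Γ A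
  | hyp {Γ : List Fml} {A : Fml} : A ∈ Γ → Derives Ax Γ A
  | botE {Γ : List Fml} {A : Fml} : Derives Ax Γ .bot → Derives Ax Γ A
  | andI {Γ : List Fml} {A B : Fml} :
      Derives Ax Γ A → Derives Ax Γ B → Derives Ax Γ (.and A B)
  | andE₁ {Γ : List Fml} {A B : Fml} : Derives Ax Γ (.and A B) → Derives Ax Γ A
  | andE₂ {Γ : List Fml} {A B : Fml} : Derives Ax Γ (.and A B) → Derives Ax Γ B
  | orI₁ {Γ : List Fml} {A B : Fml} : Derives Ax Γ A → Derives Ax Γ (.or A B)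
  | orI₂ {Γ : List Fml} {A B : Fml} : Derives Ax Γ B → Derives Ax Γ (.or A B)
  | orE {Γ : List Fml} {A B C : Fml} : Derives Ax Γ (.or A B) →
      Derives Ax (A :: Γ) C → Derives Ax (B :: Γ) C → Derives Ax Γ C
  | impI {Γ : List Fml} {A B : Fml} : Derives Ax (A :: Γ) B → Derives Ax Γ (.imp A B)
  | impE {Γ : List Fml} {A B : Fml} :
      Derives Ax Γ (.imp A B) → Derives Ax Γ A → Derives Ax Γ B
  | allI {Γ : List Fml} {A : Fml} : Derives Ax (Γ.map Fml.shift) A → Derives Ax Γ (.all A)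
  | allE {Γ : List Fml} {A : Fml} (t : Tm) : Derives Ax Γ (.all A) → Derives Ax Γ (A.inst t)
  | exI {Γ : List Fml} {A : Fml} (t : Tm) : Derives Ax Γ (A.inst t) → Derives Ax Γ (.ex A)
  | exE {Γ : List Fml} {A B : Fml} : Derives Ax Γ (.ex A) →
      Derives Ax (A :: Γ.map Fml.shift) B.shift → Derives Ax Γ B
  | eqRefl {Γ : List Fml} (t : Tm) : Derives Ax Γ (.eq t t)
  | eqSubst {Γ : List Fml} {s t : Tm} (A : Fml) : Derives Ax Γ (A.inst s) →
      Derives Ax Γ (.eq s t) → Derives Ax Γ (A.inst t)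

/-- The induction formula `A[0/x] ∧ ∀ x (A → A[S x/x]) → ∀ x A`, where `x` has index `0` in `A`. -/
def inductionFml (A : Fml) : Fml :=
  .imp (.and (A.inst .zero) (.all (.imp A (A.subst succSubst)))) (.all A)

/-- The axioms of intuitionistic `Σ₁`-induction `iIΣ₁`. -/
inductive ISigma1Ax : Fml → Prop
  | succ_ne_zero : ISigma1Ax (.imp (.eq (.succ (.var 0)) .zero) .bot)
  | succ_inj : ISigma1Ax
      (.imp (.eq (.succ (.var 0)) (.succ (.var 1))) (.eq (.var 0) (.var 1)))
  | add_zero : ISigma1Ax (.eq (.add (.var 0) .zero) (.var 0))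
  | add_succ : ISigma1Ax
      (.eq (.add (.var 0) (.succ (.var 1))) (.succ (.add (.var 0) (.var 1))))
  | mul_zero : ISigma1Ax (.eq (.mul (.var 0) .zero) .zero)
  | mul_succ : ISigma1Ax
      (.eq (.mul (.var 0) (.succ (.var 1))) (.add (.mul (.var 0) (.var 1)) (.var 0)))
  | induction {S : Fml} : IsSigma1 S → ISigma1Ax (inductionFml S)

/-- `A` is a theorem of `iIΣ₁`. -/
def ISigma1Proves (A : Fml) : Prop := Derives {B | ISigma1Ax B} [] A

/-- A theory is given by a `Σ₁`-formula in one free variable, which defines in the standard model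
the set of Gödel numbers of its axioms. -/
structure ArithTheory where
  /-- The formula that defines the axioms. -/
  ax : Fml
  ax_sigma1 : IsSigma1 ax
  ax_freeBelow : ax.FreeBelow 1

/-- `⊢_T A`. -/
def ArithTheory.Proves (T : ArithTheory) (A : Fml) : Prop :=
  Derives {B | TrueInN (boxOf T.ax B)} [] A

/-- `T` extends `iIΣ₁`. -/
def ArithTheory.ExtendsISigma1 (T : ArithTheory) : Prop := ∀ A, ISigma1Proves A → T.Proves A

/-- `T` is `Σ₁`-sound. -/
def ArithTheory.Sigma1Sound (T : ArithTheory) : Prop :=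
  ∀ S : Fml, IsSigma1 S → S.IsSentence → T.Proves S → TrueInN S

/-! ## Provability predicates and good pairs -/

/-- `P` is a provability predicate for `T`. -/
structure IsProvabilityPredicate (T : ArithTheory) (P : Fml) : Prop where
  sigma1 : IsSigma1 P
  freeBelow : P.FreeBelow 1
  of_proves : ∀ A : Fml, A.IsSentence → T.Proves A → TrueInN (boxOf P A)
  distrib : ∀ A B : Fml, A.IsSentence → B.IsSentence →
    ISigma1Proves (.imp (boxOf P (.imp A B)) (.imp (boxOf P A) (boxOf P B)))
  sigma1_complete : ∀ S : Fml, IsSigma1 S → S.IsSentence → ISigma1Proves (.imp S (boxOf P S))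

/-- `T` proves the completeness principle `A → □A` for `P`. -/
def ProvesCP (T : ArithTheory) (P : Fml) : Prop :=
  ∀ A : Fml, A.IsSentence → T.Proves (.imp A (boxOf P A))

/-- `T` proves the strong Löb principle `(□A → A) → A` for `P`. -/
def ProvesSLP (T : ArithTheory) (P : Fml) : Prop :=
  ∀ A : Fml, A.IsSentence → T.Proves (.imp (.imp (boxOf P A) A) A)

/-- `(P, Q)` is a good pair for `T`. -/
structure IsGoodPair (T : ArithTheory) (P Q : Fml) : Prop where
  left : IsProvabilityPredicate T P
  right : IsProvabilityPredicate T Q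
  sound : ∀ A : Fml, A.IsSentence → TrueInN (boxOf P A) → T.Proves A
  slp : ProvesSLP T Q
  box_tri : ∀ S : Fml, IsSigma1 S → S.IsSentence →
    T.Proves (.imp (boxOf P (boxOf Q S)) (boxOf P S))

/-! ## Intuitionistic modal logic -/

/-- Sentences of the language of intuitionistic modal logic; proposition letters are numbered. -/
inductive MFml : Type
  | letter : ℕ → MFml
  | bot : MFml
  | and : MFml → MFml → MFml
  | or : MFml → MFml → MFml
  | imp : MFml → MFml → MFml
  | box : MFml → MFml

/-- The substitution instances in the modal language of the tautologies of intuitionistic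
propositional logic, through the standard Hilbert system for that logic. -/
inductive IntTaut : MFml → Prop
  | imp_k (A B : MFml) : IntTaut (.imp A (.imp B A))
  | imp_s (A B C : MFml) :
      IntTaut (.imp (.imp A (.imp B C)) (.imp (.imp A B) (.imp A C)))
  | and_left (A B : MFml) : IntTaut (.imp (.and A B) A)
  | and_right (A B : MFml) : IntTaut (.imp (.and A B) B)
  | and_intro (A B : MFml) : IntTaut (.imp A (.imp B (.and A B)))
  | or_left (A B : MFml) : IntTaut (.imp A (.or A B))
  | or_right (A B : MFml) : IntTaut (.imp B (.or A B))
  | or_elim (A B C : MFml) :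
      IntTaut (.imp (.imp A C) (.imp (.imp B C) (.imp (.or A B) C)))
  | bot_elim (A : MFml) : IntTaut (.imp .bot A)
  | mp {A B : MFml} : IntTaut A → IntTaut (.imp A B) → IntTaut B

/-- The theorems of `iK`. -/
inductive IK : MFml → Prop
  | taut {A : MFml} : IntTaut A → IK A
  | distrib (A B : MFml) : IK (.imp (.box (.imp A B)) (.imp (.box A) (.box B)))
  | mp {A B : MFml} : IK A → IK (.imp A B) → IK B
  | nec {A : MFml} : IK A → IK (.box A)

/-- The theorems of `iGL`. -/
inductive IGL : MFml → Prop
  | of_iK {A : MFml} : IK A → IGL A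
  | loeb (A : MFml) : IGL (.imp (.box (.imp (.box A) A)) (.box A))
  | mp {A B : MFml} : IGL A → IGL (.imp A B) → IGL B
  | nec {A : MFml} : IGL A → IGL (.box A)

/-- The theorems of `iGLC`. -/
inductive IGLC : MFml → Prop
  | of_iGL {A : MFml} : IGL A → IGLC A
  | completeness (A : MFml) : IGLC (.imp A (.box A))
  | mp {A B : MFml} : IGLC A → IGLC (.imp A B) → IGLC B
  | nec {A : MFml} : IGLC A → IGLC (.box A)

/-! ## The logics of a provability predicate -/

/-- A realization assigns sentences of arithmetic to the proposition letters. -/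
def IsRealization (σ : ℕ → Fml) : Prop := ∀ p, (σ p).IsSentence

/-- A `Σ₁`-realization assigns `Σ₁`-sentences to the proposition letters. -/
def IsSigma1Realization (σ : ℕ → Fml) : Prop := ∀ p, (σ p).IsSentence ∧ IsSigma1 (σ p)

/-- The extension `σ_P` of a realization `σ` to all modal sentences. -/
def realize (P : Fml) (σ : ℕ → Fml) : MFml → Fml
  | .letter p => σ p
  | .bot => .bot
  | .and A B => .and (realize P σ A) (realize P σ B)
  | .or A B => .or (realize P σ A) (realize P σ B)
  | .imp A B => .imp (realize P σ A) (realize P σ B)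
  | .box A => boxOf P (realize P σ A)

/-- The logic for `P` with respect to `T`. -/
def logicOf (T : ArithTheory) (P : Fml) : Set MFml :=
  {A | ∀ σ : ℕ → Fml, IsRealization σ → T.Proves (realize P σ A)}

/-- The `Σ₁`-logic for `P` with respect to `T`. -/
def sigma1LogicOf (T : ArithTheory) (P : Fml) : Set MFml :=
  {A | ∀ σ : ℕ → Fml, IsSigma1Realization σ → T.Proves (realize P σ A)}

end IntArith

/-!
The inclusions that carry weight are the soundness of `iGLC` for arbitrary realizations and its
completeness for `Σ₁`-realizations.

*Soundness.* In the Heyting algebra of sentences modulo `T`-provable equivalence, `□` is an operator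
that preserves `⊤`, distributes over implication and satisfies `a ≤ □a`. Löb's principle follows from
a fixed point `r = □(r → a)`: then `r ≤ □a`, so that `□(□a → a) ≤ □(r → a) = r ≤ □a` (`op_loeb`).

*Completeness.* If `iGLC` does not prove `A`, then `A` fails in a finite Kripke model with an order
`≤` and a modal relation `⊏` that is contained in the strict order, and such that `i ≤ j ⊏ k` implies
`i ⊏ k` (`exists_countermodel`). A variant of Solovay's construction embeds the model into arithmetic. Let
`X` say that some world is reached, and `Z_k` that some world not below `k` is reached. From the
current world `i`, a proof of `X → Z_k` in the sense of `□` makes the race move to `k` if `i ⊏ k`, and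
one in the sense of `△` does so if `i < k`; the proof with the least code decides. Since the model is
finite and a state has at most one successor, "`i` is reached" can be written as a `Σ`-formula without
coding sequences: it is a finite disjunction over the ways to get to `i` of statements about least
witnesses (`Race.reachF`), made self-referential by diagonalization (`fixed`).

The rest is algebra (`IsSolovay`). Reaching `i` implies `□`-provably reaching a world `⊏`-above `i`
(`IsSolovay.le_box_supOn_rel`): the last move to `i` came from a proof that `i` is left or avoided, so
that provably some `j > i` is reached, and if `¬ i ⊏ j` then `j` is reached by a `△`-move, hence
`△`-provably left, and `□△S → □S` removes the triangle. The strong Löb principle for `△` handles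
implication: a proof of `X_U`, for the set `U` of worlds that force `B → C`, would move the race to a
world that forces `B` but not `C`. It follows that a modal sentence `B` is equivalent, once the race
has left its initial state, to the disjunction of "`i` is reached" over the worlds `i` that force `B`
(`IsSolovay.interp_iff`). By soundness the race in fact never starts (`IsSolovay.ne_top`), so that `T`
cannot prove the realization of `A`.

All that `iIΣ₁` has to prove are implications between `Σ`-sentences. By `iSigma1Proves_imp` it is
enough to check them in classical structures with a least number principle for `Δ₀`-formulas: an
underivable formula is avoided by a prime theory with Henkin witnesses (`exists_prime`), and since
`iIΣ₁` decides all `Δ₀`-formulas (`IsDelta0.decided`), membership in the prime theory agrees with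
classical truth in its term model for all `Σ`-formulas (`IsSigma.truth`).
-/

namespace IntArith

/-! ### Substitution -/

theorem Tm.subst_subst (σ τ : ℕ → Tm) (t : Tm) :
    (t.subst σ).subst τ = t.subst fun i => (σ i).subst τ := by
  induction t <;> simp_all [Tm.subst]

theorem Tm.subst_var (t : Tm) : t.subst Tm.var = t := by
  induction t <;> simp_all [Tm.subst]

theorem Tm.shift_subst (σ : ℕ → Tm) (t : Tm) :
    t.shift.subst σ = t.subst fun i => σ (i + 1) := by
  simp [Tm.shift, Tm.subst_subst, Tm.subst]

theorem Tm.subst_shift (σ : ℕ → Tm) (t : Tm) :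
    (t.subst σ).shift = t.subst fun i => (σ i).shift := by
  simp [Tm.shift, Tm.subst_subst]

theorem up_var : up Tm.var = Tm.var := by
  funext i; cases i <;> simp [up, Tm.shift, Tm.subst]

theorem up_subst (σ τ : ℕ → Tm) :
    (fun i => (up σ i).subst (up τ)) = up fun i => (σ i).subst τ := by
  funext i
  cases i with
  | zero => simp [up, Tm.subst]
  | succ i => simp only [up, Tm.shift_subst, Tm.subst_shift]

theorem Fml.subst_subst (A : Fml) (σ τ : ℕ → Tm) :
    (A.subst σ).subst τ = A.subst fun i => (σ i).subst τ := by
  induction A generalizing σ τ <;> simp_all [Fml.subst, Tm.subst_subst, up_subst]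

theorem Fml.subst_var (A : Fml) : A.subst Tm.var = A := by
  induction A <;> simp_all [Fml.subst, Tm.subst_var, up_var]

/-- The substitution that puts `t` for the variable with index `0` and `σ i` for the one with index
`i + 1`. -/
def consSubst (t : Tm) (σ : ℕ → Tm) : ℕ → Tm
  | 0 => t
  | i + 1 => σ i

theorem Fml.shift_subst (σ : ℕ → Tm) (A : Fml) :
    A.shift.subst σ = A.subst fun i => σ (i + 1) := by
  simp [Fml.shift, Fml.subst_subst, Tm.subst]

theorem Fml.shift_subst_up (σ : ℕ → Tm) (A : Fml) :
    A.shift.subst (up σ) = (A.subst σ).shift := by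
  simp [Fml.shift, Fml.subst_subst, Tm.subst, up, Tm.shift]

theorem Fml.shift_inst (A : Fml) (t : Tm) : A.shift.inst t = A := by
  rw [Fml.inst, Fml.shift_subst]; exact A.subst_var

theorem up_inst (σ : ℕ → Tm) (t : Tm) :
    (fun i => (up σ i).subst (instSubst t)) = consSubst t σ := by
  funext i
  cases i with
  | zero => simp [up, Tm.subst, instSubst, consSubst]
  | succ i => simpa [up, Tm.shift_subst, instSubst, consSubst] using Tm.subst_var _

theorem Fml.subst_up_inst (A : Fml) (σ : ℕ → Tm) (t : Tm) :
    (A.subst (up σ)).inst t = A.subst (consSubst t σ) := by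
  rw [Fml.inst, Fml.subst_subst, up_inst]

theorem instSubst_subst (σ : ℕ → Tm) (t : Tm) :
    (fun i => (instSubst t i).subst σ) = consSubst (t.subst σ) σ := by
  funext i; cases i <;> simp [instSubst, consSubst, Tm.subst]

theorem Fml.inst_subst (A : Fml) (σ : ℕ → Tm) (t : Tm) :
    (A.inst t).subst σ = (A.subst (up σ)).inst (t.subst σ) := by
  rw [Fml.subst_up_inst, Fml.inst, Fml.subst_subst, instSubst_subst]

theorem ltF_subst (σ : ℕ → Tm) (s t : Tm) :
    (ltF s t).subst σ = ltF (s.subst σ) (t.subst σ) := by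
  simp [ltF, Fml.subst, Tm.subst, Tm.shift_subst, Tm.subst_shift, up]

theorem Tm.shift_subst_up (σ : ℕ → Tm) (t : Tm) :
    t.shift.subst (up σ) = (t.subst σ).shift := by
  simp only [Tm.shift_subst, Tm.subst_shift, up]

theorem IsDelta0.subst {A : Fml} (h : IsDelta0 A) (σ : ℕ → Tm) : IsDelta0 (A.subst σ) := by
  induction h generalizing σ with
  | bot => exact .bot
  | eq s t => exact .eq _ _
  | and _ _ h₁ h₂ => exact .and (h₁ σ) (h₂ σ)
  | or _ _ h₁ h₂ => exact .or (h₁ σ) (h₂ σ)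
  | imp _ _ h₁ h₂ => exact .imp (h₁ σ) (h₂ σ)
  | bex t _ h =>
    simp only [Fml.subst, ltF_subst, Tm.shift_subst_up]
    exact .bex _ (h _)
  | ball t _ h =>
    simp only [Fml.subst, ltF_subst, Tm.shift_subst_up]
    exact .ball _ (h _)

/-! ### Free variables -/

theorem Tm.FreeBelow.mono {n m : ℕ} (h : n ≤ m) {t : Tm} (ht : t.FreeBelow n) :
    t.FreeBelow m := by
  induction t with
  | var i => exact lt_of_lt_of_le ht h
  | zero => trivial
  | succ t ih => exact ih ht
  | add s t ihs iht => exact ⟨ihs ht.1, iht ht.2⟩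
  | mul s t ihs iht => exact ⟨ihs ht.1, iht ht.2⟩

theorem Fml.FreeBelow.mono {n m : ℕ} (h : n ≤ m) {A : Fml} (hA : A.FreeBelow n) :
    A.FreeBelow m := by
  induction A generalizing n m with
  | bot => trivial
  | eq s t => exact ⟨hA.1.mono h, hA.2.mono h⟩
  | and A B ihA ihB => exact ⟨ihA h hA.1, ihB h hA.2⟩
  | or A B ihA ihB => exact ⟨ihA h hA.1, ihB h hA.2⟩
  | imp A B ihA ihB => exact ⟨ihA h hA.1, ihB h hA.2⟩
  | all A ih => exact ih (Nat.succ_le_succ h) hA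
  | ex A ih => exact ih (Nat.succ_le_succ h) hA

theorem Tm.exists_freeBelow (t : Tm) : ∃ n, t.FreeBelow n := by
  induction t with
  | var i => exact ⟨i + 1, Nat.lt_succ_self i⟩
  | zero => exact ⟨0, trivial⟩
  | succ t ih => exact ih
  | add s t ihs iht =>
    obtain ⟨n, hn⟩ := ihs; obtain ⟨m, hm⟩ := iht
    exact ⟨max n m, hn.mono (le_max_left _ _), hm.mono (le_max_right _ _)⟩
  | mul s t ihs iht =>
    obtain ⟨n, hn⟩ := ihs; obtain ⟨m, hm⟩ := iht
    exact ⟨max n m, hn.mono (le_max_left _ _), hm.mono (le_max_right _ _)⟩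

theorem Fml.exists_freeBelow (A : Fml) : ∃ n, A.FreeBelow n := by
  induction A with
  | bot => exact ⟨0, trivial⟩
  | eq s t =>
    obtain ⟨n, hn⟩ := s.exists_freeBelow; obtain ⟨m, hm⟩ := t.exists_freeBelow
    exact ⟨max n m, hn.mono (le_max_left _ _), hm.mono (le_max_right _ _)⟩
  | and A B ihA ihB =>
    obtain ⟨n, hn⟩ := ihA; obtain ⟨m, hm⟩ := ihB
    exact ⟨max n m, hn.mono (le_max_left _ _), hm.mono (le_max_right _ _)⟩
  | or A B ihA ihB =>
    obtain ⟨n, hn⟩ := ihA; obtain ⟨m, hm⟩ := ihB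
    exact ⟨max n m, hn.mono (le_max_left _ _), hm.mono (le_max_right _ _)⟩
  | imp A B ihA ihB =>
    obtain ⟨n, hn⟩ := ihA; obtain ⟨m, hm⟩ := ihB
    exact ⟨max n m, hn.mono (le_max_left _ _), hm.mono (le_max_right _ _)⟩
  | all A ih => obtain ⟨n, hn⟩ := ih; exact ⟨n, hn.mono (Nat.le_succ n)⟩
  | ex A ih => obtain ⟨n, hn⟩ := ih; exact ⟨n, hn.mono (Nat.le_succ n)⟩

theorem Tm.subst_congr {n : ℕ} {t : Tm} (ht : t.FreeBelow n) {σ τ : ℕ → Tm}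
    (h : ∀ i < n, σ i = τ i) : t.subst σ = t.subst τ := by
  induction t with
  | var i => exact h i ht
  | zero => rfl
  | succ t ih => simp only [Tm.subst, ih ht]
  | add s t ihs iht => simp only [Tm.subst, ihs ht.1, iht ht.2]
  | mul s t ihs iht => simp only [Tm.subst, ihs ht.1, iht ht.2]

theorem up_congr {n : ℕ} {σ τ : ℕ → Tm} (h : ∀ i < n, σ i = τ i) :
    ∀ i < n + 1, up σ i = up τ i := by
  intro i hi
  cases i with
  | zero => rfl
  | succ i => simp only [up, h i (Nat.lt_of_succ_lt_succ hi)]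

theorem Fml.subst_congr {n : ℕ} {A : Fml} (hA : A.FreeBelow n) {σ τ : ℕ → Tm}
    (h : ∀ i < n, σ i = τ i) : A.subst σ = A.subst τ := by
  induction A generalizing n σ τ with
  | bot => rfl
  | eq s t => simp only [Fml.subst, Tm.subst_congr hA.1 h, Tm.subst_congr hA.2 h]
  | and A B ihA ihB => simp only [Fml.subst, ihA hA.1 h, ihB hA.2 h]
  | or A B ihA ihB => simp only [Fml.subst, ihA hA.1 h, ihB hA.2 h]
  | imp A B ihA ihB => simp only [Fml.subst, ihA hA.1 h, ihB hA.2 h]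
  | all A ih => simp only [Fml.subst, ih hA (up_congr h)]
  | ex A ih => simp only [Fml.subst, ih hA (up_congr h)]

theorem Tm.FreeBelow.subst {n m : ℕ} {t : Tm} (ht : t.FreeBelow n) {σ : ℕ → Tm}
    (h : ∀ i < n, (σ i).FreeBelow m) : (t.subst σ).FreeBelow m := by
  induction t with
  | var i => exact h i ht
  | zero => trivial
  | succ t ih => exact ih ht
  | add s t ihs iht => exact ⟨ihs ht.1, iht ht.2⟩
  | mul s t ihs iht => exact ⟨ihs ht.1, iht ht.2⟩

theorem Tm.FreeBelow.shift {n : ℕ} {t : Tm} (ht : t.FreeBelow n) : t.shift.FreeBelow (n + 1) :=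
  ht.subst fun _ hi => Nat.succ_lt_succ hi

theorem freeBelow_up {n m : ℕ} {σ : ℕ → Tm} (h : ∀ i < n, (σ i).FreeBelow m) :
    ∀ i < n + 1, (up σ i).FreeBelow (m + 1) := by
  intro i hi
  cases i with
  | zero => exact Nat.succ_pos m
  | succ i => exact (h i (Nat.lt_of_succ_lt_succ hi)).shift

theorem Fml.FreeBelow.subst {n m : ℕ} {A : Fml} (hA : A.FreeBelow n) {σ : ℕ → Tm}
    (h : ∀ i < n, (σ i).FreeBelow m) : (A.subst σ).FreeBelow m := by
  induction A generalizing n m σ with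
  | bot => trivial
  | eq s t => exact ⟨hA.1.subst h, hA.2.subst h⟩
  | and A B ihA ihB => exact ⟨ihA hA.1 h, ihB hA.2 h⟩
  | or A B ihA ihB => exact ⟨ihA hA.1 h, ihB hA.2 h⟩
  | imp A B ihA ihB => exact ⟨ihA hA.1 h, ihB hA.2 h⟩
  | all A ih => exact ih hA (freeBelow_up h)
  | ex A ih => exact ih hA (freeBelow_up h)

/-! ### Derivations -/

section Derivations

variable {Ax : Set Fml} {Γ Δ : List Fml} {A B C : Fml}

theorem Derives.weaken (h : Derives Ax Γ A) (hs : Γ ⊆ Δ) : Derives Ax Δ A := by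
  induction h generalizing Δ with
  | ax h => exact .ax h
  | hyp h => exact .hyp (hs h)
  | botE _ ih => exact .botE (ih hs)
  | andI _ _ ih₁ ih₂ => exact .andI (ih₁ hs) (ih₂ hs)
  | andE₁ _ ih => exact .andE₁ (ih hs)
  | andE₂ _ ih => exact .andE₂ (ih hs)
  | orI₁ _ ih => exact .orI₁ (ih hs)
  | orI₂ _ ih => exact .orI₂ (ih hs)
  | orE _ _ _ ih ih₁ ih₂ =>
    exact .orE (ih hs) (ih₁ (List.cons_subset_cons _ hs)) (ih₂ (List.cons_subset_cons _ hs))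
  | impI _ ih => exact .impI (ih (List.cons_subset_cons _ hs))
  | impE _ _ ih₁ ih₂ => exact .impE (ih₁ hs) (ih₂ hs)
  | allI _ ih => exact .allI (ih (List.map_subset _ hs))
  | allE t _ ih => exact .allE t (ih hs)
  | exI t _ ih => exact .exI t (ih hs)
  | exE _ _ ih₁ ih₂ => exact .exE (ih₁ hs) (ih₂ (List.cons_subset_cons _ (List.map_subset _ hs)))
  | eqRefl t => exact .eqRefl t
  | eqSubst A _ _ ih₁ ih₂ => exact .eqSubst A (ih₁ hs) (ih₂ hs)

theorem Derives.of_nil (h : Derives Ax [] A) : Derives Ax Γ A := h.weaken (List.nil_subset _)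

theorem Derives.cut (h₁ : Derives Ax Γ A) (h₂ : Derives Ax (A :: Γ) B) : Derives Ax Γ B :=
  .impE (.impI h₂) h₁

theorem derives_imp_iff : Derives Ax Γ (.imp A B) ↔ Derives Ax (A :: Γ) B :=
  ⟨fun h => .impE (h.weaken (List.subset_cons_self _ _)) (.hyp (by simp)), .impI⟩

/-- A theorem remains one under every substitution of terms for its free variables, because the
variables with indices `0, 1, …` can be generalized and instantiated one after the other. -/
theorem Derives.subst_nil (h : Derives Ax [] A) (σ : ℕ → Tm) : Derives Ax [] (A.subst σ) := by
  obtain ⟨n, hn⟩ := A.exists_freeBelow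
  -- The terms put in by the first `k` instantiations are shifted past the `n - k` variables that
  -- are still to be replaced.
  have key : ∀ k ≤ n, Derives Ax [] (A.subst fun i =>
      if i < k then (σ i).subst (fun j => .var (j + (n - k))) else .var (i - k)) := by
    intro k
    induction k with
    | zero => intro _; simpa using A.subst_var.symm ▸ h
    | succ k ih =>
      intro hk
      have h₁ := (Derives.allI (Γ := []) (ih (by omega))).allE
        ((σ k).subst (fun j => .var (j + (n - (k + 1)))))
      rw [Fml.inst, Fml.subst_subst] at h₁
      convert h₁ using 2
      funext i
      rcases lt_trichotomy i k with hi | rfl | hi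
      · have h2 : n - k = n - (k + 1) + 1 := by omega
        simp only [show i < k + 1 by omega, hi, if_true, Tm.subst_subst, h2]
        congr 1
      · simp [Tm.subst, instSubst]
      · have h2 : i - k = i - (k + 1) + 1 := by omega
        simp only [show ¬ i < k + 1 by omega, show ¬ i < k by omega, if_false, h2]
        rfl
  have := key n le_rfl
  rw [Fml.subst_congr hn (τ := σ)] at this
  · exact this
  · intro i hi
    simpa [hi] using Tm.subst_var _

theorem Derives.subst (h : Derives Ax Γ A) (σ : ℕ → Tm) :
    Derives Ax (Γ.map (Fml.subst σ)) (A.subst σ) := by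
  have hmap : ∀ (Γ : List Fml) (σ : ℕ → Tm),
      (Γ.map Fml.shift).map (Fml.subst (up σ)) = (Γ.map (Fml.subst σ)).map Fml.shift := by
    intro Γ σ
    simp [List.map_map, Function.comp_def, Fml.shift_subst_up]
  induction h generalizing σ with
  | ax h => exact ((Derives.ax h).subst_nil σ).of_nil
  | hyp h => exact .hyp (List.mem_map_of_mem h)
  | botE _ ih => exact .botE (ih σ)
  | andI _ _ ih₁ ih₂ => exact .andI (ih₁ σ) (ih₂ σ)
  | andE₁ _ ih => exact .andE₁ (ih σ)
  | andE₂ _ ih => exact .andE₂ (ih σ)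
  | orI₁ _ ih => exact .orI₁ (ih σ)
  | orI₂ _ ih => exact .orI₂ (ih σ)
  | orE _ _ _ ih ih₁ ih₂ => exact .orE (ih σ) (ih₁ σ) (ih₂ σ)
  | impI _ ih => exact .impI (ih σ)
  | impE _ _ ih₁ ih₂ => exact .impE (ih₁ σ) (ih₂ σ)
  | allI _ ih => exact .allI (hmap _ σ ▸ ih (up σ))
  | allE t _ ih => rw [Fml.inst_subst]; exact .allE _ (ih σ)
  | exI t _ ih => exact .exI (t.subst σ) (Fml.inst_subst _ _ _ ▸ ih σ)
  | exE _ _ ih₁ ih₂ =>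
    refine .exE (ih₁ σ) ?_
    have := ih₂ (up σ)
    rwa [List.map_cons, hmap, Fml.shift_subst_up] at this
  | eqRefl t => exact .eqRefl _
  | eqSubst A _ _ ih₁ ih₂ =>
    rw [Fml.inst_subst]
    exact .eqSubst _ (Fml.inst_subst _ _ _ ▸ ih₁ σ) (ih₂ σ)

/-- Existence elimination with a variable as witness that does not occur elsewhere. -/
theorem Derives.exE_var {v : ℕ} (hΓ : ∀ B ∈ Γ, B.FreeBelow v) (hA : A.FreeBelow (v + 1))
    (hC : C.FreeBelow v) (h₁ : Derives Ax Γ (.ex A))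
    (h₂ : Derives Ax (A.inst (.var v) :: Γ) C) : Derives Ax Γ C := by
  refine .exE h₁ ?_
  have h := h₂.subst fun i => if i = v then .var 0 else .var (i + 1)
  rw [List.map_cons, Fml.inst, Fml.subst_subst] at h
  have hs : ∀ B : Fml, B.FreeBelow v →
      B.subst (fun i => if i = v then .var 0 else .var (i + 1)) = B.shift := fun B hB =>
    Fml.subst_congr hB fun i hi => by simp [hi.ne]
  rw [hs C hC, List.map_congr_left fun B hB => hs B (hΓ B hB)] at h
  convert h using 2
  rw [Fml.subst_congr hA (τ := Tm.var), A.subst_var]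
  intro i hi
  cases i with
  | zero => simp [instSubst, Tm.subst]
  | succ i => simp [instSubst, Tm.subst, show i ≠ v by omega]

end Derivations

/-! ### Gödel numbers are injective -/

theorem Tm.code_injective : Function.Injective Tm.code := by
  intro s
  induction s with
  | var i => intro t h; cases t <;> simp_all [Tm.code, Nat.pair_eq_pair]
  | zero => intro t h; cases t <;> simp_all [Tm.code, Nat.pair_eq_pair]
  | succ s ih =>
    intro t h
    cases t with
    | succ t =>
      simp only [Tm.code, Nat.pair_eq_pair, Nat.add_right_cancel_iff] at h
      rw [ih]
      rw [← Nat.pair_unpair s.code, ← Nat.pair_unpair t.code, h.1, h.2]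
    | _ => simp [Tm.code, Nat.pair_eq_pair] at h
  | add s s' ih ih' =>
    intro t h
    cases t <;> simp [Tm.code, Nat.pair_eq_pair] at h
    rw [ih h.1, ih' h.2]
  | mul s s' ih ih' =>
    intro t h
    cases t <;> simp [Tm.code, Nat.pair_eq_pair] at h
    rw [ih h.1, ih' h.2]

theorem Fml.code_injective : Function.Injective Fml.code := by
  intro A
  induction A with
  | bot => intro B h; cases B <;> simp_all [Fml.code, Nat.pair_eq_pair]
  | eq s t =>
    intro B h
    cases B <;> simp [Fml.code, Nat.pair_eq_pair] at h
    rw [Tm.code_injective h.1, Tm.code_injective h.2]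
  | and A A' ih ih' =>
    intro B h
    cases B <;> simp [Fml.code, Nat.pair_eq_pair] at h
    rw [ih h.1, ih' h.2]
  | or A A' ih ih' =>
    intro B h
    cases B <;> simp [Fml.code, Nat.pair_eq_pair] at h
    rw [ih h.1, ih' h.2]
  | imp A A' ih ih' =>
    intro B h
    cases B <;> simp [Fml.code, Nat.pair_eq_pair] at h
    rw [ih h.1, ih' h.2]
  | all A ih =>
    intro B h
    cases B <;> simp [Fml.code, Nat.pair_eq_pair] at h
    rw [ih h]
  | ex A ih =>
    intro B h
    cases B <;> simp [Fml.code, Nat.pair_eq_pair] at h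
    rw [ih h]

instance : Countable Fml := Fml.code_injective.countable

instance : Nonempty Fml := ⟨.bot⟩

/-! ### Structures for the language of arithmetic -/

/-- A structure for the language of arithmetic, with real equality. -/
class ArithStr (M : Type) where
  /-- The interpretation of `0`. -/
  zero : M
  /-- The interpretation of `S`. -/
  succ : M → M
  /-- The interpretation of `+`. -/
  add : M → M → M
  /-- The interpretation of `×`. -/
  mul : M → M → M

instance : ArithStr ℕ := ⟨0, Nat.succ, (· + ·), (· * ·)⟩

section Sat

variable {M : Type} [ArithStr M]

/-- Value of a term in a structure. -/
def Tm.val (e : ℕ → M) : Tm → M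
  | .var i => e i
  | .zero => ArithStr.zero
  | .succ t => ArithStr.succ (t.val e)
  | .add s t => ArithStr.add (s.val e) (t.val e)
  | .mul s t => ArithStr.mul (s.val e) (t.val e)

/-- The assignment that sends the variable with index `0` to `a` and the one with index `i + 1` to
`e i`. -/
def scons (a : M) (e : ℕ → M) : ℕ → M
  | 0 => a
  | i + 1 => e i

/-- Classical (Tarskian) satisfaction in a structure. -/
def Fml.Sat : (ℕ → M) → Fml → Prop
  | _, .bot => False
  | e, .eq s t => s.val e = t.val e
  | e, .and A B => A.Sat e ∧ B.Sat e
  | e, .or A B => A.Sat e ∨ B.Sat e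
  | e, .imp A B => A.Sat e → B.Sat e
  | e, .all A => ∀ a, A.Sat (scons a e)
  | e, .ex A => ∃ a, A.Sat (scons a e)

/-- The order of a structure, as defined by `ltF`. -/
def SLt (x y : M) : Prop := ∃ z, ArithStr.add x (ArithStr.succ z) = y

theorem Tm.val_subst (t : Tm) (σ : ℕ → Tm) (e : ℕ → M) :
    (t.subst σ).val e = t.val fun i => (σ i).val e := by
  induction t <;> simp_all [Tm.subst, Tm.val]

theorem Tm.val_shift (t : Tm) (a : M) (e : ℕ → M) : t.shift.val (scons a e) = t.val e := by
  rw [Tm.shift, Tm.val_subst]; rfl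

theorem val_up (σ : ℕ → Tm) (a : M) (e : ℕ → M) :
    (fun i => (up σ i).val (scons a e)) = scons a fun i => (σ i).val e := by
  funext i
  cases i with
  | zero => rfl
  | succ i => exact Tm.val_shift _ _ _

theorem Fml.sat_subst (A : Fml) (σ : ℕ → Tm) (e : ℕ → M) :
    (A.subst σ).Sat e ↔ A.Sat fun i => (σ i).val e := by
  induction A generalizing σ e <;> simp_all [Fml.subst, Fml.Sat, Tm.val_subst, val_up]

theorem Fml.sat_shift (A : Fml) (a : M) (e : ℕ → M) : A.shift.Sat (scons a e) ↔ A.Sat e := by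
  rw [Fml.shift, Fml.sat_subst]; rfl

theorem Fml.sat_inst (A : Fml) (t : Tm) (e : ℕ → M) :
    (A.inst t).Sat e ↔ A.Sat (scons (t.val e) e) := by
  rw [Fml.inst, Fml.sat_subst]
  have : (fun i => (instSubst t i).val e) = scons (t.val e) e := by
    funext i; cases i <;> rfl
  rw [this]

theorem sat_ltF (s t : Tm) (e : ℕ → M) : (ltF s t).Sat e ↔ SLt (s.val e) (t.val e) := by
  simp only [ltF, Fml.Sat, Tm.val, Tm.val_shift, SLt]; rfl

theorem Tm.val_congr {n : ℕ} {t : Tm} (ht : t.FreeBelow n) {e e' : ℕ → M}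
    (h : ∀ i < n, e i = e' i) : t.val e = t.val e' := by
  induction t with
  | var i => exact h i ht
  | zero => rfl
  | succ t ih => simp only [Tm.val, ih ht]
  | add s t ihs iht => simp only [Tm.val, ihs ht.1, iht ht.2]
  | mul s t ihs iht => simp only [Tm.val, ihs ht.1, iht ht.2]

omit [ArithStr M] in
theorem scons_congr {n : ℕ} {e e' : ℕ → M} (h : ∀ i < n, e i = e' i) (a : M) :
    ∀ i < n + 1, scons a e i = scons a e' i := by
  intro i hi
  cases i with
  | zero => rfl
  | succ i => exact h i (Nat.lt_of_succ_lt_succ hi)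

theorem Fml.sat_congr {n : ℕ} {A : Fml} (hA : A.FreeBelow n) {e e' : ℕ → M}
    (h : ∀ i < n, e i = e' i) : A.Sat e ↔ A.Sat e' := by
  induction A generalizing n e e' with
  | bot => rfl
  | eq s t => simp only [Fml.Sat, Tm.val_congr hA.1 h, Tm.val_congr hA.2 h]
  | and A B ihA ihB => simp only [Fml.Sat, ihA hA.1 h, ihB hA.2 h]
  | or A B ihA ihB => simp only [Fml.Sat, ihA hA.1 h, ihB hA.2 h]
  | imp A B ihA ihB => simp only [Fml.Sat, ihA hA.1 h, ihB hA.2 h]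
  | all A ih => exact forall_congr' fun a => ih hA (scons_congr h a)
  | ex A ih => exact exists_congr fun a => ih hA (scons_congr h a)

theorem Fml.IsSentence.sat_iff {A : Fml} (hA : A.IsSentence) (e e' : ℕ → M) :
    A.Sat e ↔ A.Sat e' :=
  Fml.sat_congr hA fun _ h => absurd h (Nat.not_lt_zero _)

end Sat

theorem Tm.val_nat (t : Tm) (e : ℕ → ℕ) : t.val e = t.eval e := by
  induction t <;> simp_all [Tm.val, Tm.eval] <;> rfl

theorem Fml.sat_nat (A : Fml) (e : ℕ → ℕ) : A.Sat e ↔ A.eval e := by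
  have : ∀ (a : ℕ) (e : ℕ → ℕ), scons a e = consAssign a e := by
    intro a e; funext i; cases i <;> rfl
  induction A generalizing e <;> simp_all [Fml.Sat, Fml.eval, Tm.val_nat]

/-! ### Prime theories -/

/-- A prime theory over the axioms `Ax`: deductively closed and consistent, with the disjunction
property and the existence property. The free variables serve as the Henkin constants. -/
structure IsPrime (Ax Θ : Set Fml) : Prop where
  closed : ∀ {Γ : List Fml} {A : Fml}, Derives Ax Γ A → (∀ B ∈ Γ, B ∈ Θ) → A ∈ Θ
  bot : Fml.bot ∉ Θ
  or : ∀ {A B : Fml}, Fml.or A B ∈ Θ → A ∈ Θ ∨ B ∈ Θ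
  ex : ∀ {A : Fml}, Fml.ex A ∈ Θ → ∃ t, A.inst t ∈ Θ

section PrimeTheories

variable {Ax : Set Fml}

theorem exists_freeBelow_list (Γ : List Fml) : ∃ n, ∀ B ∈ Γ, B.FreeBelow n := by
  induction Γ with
  | nil => exact ⟨0, by simp⟩
  | cons A Γ ih =>
    obtain ⟨n, hn⟩ := ih
    obtain ⟨m, hm⟩ := A.exists_freeBelow
    refine ⟨max n m, ?_⟩
    intro B hB
    rcases List.mem_cons.1 hB with rfl | hB
    · exact hm.mono (le_max_right _ _)
    · exact (hn B hB).mono (le_max_left _ _)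

/-- One step of the construction of a prime theory that does not contain `C`: the formula `A` is
added, with a witness if it is existential, unless this would make `C` derivable. -/
theorem exists_henkin_step {Γ : List Fml} {C : Fml} (h : ¬ Derives Ax Γ C) (A : Fml) :
    ∃ Γ' : List Fml, Γ ⊆ Γ' ∧ ¬ Derives Ax Γ' C ∧ (Derives Ax (A :: Γ) C ∨
      A ∈ Γ' ∧ ∀ B, A = .ex B → ∃ t, B.inst t ∈ Γ') := by
  by_cases hA : Derives Ax (A :: Γ) C
  · exact ⟨Γ, fun _ h => h, h, .inl hA⟩
  by_cases hex : ∃ B, A = .ex B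
  · obtain ⟨B, rfl⟩ := hex
    obtain ⟨v, hv⟩ := exists_freeBelow_list (C :: .ex B :: Γ)
    refine ⟨B.inst (.var v) :: .ex B :: Γ,
      fun _ h => List.mem_cons_of_mem _ (List.mem_cons_of_mem _ h), ?_, .inr ⟨by simp, ?_⟩⟩
    · intro h₂
      refine hA (Derives.exE_var (v := v) ?_ (A := B) ?_ ?_ (.hyp (by simp)) h₂)
      · exact fun D hD => hv D (List.mem_cons_of_mem _ hD)
      · exact hv (.ex B) (by simp)
      · exact hv C (by simp)
    · rintro B' h'
      cases h'
      exact ⟨.var v, by simp⟩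
  · exact ⟨A :: Γ, List.subset_cons_self _ _, hA, .inr ⟨by simp, fun B hB => absurd ⟨B, hB⟩ hex⟩⟩

/-- Henkin's lemma: an underivable formula is avoided by some prime theory. -/
theorem exists_prime {Γ : List Fml} {C : Fml} (h : ¬ Derives Ax Γ C) :
    ∃ Θ, IsPrime Ax Θ ∧ (∀ B ∈ Γ, B ∈ Θ) ∧ C ∉ Θ := by
  classical
  obtain ⟨f, hf⟩ := exists_surjective_nat Fml
  choose step hsub hcons hstep using
    fun (Δ : {Δ : List Fml // ¬ Derives Ax Δ C}) (A : Fml) => exists_henkin_step Δ.2 A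
  let s : ℕ → {Δ : List Fml // ¬ Derives Ax Δ C} :=
    Nat.rec ⟨Γ, h⟩ fun n Δ => ⟨step Δ (f n), hcons Δ (f n)⟩
  have hs : ∀ n, (s (n + 1)).1 = step (s n) (f n) := fun n => rfl
  have hmono : ∀ {m n}, m ≤ n → (s m).1 ⊆ (s n).1 := by
    intro m n hmn
    induction hmn with
    | refl => exact fun _ h => h
    | step _ ih => exact fun _ hB => hs _ ▸ hsub _ _ (ih hB)
  let Θ : Set Fml := {A | ∃ n, A ∈ (s n).1}
  have hfin : ∀ Δ : List Fml, (∀ B ∈ Δ, B ∈ Θ) → ∃ n, Δ ⊆ (s n).1 := by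
    intro Δ
    induction Δ with
    | nil => exact fun _ => ⟨0, by simp⟩
    | cons A Δ ih =>
      intro hΔ
      obtain ⟨n, hn⟩ := ih fun B hB => hΔ B (List.mem_cons_of_mem _ hB)
      obtain ⟨m, hm⟩ := hΔ A (by simp)
      refine ⟨max n m, ?_⟩
      intro B hB
      rcases List.mem_cons.1 hB with rfl | hB
      · exact hmono (le_max_right _ _) hm
      · exact hmono (le_max_left _ _) (hn hB)
  have hno : ∀ Δ : List Fml, (∀ B ∈ Δ, B ∈ Θ) → ¬ Derives Ax Δ C := by
    intro Δ hΔ hd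
    obtain ⟨n, hn⟩ := hfin Δ hΔ
    exact (s n).2 (hd.weaken hn)
  -- Every formula outside `Θ` implies `C` over `Θ`, and existential formulas in `Θ` have witnesses.
  have hmax : ∀ A, (∃ Δ : List Fml, (∀ B ∈ Δ, B ∈ Θ) ∧ Derives Ax (A :: Δ) C) ∨
      A ∈ Θ ∧ ∀ B, A = .ex B → ∃ t, B.inst t ∈ Θ := by
    intro A
    obtain ⟨n, rfl⟩ := hf A
    rcases hstep (s n) (f n) with hd | ⟨hA, hw⟩
    · exact .inl ⟨_, fun B hB => ⟨n, hB⟩, hd⟩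
    · refine .inr ⟨⟨n + 1, hA⟩, fun B hB => ?_⟩
      obtain ⟨t, ht⟩ := hw B hB
      exact ⟨t, n + 1, ht⟩
  have hclosed : ∀ {Δ : List Fml} {A : Fml}, Derives Ax Δ A → (∀ B ∈ Δ, B ∈ Θ) → A ∈ Θ := by
    intro Δ A hd hΔ
    rcases hmax A with ⟨Δ', hΔ', hd'⟩ | hA
    · refine absurd ((hd.weaken (List.subset_append_left Δ Δ')).cut (hd'.weaken
        (List.cons_subset_cons _ (List.subset_append_right Δ Δ')))) (hno _ ?_)
      intro B hB
      rcases List.mem_append.1 hB with hB | hB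
      exacts [hΔ B hB, hΔ' B hB]
    · exact hA.1
  refine ⟨Θ, ⟨hclosed, ?_, ?_, ?_⟩, fun B hB => ⟨0, hB⟩, ?_⟩
  · intro hb
    exact hno [.bot] (by simpa using hb) (.botE (.hyp (by simp)))
  · intro A B hAB
    rcases hmax A with ⟨Δ, hΔ, hd⟩ | hA
    · rcases hmax B with ⟨Δ', hΔ', hd'⟩ | hB
      · refine absurd ?_ (hno (.or A B :: (Δ ++ Δ')) ?_)
        · refine .orE (A := A) (B := B) (.hyp (by simp)) (hd.weaken ?_) (hd'.weaken ?_)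
          · exact List.cons_subset_cons _ fun D hD => by simp [hD]
          · exact List.cons_subset_cons _ fun D hD => by simp [hD]
        · intro D hD
          simp only [List.mem_cons, List.mem_append] at hD
          rcases hD with rfl | hD | hD
          exacts [hAB, hΔ D hD, hΔ' D hD]
      · exact .inr hB.1
    · exact .inl hA.1
  · intro A hA
    rcases hmax (.ex A) with ⟨Δ, hΔ, hd⟩ | hw
    · exact absurd hd (hno _ (by simpa using ⟨hA, hΔ⟩))
    · exact hw.2 A rfl
  · intro hC
    exact hno [C] (by simpa using hC) (.hyp (by simp))

theorem derives_of_prime {Γ : List Fml} {C : Fml}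
    (h : ∀ Θ, IsPrime Ax Θ → (∀ B ∈ Γ, B ∈ Θ) → C ∈ Θ) : Derives Ax Γ C := by
  by_contra hd
  obtain ⟨Θ, hΘ, hΓ, hC⟩ := exists_prime hd
  exact hC (h Θ hΘ hΓ)

/-! ### The term model of a prime theory -/

namespace IsPrime

variable {Θ : Set Fml} (hΘ : IsPrime Ax Θ)
include hΘ

theorem of_nil {A : Fml} (h : Derives Ax [] A) : A ∈ Θ := hΘ.closed h (by simp)

theorem mp {A B : Fml} (h : Fml.imp A B ∈ Θ) (hA : A ∈ Θ) : B ∈ Θ :=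
  hΘ.closed (Γ := [.imp A B, A]) (.impE (A := A) (.hyp (by simp)) (.hyp (by simp))) (by simp [h, hA])

theorem inst_of_all {A : Fml} (h : Fml.all A ∈ Θ) (t : Tm) : A.inst t ∈ Θ :=
  hΘ.closed (Γ := [.all A]) (.allE t (.hyp (by simp))) (by simp [h])

theorem and_iff {A B : Fml} : Fml.and A B ∈ Θ ↔ A ∈ Θ ∧ B ∈ Θ := by
  refine ⟨fun h => ⟨?_, ?_⟩, fun h => ?_⟩
  · exact hΘ.closed (Γ := [.and A B]) (.andE₁ (B := B) (.hyp (by simp))) (by simp [h])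
  · exact hΘ.closed (Γ := [.and A B]) (.andE₂ (A := A) (.hyp (by simp))) (by simp [h])
  · exact hΘ.closed (Γ := [A, B]) (.andI (.hyp (by simp)) (.hyp (by simp))) (by simp [h])

theorem or_iff {A B : Fml} : Fml.or A B ∈ Θ ↔ A ∈ Θ ∨ B ∈ Θ := by
  refine ⟨hΘ.or, fun h => ?_⟩
  rcases h with h | h
  · exact hΘ.closed (Γ := [A]) (.orI₁ (.hyp (by simp))) (by simp [h])
  · exact hΘ.closed (Γ := [B]) (.orI₂ (.hyp (by simp))) (by simp [h])

theorem ex_iff {A : Fml} : Fml.ex A ∈ Θ ↔ ∃ t, A.inst t ∈ Θ := by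
  refine ⟨hΘ.ex, fun ⟨t, h⟩ => ?_⟩
  exact hΘ.closed (Γ := [A.inst t]) (.exI t (.hyp (by simp))) (by simp [h])

theorem eq_refl (t : Tm) : Fml.eq t t ∈ Θ := hΘ.of_nil (.eqRefl t)

theorem eq_subst (A : Fml) {s t : Tm} (h : Fml.eq s t ∈ Θ) (hA : A.inst s ∈ Θ) : A.inst t ∈ Θ :=
  hΘ.closed (Γ := [A.inst s, .eq s t]) (.eqSubst (s := s) A (.hyp (by simp)) (.hyp (by simp)))
    (by simp [h, hA])

theorem eq_congr (u : Tm) {s t : Tm} (h : Fml.eq s t ∈ Θ) :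
    Fml.eq (u.subst (instSubst s)) (u.subst (instSubst t)) ∈ Θ := by
  have h₁ := hΘ.eq_subst (.eq (u.subst (instSubst s)).shift u) h
  simp only [Fml.inst, Fml.subst, Tm.shift_subst, instSubst] at h₁
  simpa [Tm.subst_var] using h₁ (by simpa [Tm.subst_var] using hΘ.eq_refl _)

theorem eq_symm {s t : Tm} (h : Fml.eq s t ∈ Θ) : Fml.eq t s ∈ Θ := by
  have h₁ := hΘ.eq_subst (.eq (.var 0) s.shift) h
  simp only [Fml.inst, Fml.subst, Tm.subst, Tm.shift_subst, instSubst] at h₁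
  simpa [Tm.subst_var] using h₁ (by simpa [Tm.subst_var] using hΘ.eq_refl _)

theorem eq_trans {s t u : Tm} (h : Fml.eq s t ∈ Θ) (h' : Fml.eq t u ∈ Θ) : Fml.eq s u ∈ Θ := by
  have h₁ := hΘ.eq_subst (.eq s.shift (.var 0)) h'
  simp only [Fml.inst, Fml.subst, Tm.subst, Tm.shift_subst, instSubst] at h₁
  simpa [Tm.subst_var] using h₁ (by simpa [Tm.subst_var] using h)

/-- Provable equality in a prime theory. -/
def setoid : Setoid Tm where
  r s t := Fml.eq s t ∈ Θ
  iseqv := ⟨hΘ.eq_refl, hΘ.eq_symm, hΘ.eq_trans⟩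

/-- The term model of a prime theory: terms up to provable equality. -/
def Model : Type := Quotient hΘ.setoid

/-- The element of the term model given by a term. -/
def cls (t : Tm) : hΘ.Model := Quotient.mk hΘ.setoid t

theorem cls_eq_iff {s t : Tm} : hΘ.cls s = hΘ.cls t ↔ Fml.eq s t ∈ Θ :=
  ⟨fun h => Quotient.exact h, fun h => Quotient.sound (s := hΘ.setoid) h⟩

theorem cls_surjective (x : hΘ.Model) : ∃ t, hΘ.cls t = x := Quotient.exists_rep x

instance : ArithStr hΘ.Model where
  zero := hΘ.cls .zero
  succ := Quotient.map (sa := hΘ.setoid) (sb := hΘ.setoid) Tm.succ fun s t h => by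
    change Fml.eq s.succ t.succ ∈ Θ
    simpa [Tm.subst, instSubst] using hΘ.eq_congr (.succ (.var 0)) h
  add := Quotient.map₂ (sa := hΘ.setoid) (sb := hΘ.setoid) (sc := hΘ.setoid) Tm.add
    fun s t h s' t' h' => by
      have h₁ := hΘ.eq_congr (.add (.var 0) s'.shift) h
      have h₂ := hΘ.eq_congr (.add t.shift (.var 0)) h'
      simp only [Tm.subst, Tm.shift_subst, instSubst] at h₁ h₂
      exact hΘ.eq_trans (by simpa [Tm.subst_var] using h₁) (by simpa [Tm.subst_var] using h₂)
  mul := Quotient.map₂ (sa := hΘ.setoid) (sb := hΘ.setoid) (sc := hΘ.setoid) Tm.mul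
    fun s t h s' t' h' => by
      have h₁ := hΘ.eq_congr (.mul (.var 0) s'.shift) h
      have h₂ := hΘ.eq_congr (.mul t.shift (.var 0)) h'
      simp only [Tm.subst, Tm.shift_subst, instSubst] at h₁ h₂
      exact hΘ.eq_trans (by simpa [Tm.subst_var] using h₁) (by simpa [Tm.subst_var] using h₂)

theorem val_cls (σ : ℕ → Tm) (t : Tm) : t.val (fun i => hΘ.cls (σ i)) = hΘ.cls (t.subst σ) := by
  induction t with
  | var i => rfl
  | zero => rfl
  | succ t ih => simp only [Tm.val, ih]; rfl
  | add s t ihs iht => simp only [Tm.val, ihs, iht]; rfl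
  | mul s t ihs iht => simp only [Tm.val, ihs, iht]; rfl

theorem scons_cls (t : Tm) (σ : ℕ → Tm) :
    scons (hΘ.cls t) (fun i => hΘ.cls (σ i)) = fun i => hΘ.cls (consSubst t σ i) := by
  funext i; cases i <;> rfl

/-- The instances of `A` that belong to the prime theory are those that hold in its term model. -/
def Truth (A : Fml) : Prop := ∀ σ : ℕ → Tm, A.Sat (fun i => hΘ.cls (σ i)) ↔ A.subst σ ∈ Θ

theorem truth_bot : hΘ.Truth .bot := fun _ => ⟨False.elim, hΘ.bot⟩

theorem truth_eq (s t : Tm) : hΘ.Truth (.eq s t) := fun σ => by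
  simp only [Fml.Sat, Fml.subst, val_cls, cls_eq_iff]

variable {hΘ} in
theorem Truth.and {A B : Fml} (hA : hΘ.Truth A) (hB : hΘ.Truth B) : hΘ.Truth (.and A B) :=
  fun σ => by simp only [Fml.Sat, Fml.subst, hΘ.and_iff, hA σ, hB σ]

variable {hΘ} in
theorem Truth.or {A B : Fml} (hA : hΘ.Truth A) (hB : hΘ.Truth B) : hΘ.Truth (.or A B) :=
  fun σ => by simp only [Fml.Sat, Fml.subst, hΘ.or_iff, hA σ, hB σ]

variable {hΘ} in
theorem Truth.ex {A : Fml} (hA : hΘ.Truth A) : hΘ.Truth (.ex A) := by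
  intro σ
  have h : ∀ t, A.Sat (scons (hΘ.cls t) fun i => hΘ.cls (σ i)) ↔
      (A.subst (up σ)).inst t ∈ Θ := fun t => by
    rw [Fml.subst_up_inst, ← hA (consSubst t σ), hΘ.scons_cls]
  simp only [Fml.Sat, Fml.subst, hΘ.ex_iff, ← h]
  constructor
  · rintro ⟨a, ha⟩
    obtain ⟨t, rfl⟩ := hΘ.cls_surjective a
    exact ⟨t, ha⟩
  · rintro ⟨t, ht⟩
    exact ⟨_, ht⟩

variable {hΘ} in
theorem Truth.imp {A B : Fml} (hA : hΘ.Truth A) (hB : hΘ.Truth B)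
    (hdec : ∀ σ, A.subst σ ∈ Θ ∨ Fml.imp (A.subst σ) .bot ∈ Θ) : hΘ.Truth (.imp A B) := by
  intro σ
  simp only [Fml.Sat, Fml.subst, hA σ, hB σ]
  refine ⟨fun h => ?_, hΘ.mp⟩
  rcases hdec σ with h₁ | h₁
  · exact hΘ.closed (Γ := [B.subst σ]) (.impI (.hyp (by simp))) (by simp [h h₁])
  · exact hΘ.closed (Γ := [.imp (A.subst σ) .bot])
      (.impI (.botE (.impE (A := A.subst σ) (.hyp (by simp)) (.hyp (by simp))))) (by simp [h₁])

theorem truth_ltF (s t : Tm) : hΘ.Truth (ltF s t) := (hΘ.truth_eq _ _).ex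

variable {hΘ} in
/-- The case of `Truth` where the free variables stand for themselves. -/
theorem Truth.mem_iff {A : Fml} (h : hΘ.Truth A) : A ∈ Θ ↔ A.Sat (fun i => hΘ.cls (.var i)) := by
  rw [h Tm.var, A.subst_var]

end IsPrime

end PrimeTheories

/-! ### Prime theories of `iIΣ₁` -/

/-- The axioms of `iIΣ₁`, as a set. -/
abbrev IAx : Set Fml := {B | ISigma1Ax B}

/-- Bounded universal quantification over the variable with index `0` of `A`. -/
def ball (t : Tm) (A : Fml) : Fml := .all (.imp (ltF (.var 0) t.shift) A)

/-- Bounded existential quantification over the variable with index `0` of `A`. -/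
def bex (t : Tm) (A : Fml) : Fml := .ex (.and (ltF (.var 0) t.shift) A)

/-- Negation. -/
def neg (A : Fml) : Fml := .imp A .bot

theorem ball_subst (t : Tm) (A : Fml) (σ : ℕ → Tm) :
    (ball t A).subst σ = ball (t.subst σ) (A.subst (up σ)) := by
  simp only [ball, Fml.subst, ltF_subst, Tm.shift_subst_up, Tm.subst, up]

theorem bex_subst (t : Tm) (A : Fml) (σ : ℕ → Tm) :
    (bex t A).subst σ = bex (t.subst σ) (A.subst (up σ)) := by
  simp only [bex, Fml.subst, ltF_subst, Tm.shift_subst_up, Tm.subst, up]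

theorem neg_subst (A : Fml) (σ : ℕ → Tm) : (neg A).subst σ = neg (A.subst σ) := rfl

theorem ltF_inst (t s : Tm) : (ltF (.var 0) t.shift).inst s = ltF s t := by
  rw [Fml.inst, ltF_subst, Tm.shift_subst]
  exact congrArg _ t.subst_var

theorem Fml.subst_up_shift_inst (A : Fml) (t : Tm) :
    (A.subst (up fun i => .var (i + 1))).subst (up (instSubst t)) = A := by
  rw [Fml.subst_subst, up_subst]
  simp only [Tm.subst, instSubst]
  exact (congrArg (fun σ => A.subst σ) up_var).trans A.subst_var

theorem Fml.subst_up_shift_inst_var (A : Fml) :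
    (A.subst (up fun i => .var (i + 1))).inst (.var 0) = A := by
  rw [Fml.subst_up_inst]
  convert A.subst_var using 2
  funext i; cases i <;> rfl

section BoundedQuantifiers

variable {M : Type} [ArithStr M]

theorem sat_ball (t : Tm) (A : Fml) (e : ℕ → M) :
    (ball t A).Sat e ↔ ∀ a, SLt a (t.val e) → A.Sat (scons a e) := by
  simp only [ball, Fml.Sat, sat_ltF, Tm.val_shift]; rfl

theorem sat_bex (t : Tm) (A : Fml) (e : ℕ → M) :
    (bex t A).Sat e ↔ ∃ a, SLt a (t.val e) ∧ A.Sat (scons a e) := by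
  simp only [bex, Fml.Sat, sat_ltF, Tm.val_shift]; rfl

theorem sat_neg (A : Fml) (e : ℕ → M) : (neg A).Sat e ↔ ¬ A.Sat e := Iff.rfl

end BoundedQuantifiers

namespace IsPrime

variable {Ax Θ : Set Fml}

theorem not_mem_of_neg (hΘ : IsPrime Ax Θ) {A : Fml} (h : neg A ∈ Θ) : A ∉ Θ :=
  fun hA => hΘ.bot (hΘ.mp h hA)

theorem bex_iff (hΘ : IsPrime Ax Θ) {t : Tm} {A : Fml} :
    bex t A ∈ Θ ↔ ∃ s, ltF s t ∈ Θ ∧ A.inst s ∈ Θ := by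
  refine hΘ.ex_iff.trans (exists_congr fun s => ?_)
  rw [← hΘ.and_iff, ← ltF_inst t s]; rfl

theorem inst_of_ball (hΘ : IsPrime Ax Θ) {s t : Tm} {A : Fml} (h : ball t A ∈ Θ)
    (hs : ltF s t ∈ Θ) : A.inst s ∈ Θ :=
  hΘ.mp (A := (ltF (.var 0) t.shift).inst s) (hΘ.inst_of_all h s) (ltF_inst t s ▸ hs)

/-- Negations may be introduced by contradiction with the members of a prime theory. -/
theorem neg_mem (hΘ : IsPrime Ax Θ) (Γ : List Fml) (hΓ : ∀ B ∈ Γ, B ∈ Θ) {A : Fml}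
    (h : ∀ Θ', IsPrime Ax Θ' → (∀ B ∈ Γ, B ∈ Θ') → A ∉ Θ') : neg A ∈ Θ := by
  refine hΘ.closed (.impI (derives_of_prime fun Θ' hΘ' hm => ?_)) hΓ
  simp only [List.mem_cons, forall_eq_or_imp] at hm
  exact absurd hm.1 (h Θ' hΘ' hm.2)

end IsPrime

/-- The induction rule of `iIΣ₁`, for `Σ₁`-formulas. -/
theorem sigma1_induction {S : Fml} (hS : IsSigma1 S) (h0 : Derives IAx [] (S.inst .zero))
    (h1 : Derives IAx [S] (S.subst succSubst)) (τ : ℕ → Tm) : Derives IAx [] (S.subst τ) := by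
  have h := (Derives.impE (Derives.ax (Ax := IAx) (Γ := []) (ISigma1Ax.induction hS))
    (.andI h0 (.allI (.impI h1)))).subst_nil fun i => τ (i + 1)
  have h2 := h.allE (τ 0)
  rw [Fml.subst_up_inst] at h2
  convert h2 using 2
  funext i; cases i <;> rfl

/-- The induction rule of `iIΣ₁`, for `Δ₀`-formulas; these become `Σ₁` by a dummy quantifier. -/
theorem delta0_induction {D : Fml} (hD : IsDelta0 D) (h0 : Derives IAx [] (D.inst .zero))
    (h1 : Derives IAx [D] (D.subst succSubst)) (τ : ℕ → Tm) : Derives IAx [] (D.subst τ) := by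
  have hs : ∀ σ, (Fml.ex D.shift).subst σ = .ex (D.subst σ).shift := fun σ => by
    simp only [Fml.subst, Fml.shift_subst_up]
  have key : ∀ {Θ : Set Fml} (_ : IsPrime IAx Θ) (B : Fml), Fml.ex B.shift ∈ Θ ↔ B ∈ Θ :=
    fun hΘ B => by
      simpa [hΘ.ex_iff, Fml.shift_inst] using fun _ => ⟨Tm.zero⟩
  have := sigma1_induction (S := .ex D.shift) ⟨_, hD.subst _, rfl⟩ ?_ ?_ τ
  · exact derives_of_prime fun Θ hΘ _ => (key hΘ _).1 (hs τ ▸ hΘ.of_nil this)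
  · rw [Fml.inst, hs]
    exact derives_of_prime fun Θ hΘ _ => (key hΘ _).2 (hΘ.of_nil h0)
  · rw [hs]
    refine derives_of_prime fun Θ hΘ hm => (key hΘ _).2 (hΘ.closed h1 ?_)
    simpa [key hΘ] using hm

namespace IsPrime

variable {Θ : Set Fml}

open ArithStr (zero succ add mul)

theorem subst_mem_of_ax (hΘ : IsPrime IAx Θ) {A : Fml} (h : ISigma1Ax A) (σ : ℕ → Tm) :
    A.subst σ ∈ Θ :=
  hΘ.of_nil ((Derives.ax h).subst_nil σ)

theorem succ_ne_zero (hΘ : IsPrime IAx Θ) (x : hΘ.Model) : succ x ≠ zero := by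
  obtain ⟨s, rfl⟩ := hΘ.cls_surjective x
  intro h
  exact hΘ.bot (hΘ.mp (hΘ.subst_mem_of_ax .succ_ne_zero fun _ => s) (hΘ.cls_eq_iff.1 h))

theorem succ_inj (hΘ : IsPrime IAx Θ) {x y : hΘ.Model} (h : succ x = succ y) : x = y := by
  obtain ⟨s, rfl⟩ := hΘ.cls_surjective x
  obtain ⟨t, rfl⟩ := hΘ.cls_surjective y
  exact hΘ.cls_eq_iff.2 (hΘ.mp (hΘ.subst_mem_of_ax .succ_inj (consSubst s fun _ => t))
    (hΘ.cls_eq_iff.1 h))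

theorem add_zero (hΘ : IsPrime IAx Θ) (x : hΘ.Model) : add x zero = x := by
  obtain ⟨s, rfl⟩ := hΘ.cls_surjective x
  exact hΘ.cls_eq_iff.2 (hΘ.subst_mem_of_ax .add_zero fun _ => s)

theorem add_succ (hΘ : IsPrime IAx Θ) (x y : hΘ.Model) : add x (succ y) = succ (add x y) := by
  obtain ⟨s, rfl⟩ := hΘ.cls_surjective x
  obtain ⟨t, rfl⟩ := hΘ.cls_surjective y
  exact hΘ.cls_eq_iff.2 (hΘ.subst_mem_of_ax .add_succ (consSubst s fun _ => t))

theorem mul_zero (hΘ : IsPrime IAx Θ) (x : hΘ.Model) : mul x zero = zero := by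
  obtain ⟨s, rfl⟩ := hΘ.cls_surjective x
  exact hΘ.cls_eq_iff.2 (hΘ.subst_mem_of_ax .mul_zero fun _ => s)

theorem mul_succ (hΘ : IsPrime IAx Θ) (x y : hΘ.Model) :
    mul x (succ y) = add (mul x y) x := by
  obtain ⟨s, rfl⟩ := hΘ.cls_surjective x
  obtain ⟨t, rfl⟩ := hΘ.cls_surjective y
  exact hΘ.cls_eq_iff.2 (hΘ.subst_mem_of_ax .mul_succ (consSubst s fun _ => t))

theorem zero_or_succ (hΘ : IsPrime IAx Θ) (x : hΘ.Model) : x = zero ∨ ∃ y, x = succ y := by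
  let D : Fml := .or (.eq (.var 1) .zero) (.eq (.var 1) (.succ (.var 0)))
  have hT : ∀ {Θ : Set Fml} (hΘ : IsPrime IAx Θ), hΘ.Truth (.ex D) := fun hΘ =>
    ((hΘ.truth_eq _ _).or (hΘ.truth_eq _ _)).ex
  have h := sigma1_induction (S := .ex D) ⟨D, .or (.eq _ _) (.eq _ _), rfl⟩
    (derives_of_prime fun Θ' hΘ' _ => (hT hΘ' _).1 ⟨zero, .inl rfl⟩)
    (derives_of_prime fun Θ' hΘ' _ => (hT hΘ' _).1 ⟨hΘ'.cls (.var 0), .inr rfl⟩)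
  obtain ⟨s, rfl⟩ := hΘ.cls_surjective x
  obtain ⟨y, hy⟩ := (hT hΘ fun _ => s).2 (hΘ.of_nil (h _))
  exact hy.imp id fun h => ⟨y, h⟩

theorem zero_add (hΘ : IsPrime IAx Θ) (x : hΘ.Model) : add zero x = x := by
  have hT : ∀ {Θ : Set Fml} (hΘ : IsPrime IAx Θ),
      hΘ.Truth (.eq (.add .zero (.var 0)) (.var 0)) := fun hΘ => hΘ.truth_eq _ _
  have h := delta0_induction (D := .eq (.add .zero (.var 0)) (.var 0)) (.eq _ _)
    (derives_of_prime fun Θ' hΘ' _ => (hT hΘ' _).1 (hΘ'.add_zero _))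
    (derives_of_prime fun Θ' hΘ' hm => (hT hΘ' _).1 (by
      have h := (hT hΘ').mem_iff.1 (hm _ (by simp))
      exact (hΘ'.add_succ _ _).trans (congrArg succ h)))
  obtain ⟨s, rfl⟩ := hΘ.cls_surjective x
  exact (hT hΘ fun _ => s).2 (hΘ.of_nil (h _))

theorem succ_add (hΘ : IsPrime IAx Θ) (x y : hΘ.Model) :
    add (succ x) y = succ (add x y) := by
  let D : Fml := .eq (.add (.succ (.var 1)) (.var 0)) (.succ (.add (.var 1) (.var 0)))
  have hT : ∀ {Θ : Set Fml} (hΘ : IsPrime IAx Θ), hΘ.Truth D := fun hΘ => hΘ.truth_eq _ _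
  have h := delta0_induction (D := D) (.eq _ _)
    (derives_of_prime fun Θ' hΘ' _ => (hT hΘ' _).1
      ((hΘ'.add_zero _).trans (congrArg succ (hΘ'.add_zero _).symm)))
    (derives_of_prime fun Θ' hΘ' hm => (hT hΘ' _).1 (by
      have h := (hT hΘ').mem_iff.1 (hm _ (by simp))
      exact (hΘ'.add_succ _ _).trans
        ((congrArg succ h).trans (congrArg succ (hΘ'.add_succ _ _).symm))))
  obtain ⟨s, rfl⟩ := hΘ.cls_surjective x
  obtain ⟨t, rfl⟩ := hΘ.cls_surjective y
  exact (hT hΘ (consSubst t fun _ => s)).2 (hΘ.of_nil (h _))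

theorem not_sLt_self (hΘ : IsPrime IAx Θ) (x : hΘ.Model) : ¬ SLt x x := by
  let E : Fml := .eq (.add (.var 0) (.succ (.var 1))) (.var 0)
  have hT : ∀ {Θ : Set Fml} (hΘ : IsPrime IAx Θ), hΘ.Truth E := fun hΘ => hΘ.truth_eq _ _
  have h := delta0_induction (D := neg E) (.imp (.eq _ _) .bot)
    (derives_of_prime fun Θ' hΘ' _ => hΘ'.neg_mem [] (by simp) fun Θ₂ hΘ₂ _ hm => by
      have h : add zero (succ (hΘ₂.cls (.var 0))) = zero := (hT hΘ₂ _).2 hm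
      rw [hΘ₂.add_succ] at h
      exact hΘ₂.succ_ne_zero _ h)
    (derives_of_prime fun Θ' hΘ' hm => hΘ'.neg_mem [neg E] hm fun Θ₂ hΘ₂ hm₂ hm => by
      have h : add (succ (hΘ₂.cls (.var 0))) (succ (hΘ₂.cls (.var 1))) =
        succ (hΘ₂.cls (.var 0)) := (hT hΘ₂ _).2 hm
      rw [hΘ₂.succ_add] at h
      exact hΘ₂.not_mem_of_neg (hm₂ _ (by simp)) ((hT hΘ₂).mem_iff.2 (hΘ₂.succ_inj h)))
  rintro ⟨z, hz⟩
  obtain ⟨s, rfl⟩ := hΘ.cls_surjective x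
  obtain ⟨t, rfl⟩ := hΘ.cls_surjective z
  exact hΘ.not_mem_of_neg (hΘ.of_nil (h (consSubst s fun _ => t))) ((hT hΘ _).1 hz)

theorem trichotomy (hΘ : IsPrime IAx Θ) (x y : hΘ.Model) : SLt x y ∨ x = y ∨ SLt y x := by
  let D : Fml := .or (.eq (.add (.var 1) (.succ (.var 0))) (.var 2))
    (.or (.eq (.var 1) (.var 2)) (.eq (.add (.var 2) (.succ (.var 0))) (.var 1)))
  have hT : ∀ {Θ : Set Fml} (hΘ : IsPrime IAx Θ), hΘ.Truth (.ex D) := fun hΘ =>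
    ((hΘ.truth_eq _ _).or ((hΘ.truth_eq _ _).or (hΘ.truth_eq _ _))).ex
  have h := sigma1_induction (S := .ex D) ⟨D, .or (.eq _ _) (.or (.eq _ _) (.eq _ _)), rfl⟩
    (derives_of_prime fun Θ' hΘ' _ => (hT hΘ' _).1 (by
      change ∃ w, add zero (succ w) = hΘ'.cls (.var 0) ∨ zero = hΘ'.cls (.var 0) ∨
        add (hΘ'.cls (.var 0)) (succ w) = zero
      rcases hΘ'.zero_or_succ (hΘ'.cls (.var 0)) with h | ⟨w, h⟩
      · exact ⟨zero, .inr (.inl h.symm)⟩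
      · exact ⟨w, .inl (by rw [hΘ'.zero_add, h])⟩))
    (derives_of_prime fun Θ' hΘ' hm => (hT hΘ' _).1 (by
      change ∃ w, add (succ (hΘ'.cls (.var 0))) (succ w) = hΘ'.cls (.var 1) ∨
        succ (hΘ'.cls (.var 0)) = hΘ'.cls (.var 1) ∨
        add (hΘ'.cls (.var 1)) (succ w) = succ (hΘ'.cls (.var 0))
      obtain ⟨w, h⟩ := (hT hΘ').mem_iff.1 (hm _ (by simp))
      change add (hΘ'.cls (.var 0)) (succ w) = hΘ'.cls (.var 1) ∨
        hΘ'.cls (.var 0) = hΘ'.cls (.var 1) ∨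
        add (hΘ'.cls (.var 1)) (succ w) = hΘ'.cls (.var 0) at h
      rcases h with h | h | h
      · rcases hΘ'.zero_or_succ w with rfl | ⟨v, rfl⟩
        · exact ⟨zero, .inr (.inl (by rw [← h, hΘ'.add_succ, hΘ'.add_zero]))⟩
        · exact ⟨v, .inl (by rw [← h, hΘ'.add_succ, hΘ'.add_succ, hΘ'.add_succ,
            hΘ'.succ_add])⟩
      · exact ⟨zero, .inr (.inr (by rw [h, hΘ'.add_succ, hΘ'.add_zero]))⟩
      · exact ⟨succ w, .inr (.inr (by rw [hΘ'.add_succ, h]))⟩))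
  obtain ⟨s, rfl⟩ := hΘ.cls_surjective x
  obtain ⟨t, rfl⟩ := hΘ.cls_surjective y
  obtain ⟨w, hw⟩ := (hT hΘ (consSubst s fun _ => t)).2 (hΘ.of_nil (h _))
  exact hw.imp (fun h => ⟨w, h⟩) (Or.imp id fun h => ⟨w, h⟩)

theorem sLt_succ_self (hΘ : IsPrime IAx Θ) (x : hΘ.Model) : SLt x (succ x) :=
  ⟨zero, by rw [hΘ.add_succ, hΘ.add_zero]⟩

theorem sLt_succ_of_sLt (hΘ : IsPrime IAx Θ) {x y : hΘ.Model} (h : SLt x y) :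
    SLt x (succ y) := by
  obtain ⟨z, rfl⟩ := h
  exact ⟨succ z, hΘ.add_succ _ _⟩

theorem not_sLt_zero (hΘ : IsPrime IAx Θ) (x : hΘ.Model) : ¬ SLt x zero := by
  rintro ⟨z, hz⟩
  rw [hΘ.add_succ] at hz
  exact hΘ.succ_ne_zero _ hz

theorem sLt_or_eq_of_sLt_succ (hΘ : IsPrime IAx Θ) {x y : hΘ.Model} (h : SLt x (succ y)) :
    SLt x y ∨ x = y := by
  obtain ⟨z, hz⟩ := h
  rw [hΘ.add_succ] at hz
  have hz := hΘ.succ_inj hz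
  rcases hΘ.zero_or_succ z with rfl | ⟨w, rfl⟩
  · exact .inr (by rw [← hz, hΘ.add_zero])
  · exact .inl ⟨w, hz⟩

theorem ltF_iff (hΘ : IsPrime IAx Θ) {s t : Tm} :
    ltF s t ∈ Θ ↔ SLt (hΘ.cls s) (hΘ.cls t) := by
  rw [(hΘ.truth_ltF s t).mem_iff, sat_ltF, val_cls, val_cls, s.subst_var, t.subst_var]

end IsPrime

/-! ### Decidability of `Δ₀`-formulas and the least number principle -/

/-- `A` is decided, at all instances, by all prime theories of `iIΣ₁`. -/
def Decided (A : Fml) : Prop :=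
  ∀ Θ, IsPrime IAx Θ → ∀ σ, A.subst σ ∈ Θ ∨ neg (A.subst σ) ∈ Θ

theorem Decided.subst {A : Fml} (h : Decided A) (τ : ℕ → Tm) : Decided (A.subst τ) :=
  fun Θ hΘ σ => by rw [Fml.subst_subst]; exact h Θ hΘ _

theorem Decided.mem {A : Fml} (h : Decided A) {Θ : Set Fml} (hΘ : IsPrime IAx Θ) :
    A ∈ Θ ∨ neg A ∈ Θ := by
  simpa [A.subst_var] using h Θ hΘ Tm.var

theorem Decided.imp {A B : Fml} (hA : Decided A) (hB : Decided B) : Decided (.imp A B) := by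
  intro Θ hΘ σ
  rcases hA Θ hΘ σ with h | h
  · rcases hB Θ hΘ σ with h' | h'
    · exact .inl (hΘ.closed (Γ := [B.subst σ]) (.impI (.hyp (by simp))) (by simp [h']))
    · refine .inr (hΘ.neg_mem [A.subst σ, neg (B.subst σ)] (by simp [h, h']) ?_)
      intro Θ' hΘ' hm hi
      exact hΘ'.not_mem_of_neg (hm _ (by simp)) (hΘ'.mp hi (hm _ (by simp)))
  · exact .inl (hΘ.closed (Γ := [neg (A.subst σ)])
      (.impI (.botE (.impE (A := A.subst σ) (.hyp (by simp [neg])) (.hyp (by simp)))))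
      (by simp [h]))

theorem decided_bot : Decided .bot := fun _ hΘ _ => .inr (hΘ.of_nil (.impI (.hyp (by simp [Fml.subst]))))

theorem Decided.neg {A : Fml} (hA : Decided A) : Decided (neg A) := hA.imp decided_bot

theorem decided_eq (s t : Tm) : Decided (.eq s t) := by
  intro Θ hΘ σ
  simp only [Fml.subst]
  generalize s.subst σ = s
  generalize t.subst σ = t
  have key : ∀ s t, SLt (hΘ.cls s) (hΘ.cls t) → neg (.eq s t) ∈ Θ ∧ neg (.eq t s) ∈ Θ := by
    intro s t h
    rw [← hΘ.ltF_iff] at h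
    constructor <;>
    · refine hΘ.neg_mem [ltF s t] (by simp [h]) fun Θ' hΘ' hm he => ?_
      have h' := hΘ'.ltF_iff.1 (hm (ltF s t) (by simp))
      rw [hΘ'.cls_eq_iff.2 he] at h'
      exact hΘ'.not_sLt_self _ h'
  rcases hΘ.trichotomy (hΘ.cls s) (hΘ.cls t) with h | h | h
  · exact .inr (key s t h).1
  · exact .inl (hΘ.cls_eq_iff.1 h)
  · exact .inr (key t s h).2

/-- Either `A` fails below `t` or it has a least witness below `t`. -/
def leastFml (A : Fml) (t : Tm) : Fml :=
  .or (ball t (neg A))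
    (bex t (.and A (ball (.var 0) (neg (A.subst (up fun i => .var (i + 1)))))))

theorem leastFml_subst (A : Fml) (t : Tm) (σ : ℕ → Tm) :
    (leastFml A t).subst σ = leastFml (A.subst (up σ)) (t.subst σ) := by
  simp only [leastFml, Fml.subst, ball_subst, bex_subst, neg_subst, Fml.subst_subst, up_subst]
  rfl

theorem isDelta0_leastFml {A : Fml} (hA : IsDelta0 A) (t : Tm) : IsDelta0 (leastFml A t) :=
  .or (.ball t (.imp hA .bot)) (.bex t (.and hA (.ball _ (.imp (hA.subst _) .bot))))

theorem leastFml_mem_succ {A : Fml} (hA : Decided A) {Θ : Set Fml} (hΘ : IsPrime IAx Θ) {t : Tm}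
    (h : leastFml A t ∈ Θ) : leastFml A (.succ t) ∈ Θ := by
  have hin : ∀ s, (ball (.var 0) (neg (A.subst (up fun i => .var (i + 1))))).inst s =
      ball s (neg A) := fun s => by
    rw [Fml.inst, ball_subst, neg_subst, Fml.subst_up_shift_inst]; rfl
  rcases hΘ.or h with h | h
  · rcases hA Θ hΘ (instSubst t) with hAt | hAt
    · refine hΘ.or_iff.2 (.inr (hΘ.bex_iff.2 ⟨t, hΘ.ltF_iff.2 (hΘ.sLt_succ_self _), ?_⟩))
      exact hΘ.and_iff.2 ⟨hAt, (hin t).symm.subst (motive := (· ∈ Θ)) h⟩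
    · refine hΘ.or_iff.2 (.inl (hΘ.closed (Γ := [ball t (neg A), neg (A.inst t)])
        (.allI (.impI (derives_of_prime fun Θ' hΘ' hm => ?_))) (by simpa using ⟨h, hAt⟩)))
      simp only [List.map_cons, List.map_nil, List.mem_cons, List.not_mem_nil, or_false,
        forall_eq_or_imp, forall_eq, Fml.shift, ball_subst, neg_subst, Fml.inst_subst] at hm
      obtain ⟨hlt, hb, hn⟩ := hm
      have hlt := hΘ'.ltF_iff.1 hlt
      have hA' : neg A = (neg (A.subst (up fun i => .var (i + 1)))).inst (.var 0) := by
        rw [Fml.inst, neg_subst]; exact congrArg neg A.subst_up_shift_inst_var.symm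
      rw [hA']
      rcases hΘ'.sLt_or_eq_of_sLt_succ (y := hΘ'.cls t.shift) hlt with hlt | heq
      · exact hΘ'.inst_of_ball hb (hΘ'.ltF_iff.2 hlt)
      · exact hΘ'.eq_subst _ (hΘ'.cls_eq_iff.1 heq.symm) hn
  · obtain ⟨s, hs, hw⟩ := hΘ.bex_iff.1 h
    refine hΘ.or_iff.2 (.inr (hΘ.bex_iff.2 ⟨s, hΘ.ltF_iff.2 ?_, hw⟩))
    exact hΘ.sLt_succ_of_sLt (hΘ.ltF_iff.1 hs)

theorem leastFml_mem {A : Fml} (hA : IsDelta0 A) (hd : Decided A) {Θ : Set Fml}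
    (hΘ : IsPrime IAx Θ) (t : Tm) : leastFml A t ∈ Θ := by
  let D : Fml := leastFml (A.subst (up fun i => .var (i + 1))) (.var 0)
  have h := delta0_induction (D := D) (isDelta0_leastFml (hA.subst _) _) ?_ ?_ (instSubst t)
  · have h := hΘ.of_nil h
    rwa [leastFml_subst, Fml.subst_up_shift_inst] at h
  · rw [Fml.inst, leastFml_subst, Fml.subst_up_shift_inst]
    refine derives_of_prime fun Θ' hΘ' _ => hΘ'.or_iff.2 (.inl (hΘ'.of_nil (.allI (.impI ?_))))
    refine derives_of_prime fun Θ₂ hΘ₂ hm => ?_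
    have := hΘ₂.ltF_iff.1 (hm (ltF (.var 0) Tm.zero) (by simp; rfl))
    exact absurd this (hΘ₂.not_sLt_zero _)
  · have hs : D.subst succSubst =
        leastFml (A.subst (up fun i => .var (i + 1))) (.succ (.var 0)) := by
      rw [leastFml_subst, Fml.subst_subst, up_subst]; rfl
    rw [hs]
    exact derives_of_prime fun Θ' hΘ' hm => leastFml_mem_succ (hd.subst _) hΘ' (hm D (by simp))

theorem ball_neg_or_bex {A : Fml} (hA : IsDelta0 A) (hd : Decided A) {Θ : Set Fml}
    (hΘ : IsPrime IAx Θ) (t : Tm) : ball t (neg A) ∈ Θ ∨ bex t A ∈ Θ := by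
  refine (hΘ.or (leastFml_mem hA hd hΘ t)).imp id fun h => ?_
  obtain ⟨s, hs, hw⟩ := hΘ.bex_iff.1 h
  exact hΘ.bex_iff.2 ⟨s, hs, (hΘ.and_iff.1 hw).1⟩

theorem ball_or_bex_neg {A : Fml} (hA : IsDelta0 A) (hd : Decided A) {Θ : Set Fml}
    (hΘ : IsPrime IAx Θ) (t : Tm) : ball t A ∈ Θ ∨ bex t (neg A) ∈ Θ := by
  refine (ball_neg_or_bex (A := neg A) (.imp hA .bot) hd.neg hΘ t).imp (fun h => ?_) id
  refine hΘ.closed (Γ := [ball t (neg (neg A))])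
    (.allI (.impI (derives_of_prime fun Θ' hΘ' hm => ?_))) (by simp [h])
  simp only [List.map_cons, List.map_nil, List.mem_cons, List.not_mem_nil, or_false,
    forall_eq_or_imp, forall_eq, Fml.shift, ball_subst] at hm
  have h := hΘ'.inst_of_ball hm.2 hm.1
  rw [Fml.inst, neg_subst, neg_subst, neg_subst, neg_subst] at h
  have h : neg (neg ((A.subst (up fun i => .var (i + 1))).inst (.var 0))) ∈ Θ' := h
  rw [Fml.subst_up_shift_inst_var] at h
  exact (hd.mem hΘ').resolve_right (hΘ'.not_mem_of_neg h)

theorem IsDelta0.decided {A : Fml} (hA : IsDelta0 A) : Decided A := by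
  induction hA with
  | bot => exact decided_bot
  | eq s t => exact decided_eq s t
  | imp _ _ h₁ h₂ => exact h₁.imp h₂
  | @and A B _ _ h₁ h₂ =>
    intro Θ hΘ σ
    rcases h₁ Θ hΘ σ with h | h
    · rcases h₂ Θ hΘ σ with h' | h'
      · exact .inl (hΘ.and_iff.2 ⟨h, h'⟩)
      · exact .inr (hΘ.neg_mem [neg (B.subst σ)] (by simp [h']) fun Θ' hΘ' hm hi =>
          hΘ'.not_mem_of_neg (hm _ (by simp)) (hΘ'.and_iff.1 hi).2)
    · exact .inr (hΘ.neg_mem [neg (A.subst σ)] (by simp [h]) fun Θ' hΘ' hm hi =>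
          hΘ'.not_mem_of_neg (hm _ (by simp)) (hΘ'.and_iff.1 hi).1)
  | @or A B _ _ h₁ h₂ =>
    intro Θ hΘ σ
    rcases h₁ Θ hΘ σ with h | h
    · exact .inl (hΘ.or_iff.2 (.inl h))
    · rcases h₂ Θ hΘ σ with h' | h'
      · exact .inl (hΘ.or_iff.2 (.inr h'))
      · exact .inr (hΘ.neg_mem [neg (A.subst σ), neg (B.subst σ)] (by simp [h, h'])
          fun Θ' hΘ' hm hi => (hΘ'.or hi).elim (hΘ'.not_mem_of_neg (hm _ (by simp)))
            (hΘ'.not_mem_of_neg (hm _ (by simp))))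
  | @bex t A hA ih =>
    intro Θ hΘ σ
    change (IntArith.bex t A).subst σ ∈ Θ ∨ neg ((IntArith.bex t A).subst σ) ∈ Θ
    rw [bex_subst]
    refine (ball_neg_or_bex (hA.subst (up σ)) (ih.subst _) hΘ (t.subst σ)).symm.imp id fun h => ?_
    refine hΘ.neg_mem _ (List.forall_mem_singleton.2 h) fun Θ' hΘ' hm hi => ?_
    obtain ⟨s, hs, hw⟩ := hΘ'.bex_iff.1 hi
    exact hΘ'.not_mem_of_neg (hΘ'.inst_of_ball (List.forall_mem_singleton.1 hm) hs) hw
  | @ball t A hA ih =>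
    intro Θ hΘ σ
    change (IntArith.ball t A).subst σ ∈ Θ ∨ neg ((IntArith.ball t A).subst σ) ∈ Θ
    rw [ball_subst]
    refine (ball_or_bex_neg (hA.subst (up σ)) (ih.subst _) hΘ (t.subst σ)).imp id fun h => ?_
    refine hΘ.neg_mem _ (List.forall_mem_singleton.2 h) fun Θ' hΘ' hm hi => ?_
    obtain ⟨s, hs, hw⟩ := hΘ'.bex_iff.1 (List.forall_mem_singleton.1 hm)
    exact hΘ'.not_mem_of_neg hw (hΘ'.inst_of_ball hi hs)

theorem IsDelta0.truth {A : Fml} (hA : IsDelta0 A) {Θ : Set Fml} (hΘ : IsPrime IAx Θ) :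
    hΘ.Truth A := by
  induction hA with
  | bot => exact hΘ.truth_bot
  | eq s t => exact hΘ.truth_eq s t
  | imp hA _ h₁ h₂ => exact h₁.imp h₂ fun σ => hA.decided Θ hΘ σ
  | and _ _ h₁ h₂ => exact h₁.and h₂
  | or _ _ h₁ h₂ => exact h₁.or h₂
  | bex t _ ih => exact ((hΘ.truth_ltF _ _).and ih).ex
  | @ball t A hA ih =>
    intro σ
    have hi : ∀ s, A.Sat (scons (hΘ.cls s) fun i => hΘ.cls (σ i)) ↔
        (A.subst (up σ)).inst s ∈ Θ := fun s => by
      rw [Fml.subst_up_inst, ← ih (consSubst s σ), hΘ.scons_cls]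
    change (IntArith.ball t A).Sat _ ↔ (IntArith.ball t A).subst σ ∈ Θ
    rw [ball_subst, sat_ball, hΘ.val_cls]
    constructor
    · intro h
      refine (ball_or_bex_neg (hA.subst _) (hA.subst _).decided hΘ _).resolve_right fun hb => ?_
      obtain ⟨s, hs, hw⟩ := hΘ.bex_iff.1 hb
      exact hΘ.not_mem_of_neg hw ((hi s).1 (h _ (hΘ.ltF_iff.1 hs)))
    · intro h a ha
      obtain ⟨s, rfl⟩ := hΘ.cls_surjective a
      exact (hi s).2 (hΘ.inst_of_ball h (hΘ.ltF_iff.2 ha))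

/-! ### Conservativity of classical over intuitionistic `Δ₀`-reasoning -/

open ArithStr in
/-- Classical structures in which the discrete linear order of the numbers and the least number
principle for `Δ₀`-formulas with parameters are available. -/
class IsDelta0Model (M : Type) [ArithStr M] : Prop where
  succ_ne_zero (x : M) : succ x ≠ zero
  succ_inj {x y : M} : succ x = succ y → x = y
  add_zero (x : M) : add x zero = x
  add_succ (x y : M) : add x (succ y) = succ (add x y)
  mul_zero (x : M) : mul x zero = zero
  mul_succ (x y : M) : mul x (succ y) = add (mul x y) x
  zero_or_succ (x : M) : x = zero ∨ ∃ y, x = succ y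
  trichotomy (x y : M) : SLt x y ∨ x = y ∨ SLt y x
  least {A : Fml} (hA : IsDelta0 A) (e : ℕ → M) {a : M} (ha : A.Sat (scons a e)) :
    ∃ b, A.Sat (scons b e) ∧ ∀ c, SLt c b → ¬ A.Sat (scons c e)

instance {Θ : Set Fml} (hΘ : IsPrime IAx Θ) : IsDelta0Model hΘ.Model where
  succ_ne_zero := hΘ.succ_ne_zero
  succ_inj := hΘ.succ_inj
  add_zero := hΘ.add_zero
  add_succ := hΘ.add_succ
  mul_zero := hΘ.mul_zero
  mul_succ := hΘ.mul_succ
  zero_or_succ := hΘ.zero_or_succ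
  trichotomy := hΘ.trichotomy
  least {A} hA e a ha := by
    choose σ hσ using fun i => hΘ.cls_surjective (e i)
    obtain rfl : (fun i => hΘ.cls (σ i)) = e := funext hσ
    obtain ⟨s, rfl⟩ := hΘ.cls_surjective a
    have hi : ∀ s, A.Sat (scons (hΘ.cls s) fun i => hΘ.cls (σ i)) ↔
        (A.subst (up σ)).inst s ∈ Θ := fun s => by
      rw [Fml.subst_up_inst, ← hA.truth hΘ (consSubst s σ), hΘ.scons_cls]
    rcases hΘ.or (leastFml_mem (hA.subst (up σ)) (hA.subst _).decided hΘ (.succ s)) with h | h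
    · refine absurd ((hi s).1 ha) (hΘ.not_mem_of_neg ?_)
      exact hΘ.inst_of_ball h (hΘ.ltF_iff.2 (hΘ.sLt_succ_self _))
    · obtain ⟨t, -, hw⟩ := hΘ.bex_iff.1 h
      obtain ⟨h₁, h₂⟩ := hΘ.and_iff.1 hw
      refine ⟨hΘ.cls t, (hi t).2 h₁, fun c hc hs => ?_⟩
      obtain ⟨u, rfl⟩ := hΘ.cls_surjective c
      rw [ball_subst, neg_subst, Fml.subst_up_shift_inst] at h₂
      exact hΘ.not_mem_of_neg (hΘ.inst_of_ball h₂ (hΘ.ltF_iff.2 hc)) ((hi u).1 hs)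

instance : IsDelta0Model ℕ where
  succ_ne_zero := Nat.succ_ne_zero
  succ_inj := Nat.succ.inj
  add_zero := Nat.add_zero
  add_succ := Nat.add_succ
  mul_zero := Nat.mul_zero
  mul_succ := Nat.mul_succ
  zero_or_succ x := by cases x <;> simp [ArithStr.zero, ArithStr.succ]
  trichotomy x y := by
    have h : ∀ x y : ℕ, x < y → SLt x y := fun x y h => ⟨y - x - 1, by
      change x + (y - x - 1 + 1) = y; omega⟩
    rcases lt_trichotomy x y with h' | h' | h'
    exacts [.inl (h _ _ h'), .inr (.inl h'), .inr (.inr (h _ _ h'))]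
  least {A} _ e a ha := by
    classical
    have hex : ∃ a, A.Sat (scons a e) := ⟨a, ha⟩
    refine ⟨Nat.find hex, Nat.find_spec hex, fun c ⟨z, hz⟩ => Nat.find_min hex ?_⟩
    rw [← hz]
    exact Nat.lt_add_of_pos_right (Nat.succ_pos z)

/-- Formulas obtained from `Δ₀`-formulas by conjunction, disjunction and existential
quantification. -/
inductive IsSigma : Fml → Prop
  | delta0 {A : Fml} : IsDelta0 A → IsSigma A
  | and {A B : Fml} : IsSigma A → IsSigma B → IsSigma (.and A B)
  | or {A B : Fml} : IsSigma A → IsSigma B → IsSigma (.or A B)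
  | ex {A : Fml} : IsSigma A → IsSigma (.ex A)

theorem IsSigma.truth {A : Fml} (hA : IsSigma A) {Θ : Set Fml} (hΘ : IsPrime IAx Θ) :
    hΘ.Truth A := by
  induction hA with
  | delta0 h => exact h.truth hΘ
  | and _ _ h₁ h₂ => exact h₁.and h₂
  | or _ _ h₁ h₂ => exact h₁.or h₂
  | ex _ h => exact h.ex

/-- To derive one `Σ`-formula from another in `iIΣ₁`, it suffices to argue classically in the models
of `Δ₀`-induction. -/
theorem iSigma1Proves_imp {A B : Fml} (hA : IsSigma A) (hB : IsSigma B)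
    (h : ∀ (M : Type) [ArithStr M] [IsDelta0Model M] (e : ℕ → M), A.Sat e → B.Sat e) :
    ISigma1Proves (.imp A B) := by
  refine .impI (derives_of_prime fun Θ hΘ hm => ?_)
  exact (hB.truth hΘ).mem_iff.2 (h _ _ ((hA.truth hΘ).mem_iff.1 (hm A (by simp))))

theorem iSigma1Proves_of_sat {A : Fml} (hA : IsSigma A)
    (h : ∀ (M : Type) [ArithStr M] [IsDelta0Model M] (e : ℕ → M), A.Sat e) :
    ISigma1Proves A :=
  derives_of_prime fun _ hΘ _ => (hA.truth hΘ).mem_iff.2 (h _ _)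

/-! ### Numerals -/

section Numerals

open ArithStr (zero succ add mul)

/-- The value of the numeral of `n` in a structure. -/
def numeral (M : Type) [ArithStr M] : ℕ → M
  | 0 => zero
  | n + 1 => succ (numeral M n)

theorem num_freeBelow (n m : ℕ) : (num n).FreeBelow m := by
  induction n with
  | zero => trivial
  | succ n ih => exact ih

section

variable {M : Type} [ArithStr M]

theorem val_num (n : ℕ) (e : ℕ → M) : (num n).val e = numeral M n := by
  induction n with
  | zero => rfl
  | succ n ih => simp only [num, Tm.val, ih, numeral]

variable [IsDelta0Model M]

open IsDelta0Model

theorem numeral_add (a b : ℕ) : add (numeral M a) (numeral M b) = numeral M (a + b) := by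
  induction b with
  | zero => exact add_zero _
  | succ b ih => rw [numeral, add_succ, ih]; rfl

theorem numeral_mul (a b : ℕ) : mul (numeral M a) (numeral M b) = numeral M (a * b) := by
  induction b with
  | zero => exact mul_zero _
  | succ b ih => rw [numeral, mul_succ, ih, numeral_add]; rfl

theorem numeral_injective : Function.Injective (numeral M) := by
  intro a
  induction a with
  | zero =>
    intro b h
    cases b with
    | zero => rfl
    | succ b => exact absurd h.symm (succ_ne_zero _)
  | succ a ih =>
    intro b h
    cases b with
    | zero => exact absurd h (succ_ne_zero _)
    | succ b => rw [ih (succ_inj h)]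

theorem sLt_numeral_iff {x : M} {b : ℕ} : SLt x (numeral M b) ↔ ∃ c < b, x = numeral M c := by
  constructor
  · induction b with
    | zero =>
      rintro ⟨z, hz⟩
      rw [add_succ] at hz
      exact absurd hz (succ_ne_zero _)
    | succ b ih =>
      rintro ⟨z, hz⟩
      rw [add_succ] at hz
      have hz := succ_inj hz
      rcases zero_or_succ z with rfl | ⟨w, rfl⟩
      · exact ⟨b, b.lt_succ_self, by rw [← hz, IsDelta0Model.add_zero]⟩
      · obtain ⟨c, hc, h⟩ := ih ⟨w, hz⟩
        exact ⟨c, hc.trans b.lt_succ_self, h⟩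
  · rintro ⟨c, hc, rfl⟩
    refine ⟨numeral M (b - c - 1), ?_⟩
    change add _ (numeral M (b - c - 1 + 1)) = _
    rw [numeral_add]
    congr 1
    omega

theorem sLt_numeral_numeral {a b : ℕ} : SLt (numeral M a) (numeral M b) ↔ a < b := by
  rw [sLt_numeral_iff]
  constructor
  · rintro ⟨c, hc, h⟩
    rwa [numeral_injective h]
  · exact fun h => ⟨a, h, rfl⟩

theorem val_numeral (t : Tm) (e : ℕ → ℕ) :
    t.val (fun i => numeral M (e i)) = numeral M (t.val e) := by
  induction t with
  | var i => rfl
  | zero => rfl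
  | succ t ih => simp only [Tm.val, ih]; rfl
  | add s t ihs iht => simp only [Tm.val, ihs, iht, numeral_add]; rfl
  | mul s t ihs iht => simp only [Tm.val, ihs, iht, numeral_mul]; rfl

omit [IsDelta0Model M] in
theorem scons_numeral (a : ℕ) (e : ℕ → ℕ) :
    scons (numeral M a) (fun i => numeral M (e i)) = fun i => numeral M (scons a e i) := by
  funext i; cases i <;> rfl

theorem numeral_nat (n : ℕ) : numeral ℕ n = n := by
  induction n with
  | zero => rfl
  | succ n ih => rw [numeral, ih]; rfl

theorem sLt_nat {a b : ℕ} : SLt a b ↔ a < b := by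
  simpa only [numeral_nat] using sLt_numeral_numeral (M := ℕ) (a := a) (b := b)

/-- `Δ₀`-formulas are absolute between `ℕ` and the models of `Δ₀`-induction. -/
theorem IsDelta0.sat_numeral {A : Fml} (hA : IsDelta0 A) (e : ℕ → ℕ) :
    A.Sat (fun i => numeral M (e i)) ↔ A.Sat e := by
  induction hA generalizing e with
  | bot => rfl
  | eq s t => simp only [Fml.Sat, val_numeral, numeral_injective.eq_iff]
  | and _ _ h₁ h₂ => simp only [Fml.Sat, h₁, h₂]
  | or _ _ h₁ h₂ => simp only [Fml.Sat, h₁, h₂]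
  | imp _ _ h₁ h₂ => simp only [Fml.Sat, h₁, h₂]
  | @bex t A _ ih =>
    change (IntArith.bex t A).Sat _ ↔ (IntArith.bex t A).Sat e
    simp only [sat_bex, val_numeral, sLt_numeral_iff, sLt_nat]
    constructor
    · rintro ⟨_, ⟨c, hc, rfl⟩, h⟩
      exact ⟨c, hc, by rwa [scons_numeral, ih] at h⟩
    · rintro ⟨c, hc, h⟩
      exact ⟨_, ⟨c, hc, rfl⟩, by rwa [scons_numeral, ih]⟩
  | @ball t A _ ih =>
    change (IntArith.ball t A).Sat _ ↔ (IntArith.ball t A).Sat e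
    simp only [sat_ball, val_numeral, sLt_numeral_iff, sLt_nat]
    constructor
    · intro h c hc
      have := h _ ⟨c, hc, rfl⟩
      rwa [scons_numeral, ih] at this
    · rintro h _ ⟨c, hc, rfl⟩
      rw [scons_numeral, ih]
      exact h c hc

theorem IsSigma.sat_numeral {A : Fml} (hA : IsSigma A) {e : ℕ → ℕ} (h : A.Sat e) :
    A.Sat (fun i => numeral M (e i)) := by
  induction hA generalizing e with
  | delta0 hA => exact (hA.sat_numeral e).2 h
  | and _ _ h₁ h₂ => exact ⟨h₁ h.1, h₂ h.2⟩
  | or _ _ h₁ h₂ => exact h.imp h₁ h₂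
  | ex _ ih =>
    obtain ⟨a, ha⟩ := h
    exact ⟨numeral M a, by rw [scons_numeral]; exact ih ha⟩

end

theorem trueInN_iff {A : Fml} : TrueInN A ↔ ∀ e : ℕ → ℕ, A.Sat e :=
  forall_congr' fun e => (A.sat_nat e).symm

theorem Fml.IsSentence.trueInN_iff {A : Fml} (hA : A.IsSentence) (e : ℕ → ℕ) :
    TrueInN A ↔ A.Sat e :=
  IntArith.trueInN_iff.trans ⟨fun h => h e, fun h e' => (hA.sat_iff e e').1 h⟩

/-- `Σ`-completeness of `iIΣ₁`. -/
theorem iSigma1Proves_of_trueInN {A : Fml} (hA : IsSigma A) (hs : A.IsSentence)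
    (h : TrueInN A) : ISigma1Proves A := by
  refine iSigma1Proves_of_sat hA fun M _ _ e => ?_
  exact (hs.sat_iff _ _).1 (hA.sat_numeral (M := M) (trueInN_iff.1 h fun _ => 0))

/-! ### From `Σ`-formulas to `Σ₁`-formulas -/

theorem IsSigma1.isSigma {S : Fml} (h : IsSigma1 S) : IsSigma S := by
  obtain ⟨A, hA, rfl⟩ := h
  exact .ex (.delta0 hA)

theorem exists_sLt_sLt {M : Type} [ArithStr M] [IsDelta0Model M] (a b : M) :
    ∃ u, SLt a u ∧ SLt b u := by
  have h : ∀ a : M, SLt a (succ a) := fun a =>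
    ⟨zero, by rw [IsDelta0Model.add_succ, IsDelta0Model.add_zero]⟩
  have h' : ∀ a b : M, SLt a b → SLt a (succ b) := fun a b ⟨z, hz⟩ =>
    ⟨succ z, by rw [IsDelta0Model.add_succ, hz]⟩
  rcases IsDelta0Model.trichotomy a b with hab | rfl | hab
  · exact ⟨succ b, h' _ _ hab, h b⟩
  · exact ⟨succ a, h a, h a⟩
  · exact ⟨succ a, h a, h' _ _ hab⟩

theorem freeBelow_ltF {s t : Tm} {n : ℕ} (hs : s.FreeBelow n) (ht : t.FreeBelow n) :
    (ltF s t).FreeBelow n :=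
  ⟨⟨hs.shift, Nat.succ_pos n⟩, ht.shift⟩

theorem freeBelow_bex {t : Tm} {A : Fml} {n : ℕ} (ht : t.FreeBelow n)
    (hA : A.FreeBelow (n + 1)) : (bex t A).FreeBelow n :=
  ⟨freeBelow_ltF (Nat.succ_pos n) ht.shift, hA⟩

theorem freeBelow_ball {t : Tm} {A : Fml} {n : ℕ} (ht : t.FreeBelow n)
    (hA : A.FreeBelow (n + 1)) : (ball t A).FreeBelow n :=
  ⟨freeBelow_ltF (Nat.succ_pos n) ht.shift, hA⟩

/-- The existential quantifiers of a `Σ`-formula can be bounded by a single one in front. -/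
theorem IsSigma.exists_bound {A : Fml} (hA : IsSigma A) :
    ∃ B, IsDelta0 B ∧ (∀ n, A.FreeBelow n → B.FreeBelow (n + 1)) ∧
      ∀ (M : Type) [ArithStr M] [IsDelta0Model M] (e : ℕ → M),
        A.Sat e ↔ ∃ w, B.Sat (scons w e) := by
  have hf : ∀ n, ∀ i < n, (Tm.var (i + 1)).FreeBelow (n + 1) := fun n i hi =>
    Nat.succ_lt_succ hi
  induction hA with
  | @delta0 A hA =>
    exact ⟨A.shift, hA.subst _, fun n hn => hn.subst (hf n),
      fun M _ _ e => by simp only [Fml.sat_shift]; exact ⟨fun h => ⟨zero, h⟩, fun ⟨_, h⟩ => h⟩⟩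
  | or _ _ h₁ h₂ =>
    obtain ⟨B₁, hB₁, hf₁, hs₁⟩ := h₁
    obtain ⟨B₂, hB₂, hf₂, hs₂⟩ := h₂
    refine ⟨.or B₁ B₂, .or hB₁ hB₂, fun n hn => ⟨hf₁ n hn.1, hf₂ n hn.2⟩, fun M _ _ e => ?_⟩
    simp only [Fml.Sat, hs₁, hs₂, exists_or]
  | and _ _ h₁ h₂ =>
    obtain ⟨B₁, hB₁, hf₁, hs₁⟩ := h₁
    obtain ⟨B₂, hB₂, hf₂, hs₂⟩ := h₂
    refine ⟨.and (bex (.var 0) (B₁.subst (up fun i => .var (i + 1))))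
      (bex (.var 0) (B₂.subst (up fun i => .var (i + 1)))),
      .and (.bex _ (hB₁.subst _)) (.bex _ (hB₂.subst _)), fun n hn => ?_, fun M _ _ e => ?_⟩
    · exact ⟨freeBelow_bex (Nat.succ_pos n) ((hf₁ n hn.1).subst (freeBelow_up (hf n))),
        freeBelow_bex (Nat.succ_pos n) ((hf₂ n hn.2).subst (freeBelow_up (hf n)))⟩
    · simp only [Fml.Sat, hs₁, hs₂, sat_bex, Fml.sat_subst, val_up]
      constructor
      · rintro ⟨⟨a, ha⟩, b, hb⟩
        obtain ⟨u, hau, hbu⟩ := exists_sLt_sLt a b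
        exact ⟨u, ⟨a, hau, ha⟩, b, hbu, hb⟩
      · rintro ⟨u, ⟨a, -, ha⟩, b, -, hb⟩
        exact ⟨⟨a, ha⟩, b, hb⟩
  | ex _ ih =>
    obtain ⟨B, hB, hf', hs⟩ := ih
    refine ⟨bex (.var 0) (bex (.var 1) (B.subst (up (up fun i => .var (i + 1))))),
      .bex _ (.bex _ (hB.subst _)), fun n hn => ?_, fun M _ _ e => ?_⟩
    · exact freeBelow_bex (Nat.succ_pos n) (freeBelow_bex (Nat.succ_lt_succ (Nat.succ_pos n))
        ((hf' _ hn).subst (freeBelow_up (freeBelow_up (hf n)))))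
    · simp only [Fml.Sat, hs, sat_bex, Fml.sat_subst, val_up]
      constructor
      · rintro ⟨a, b, h⟩
        obtain ⟨u, hau, hbu⟩ := exists_sLt_sLt a b
        exact ⟨u, a, hau, b, hbu, h⟩
      · rintro ⟨u, a, -, b, -, h⟩
        exact ⟨a, b, h⟩

/-- Every `Σ`-sentence is equivalent to a `Σ₁`-sentence. -/
theorem IsSigma.exists_isSigma1 {A : Fml} (hA : IsSigma A) (hs : A.IsSentence) :
    ∃ S, IsSigma1 S ∧ S.IsSentence ∧
      ∀ (M : Type) [ArithStr M] [IsDelta0Model M] (e : ℕ → M), A.Sat e ↔ S.Sat e := by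
  obtain ⟨B, hB, hf, hAB⟩ := hA.exists_bound
  exact ⟨.ex B, ⟨B, hB, rfl⟩, hf 0 hs, hAB⟩

end Numerals

/-! ### Finite disjunctions and conjunctions -/

/-- The disjunction of a list of formulas. -/
def bigOr (l : List Fml) : Fml := l.foldr .or .bot

/-- The conjunction of a list of formulas. -/
def bigAnd (l : List Fml) : Fml := l.foldr .and (.eq .zero .zero)

theorem sat_bigOr {M : Type} [ArithStr M] (l : List Fml) (e : ℕ → M) :
    (bigOr l).Sat e ↔ ∃ A ∈ l, A.Sat e := by
  induction l with
  | nil => simp [bigOr, Fml.Sat]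
  | cons A l ih => rw [List.exists_mem_cons_iff, ← ih]; rfl

theorem sat_bigAnd {M : Type} [ArithStr M] (l : List Fml) (e : ℕ → M) :
    (bigAnd l).Sat e ↔ ∀ A ∈ l, A.Sat e := by
  induction l with
  | nil => simp [bigAnd, Fml.Sat]
  | cons A l ih => rw [List.forall_mem_cons, ← ih]; rfl

theorem freeBelow_bigOr {l : List Fml} {n : ℕ} (h : ∀ A ∈ l, A.FreeBelow n) :
    (bigOr l).FreeBelow n := by
  induction l with
  | nil => trivial
  | cons A l ih => exact ⟨h A (by simp), ih fun B hB => h B (by simp [hB])⟩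

theorem freeBelow_bigAnd {l : List Fml} {n : ℕ} (h : ∀ A ∈ l, A.FreeBelow n) :
    (bigAnd l).FreeBelow n := by
  induction l with
  | nil => exact ⟨trivial, trivial⟩
  | cons A l ih => exact ⟨h A (by simp), ih fun B hB => h B (by simp [hB])⟩

theorem isSigma_bigOr {l : List Fml} (h : ∀ A ∈ l, IsSigma A) : IsSigma (bigOr l) := by
  induction l with
  | nil => exact .delta0 .bot
  | cons A l ih => exact .or (h A (by simp)) (ih fun B hB => h B (by simp [hB]))

theorem isSigma_bigAnd {l : List Fml} (h : ∀ A ∈ l, IsSigma A) : IsSigma (bigAnd l) := by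
  induction l with
  | nil => exact .delta0 (.eq _ _)
  | cons A l ih => exact .and (h A (by simp)) (ih fun B hB => h B (by simp [hB]))

theorem isDelta0_bigOr {l : List Fml} (h : ∀ A ∈ l, IsDelta0 A) : IsDelta0 (bigOr l) := by
  induction l with
  | nil => exact .bot
  | cons A l ih => exact .or (h A (by simp)) (ih fun B hB => h B (by simp [hB]))

/-! ### Computations with Gödel numbers -/

/-- Functions of one number that are built from constants and the pairing function. -/
inductive CodeTm : Type
  | input : CodeTm
  | const : ℕ → CodeTm
  | pair : CodeTm → CodeTm → CodeTm

/-- The function denoted by a `CodeTm`. -/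
def CodeTm.eval (a : ℕ) : CodeTm → ℕ
  | .input => a
  | .const n => n
  | .pair s t => Nat.pair (s.eval a) (t.eval a)

/-- The graph of `Nat.pair`. -/
def pairF (u v z : Tm) : Fml :=
  .or (.and (ltF u v) (.eq z (.add (.mul v v) u)))
    (.and (.or (ltF v u) (.eq u v)) (.eq z (.add (.add (.mul u u) u) v)))

/-- The formula saying that `z` is the value of the function denoted by the `CodeTm` at `y`. -/
def CodeTm.graph : CodeTm → Tm → Tm → Fml
  | .input, z, y => .eq z y
  | .const n, z, _ => .eq z (num n)
  | .pair s t, z, y => .ex (.ex (.and (.and (s.graph (.var 1) y.shift.shift)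
      (t.graph (.var 0) y.shift.shift)) (pairF (.var 1) (.var 0) z.shift.shift)))

theorem isSigma_ltF (s t : Tm) : IsSigma (ltF s t) := .ex (.delta0 (.eq _ _))

theorem CodeTm.isSigma_graph (c : CodeTm) (z y : Tm) : IsSigma (c.graph z y) := by
  induction c generalizing z y with
  | input => exact .delta0 (.eq _ _)
  | const n => exact .delta0 (.eq _ _)
  | pair s t ihs iht =>
    exact .ex (.ex (.and (.and (ihs _ _) (iht _ _)) (.or
      (.and (isSigma_ltF _ _) (.delta0 (.eq _ _)))
      (.and (.or (isSigma_ltF _ _) (.delta0 (.eq _ _))) (.delta0 (.eq _ _))))))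

theorem CodeTm.freeBelow_graph (c : CodeTm) {z y : Tm} {n : ℕ} (hz : z.FreeBelow n)
    (hy : y.FreeBelow n) : (c.graph z y).FreeBelow n := by
  induction c generalizing z y n with
  | input => exact ⟨hz, hy⟩
  | const m => exact ⟨hz, num_freeBelow m n⟩
  | pair s t ihs iht =>
    have h0 : (Tm.var 0).FreeBelow (n + 1 + 1) := Nat.succ_pos _
    have h1 : (Tm.var 1).FreeBelow (n + 1 + 1) := Nat.succ_lt_succ (Nat.succ_pos _)
    exact ⟨⟨ihs h1 hy.shift.shift, iht h0 hy.shift.shift⟩,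
      ⟨freeBelow_ltF h1 h0, hz.shift.shift, ⟨h0, h0⟩, h1⟩,
      ⟨freeBelow_ltF h0 h1, h1, h0⟩, hz.shift.shift, ⟨⟨h1, h1⟩, h1⟩, h0⟩

section Graph

variable {M : Type} [ArithStr M] [IsDelta0Model M]

theorem sat_pairF {u v z : Tm} {e : ℕ → M} {a b : ℕ} (hu : u.val e = numeral M a)
    (hv : v.val e = numeral M b) :
    (pairF u v z).Sat e ↔ z.val e = numeral M (Nat.pair a b) := by
  simp only [pairF, Fml.Sat, sat_ltF, Tm.val, hu, hv, sLt_numeral_numeral, numeral_mul,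
    numeral_add, numeral_injective.eq_iff, Nat.pair]
  split_ifs with h
  · simp [h, h.not_gt, h.ne]
  · simp [h, show b < a ∨ a = b by omega]

theorem CodeTm.sat_graph (c : CodeTm) {z y : Tm} {e : ℕ → M} {a : ℕ}
    (hy : y.val e = numeral M a) : (c.graph z y).Sat e ↔ z.val e = numeral M (c.eval a) := by
  induction c generalizing z y e with
  | input => simp only [CodeTm.graph, Fml.Sat, hy, CodeTm.eval]
  | const n => simp only [CodeTm.graph, Fml.Sat, val_num, CodeTm.eval]
  | pair s t ihs iht =>
    have hy' : ∀ u v : M, y.shift.shift.val (scons v (scons u e)) = numeral M a := fun u v => by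
      rw [Tm.val_shift, Tm.val_shift, hy]
    simp only [CodeTm.graph, Fml.Sat, ihs (hy' _ _), iht (hy' _ _), CodeTm.eval]
    constructor
    · rintro ⟨u, v, ⟨hu, hv⟩, hp⟩
      rw [sat_pairF hu hv, Tm.val_shift, Tm.val_shift] at hp
      exact hp
    · intro h
      refine ⟨numeral M (s.eval a), numeral M (t.eval a), ⟨rfl, rfl⟩, ?_⟩
      rw [sat_pairF (a := s.eval a) (b := t.eval a) rfl rfl, Tm.val_shift, Tm.val_shift]
      exact h

/-- `D[z/x]`, where `x` has index `0` and `z` is the value of the function denoted by `c` at `y`. -/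
def CodeTm.app (c : CodeTm) (y : Tm) (D : Fml) : Fml :=
  .ex (.and (c.graph (.var 0) y.shift) D)

theorem CodeTm.sat_app (c : CodeTm) {y : Tm} {e : ℕ → M} {a : ℕ} (D : Fml)
    (hy : y.val e = numeral M a) :
    (c.app y D).Sat e ↔ D.Sat (scons (numeral M (c.eval a)) e) := by
  have hy' : ∀ z : M, y.shift.val (scons z e) = numeral M a := fun z => by
    rw [Tm.val_shift, hy]
  simp only [CodeTm.app, Fml.Sat, c.sat_graph (hy' _), Tm.val]
  exact exists_eq_left

end Graph

theorem CodeTm.isSigma_app (c : CodeTm) (y : Tm) {D : Fml} (hD : IsSigma D) :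
    IsSigma (c.app y D) :=
  .ex (.and (c.isSigma_graph _ _) hD)

theorem CodeTm.freeBelow_app (c : CodeTm) {y : Tm} {D : Fml} {n : ℕ} (hy : y.FreeBelow n)
    (hD : D.FreeBelow (n + 1)) : (c.app y D).FreeBelow n :=
  ⟨c.freeBelow_graph (Nat.succ_pos n) hy.shift, hD⟩

/-! ### Simultaneous fixed points -/

/-- The `i`-th of the sentences obtained from `A` by diagonalization: `A` with the numeral of `i` for
the variable with index `0` and the numeral of its own Gödel number for the one with index `1`. The
substitutions are expressed by quantifiers, so that the Gödel number of the result is obtained from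
that of `A` by pairing. -/
def fixed (A : Fml) (i : ℕ) : Fml :=
  .ex (.and (.eq (.var 0) (num A.code)) (.ex (.and (.eq (.var 0) (num i)) A)))

/-- The Gödel number of `fixed A i`, as a function of that of `A`. -/
def fixedCode (i : ℕ) : CodeTm :=
  let v : CodeTm := .const (Tm.var 0).code
  .pair (.const 6) (.pair (.const 2) (.pair
    (.pair (.const 1) (.pair v (.pair .input (.const (Nat.pair 0 0)))))
    (.pair (.const 6) (.pair (.const 2)
      (.pair (.const (Fml.code (.eq (.var 0) (num i)))) .input)))))

theorem code_num (n : ℕ) : (num n).code = Nat.pair n (Nat.pair 0 0) := by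
  induction n with
  | zero => rfl
  | succ n ih => simp only [num, Tm.code, ih, Nat.unpair_pair]

theorem eval_fixedCode (A : Fml) (i : ℕ) : (fixedCode i).eval A.code = (fixed A i).code := by
  simp only [fixedCode, CodeTm.eval, fixed, Fml.code, code_num]

theorem sat_fixed {M : Type} [ArithStr M] (A : Fml) (i : ℕ) (e : ℕ → M) :
    (fixed A i).Sat e ↔ A.Sat (scons (numeral M i) (scons (numeral M A.code) e)) := by
  simp only [fixed, Fml.Sat, Tm.val, val_num, scons, exists_eq_left]

theorem isSigma_fixed {A : Fml} (hA : IsSigma A) (i : ℕ) : IsSigma (fixed A i) :=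
  .ex (.and (.delta0 (.eq _ _)) (.ex (.and (.delta0 (.eq _ _)) hA)))

theorem isSentence_fixed {A : Fml} (hA : A.FreeBelow 2) (i : ℕ) : (fixed A i).IsSentence :=
  ⟨⟨Nat.zero_lt_one, num_freeBelow _ _⟩, ⟨Nat.zero_lt_two, num_freeBelow _ _⟩, hA⟩

/-- Propositional contexts with holes indexed by `W`. -/
inductive Template (W : Type) : Type
  | hole : W → Template W
  | const : Fml → Template W
  | or : Template W → Template W → Template W
  | imp : Template W → Template W → Template W

/-- The formula obtained by filling the holes. -/
def Template.fill {W : Type} (S : W → Fml) : Template W → Fml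
  | .hole i => S i
  | .const A => A
  | .or s t => .or (s.fill S) (t.fill S)
  | .imp s t => .imp (s.fill S) (t.fill S)

/-- The Gödel number of the template filled with the sentences `fixed A (idx i)`, as a function of
that of `A`. -/
def Template.codeTm {W : Type} (idx : W → ℕ) : Template W → CodeTm
  | .hole i => fixedCode (idx i)
  | .const A => .const A.code
  | .or s t => .pair (.const 3) (.pair (s.codeTm idx) (t.codeTm idx))
  | .imp s t => .pair (.const 4) (.pair (s.codeTm idx) (t.codeTm idx))

theorem Template.eval_codeTm {W : Type} (idx : W → ℕ) (A : Fml) (t : Template W) :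
    (t.codeTm idx).eval A.code = (t.fill fun i => fixed A (idx i)).code := by
  induction t with
  | hole i => exact eval_fixedCode A (idx i)
  | const B => rfl
  | or s t ihs iht => simp only [Template.codeTm, CodeTm.eval, Template.fill, Fml.code, ihs, iht]
  | imp s t ihs iht => simp only [Template.codeTm, CodeTm.eval, Template.fill, Fml.code, ihs, iht]

/-- The disjunction of the holes in a list. -/
def Template.bigOr {W : Type} (l : List W) : Template W :=
  l.foldr (fun i t => .or (.hole i) t) (.const .bot)

theorem Template.fill_bigOr {W : Type} (S : W → Fml) (l : List W) :
    (Template.bigOr l).fill S = IntArith.bigOr (l.map S) := by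
  induction l with
  | nil => rfl
  | cons i l ih =>
    change Fml.or (S i) ((Template.bigOr l).fill S) = Fml.or (S i) (IntArith.bigOr (l.map S))
    rw [ih]

theorem sat_boxOf {M : Type} [ArithStr M] {p A : Fml} (e : ℕ → M) :
    (boxOf (.ex p) A).Sat e ↔ ∃ w, p.Sat (scons w (scons (numeral M A.code) e)) := by
  rw [boxOf, Fml.sat_inst, val_num]; rfl

theorem isSigma_boxOf {P : Fml} (hP : IsSigma1 P) (A : Fml) : IsSigma (boxOf P A) := by
  obtain ⟨p, hp, rfl⟩ := hP
  exact .ex (.delta0 (hp.subst _))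

theorem isSentence_boxOf {P : Fml} (hP : P.FreeBelow 1) (A : Fml) : (boxOf P A).IsSentence :=
  hP.subst fun i hi => by
    rw [Nat.lt_one_iff.1 hi]
    exact num_freeBelow _ _

/-- The fixed point behind Löb's theorem: a `Σ`-sentence `R` equivalent to `P(⌜R → A⌝)`. -/
theorem exists_loeb_fixedPoint {P : Fml} (hP : IsSigma1 P) (hf : P.FreeBelow 1) (A : Fml) :
    ∃ R, IsSigma R ∧ R.IsSentence ∧ ISigma1Proves (.imp R (boxOf P (.imp R A))) ∧
      ISigma1Proves (.imp (boxOf P (.imp R A)) R) := by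
  let t : Template Unit := .imp (.hole ()) (.const A)
  let B : Fml := (t.codeTm fun _ => 0).app (.var 1) P
  have hB : IsSigma B := CodeTm.isSigma_app _ _ hP.isSigma
  have hsat : ∀ (M : Type) [ArithStr M] [IsDelta0Model M] (e : ℕ → M),
      (fixed B 0).Sat e ↔ (boxOf P (.imp (fixed B 0) A)).Sat e := by
    intro M _ _ e
    have hv : ∀ x y : M, (Tm.var 1).val (scons x (scons y e)) = y := fun _ _ => rfl
    rw [sat_fixed, CodeTm.sat_app (y := .var 1) _ P ((hv _ _).trans rfl), Template.eval_codeTm,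
      boxOf, Fml.sat_inst, val_num]
    refine Fml.sat_congr hf fun i hi => ?_
    rw [Nat.lt_one_iff.1 hi]; rfl
  have hR := isSigma_fixed hB 0
  have hbox := isSigma_boxOf hP (.imp (fixed B 0) A)
  refine ⟨fixed B 0, hR, isSentence_fixed ?_ 0, ?_, ?_⟩
  · exact CodeTm.freeBelow_app _ Nat.one_lt_two (hf.mono (by omega))
  · exact iSigma1Proves_imp hR hbox fun M _ _ e => (hsat M e).1
  · exact iSigma1Proves_imp hbox hR fun M _ _ e => (hsat M e).2

/-! ### Races between finitely many `Σ₁`-sentences -/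

/-- A numbering of a finite type. -/
noncomputable def index {ι : Type} [Fintype ι] (i : ι) : ℕ := (Fintype.equivFin ι i : ℕ)

theorem index_injective {ι : Type} [Fintype ι] : Function.Injective (index (ι := ι)) :=
  fun _ _ h => (Fintype.equivFin ι).injective (Fin.ext h)

/-- The data of a race. The states are the elements of `W`, together with an initial state `none`.
Each trigger `t : τ` is a `Σ₁`-sentence `∃ w, wit t (w, ⌜A⌝)`, where `A` comes from the template
`tmpl t`, whose holes are to be filled with sentences saying which states are reached. It is
effective at some of the states below its target. From every state, the race moves to the target of
the effective trigger that has the least witness. -/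
structure Race (W τ : Type) [PartialOrder W] where
  /-- The state to which a trigger leads. -/
  target : τ → W
  /-- The states at which a trigger has an effect. -/
  eff : τ → Option W → Prop
  /-- The sentence to which the predicate of a trigger applies. -/
  tmpl : τ → Template W
  /-- The matrix of the predicate of a trigger; the witness has index `0`. -/
  wit : τ → Fml
  wit_delta0 (t : τ) : IsDelta0 (wit t)
  wit_freeBelow (t : τ) : (wit t).FreeBelow 2
  lt_target {t : τ} {i : W} : eff t (some i) → i < target t

namespace Race

open Classical in
/-- The disjunction over the elements of a finite type that satisfy `p`. -/
noncomputable def disj {ι : Type} [Fintype ι] (p : ι → Prop) (f : ι → Fml) : Fml :=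
  bigOr (((Finset.univ.filter p).toList).map f)

open Classical in
/-- The conjunction over the elements of a finite type that satisfy `p`. -/
noncomputable def conj {ι : Type} [Fintype ι] (p : ι → Prop) (f : ι → Fml) : Fml :=
  bigAnd (((Finset.univ.filter p).toList).map f)

section

variable {ι : Type} [Fintype ι] {p : ι → Prop} {f : ι → Fml}

theorem sat_disj {M : Type} [ArithStr M] {e : ℕ → M} :
    (disj p f).Sat e ↔ ∃ i, p i ∧ (f i).Sat e := by
  simp [disj, sat_bigOr]

theorem sat_conj {M : Type} [ArithStr M] {e : ℕ → M} :
    (conj p f).Sat e ↔ ∀ i, p i → (f i).Sat e := by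
  simp [conj, sat_bigAnd]

theorem isSigma_disj (h : ∀ i, p i → IsSigma (f i)) : IsSigma (disj p f) :=
  isSigma_bigOr (by simpa using h)

theorem isSigma_conj (h : ∀ i, p i → IsSigma (f i)) : IsSigma (conj p f) :=
  isSigma_bigAnd (by simpa using h)

theorem isDelta0_disj (h : ∀ i, p i → IsDelta0 (f i)) : IsDelta0 (disj p f) :=
  isDelta0_bigOr (by simpa using h)

theorem freeBelow_disj {n : ℕ} (h : ∀ i, p i → (f i).FreeBelow n) : (disj p f).FreeBelow n :=
  freeBelow_bigOr (by simpa using h)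

theorem isSentence_disj (h : ∀ i, (f i).IsSentence) : (disj p f).IsSentence :=
  freeBelow_disj fun i _ => h i

theorem freeBelow_conj {n : ℕ} (h : ∀ i, p i → (f i).FreeBelow n) : (conj p f).FreeBelow n :=
  freeBelow_bigAnd (by simpa using h)

end

variable {W τ : Type} [PartialOrder W] [Fintype W] [Fintype τ] (R : Race W τ)

/-- The moves of the race in a structure, where `trig t w` says that `w` is a witness of the trigger
`t`. If several triggers have the same least witness, the first one counts. -/
def Step {M : Type} [ArithStr M] (trig : τ → M → Prop) (j k : Option W) : Prop :=
  ∃ w t, (k = some (R.target t) ∧ R.eff t j) ∧ trig t w ∧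
    (∀ t', (R.eff t' j ∧ index t' < index t) → ¬ trig t' w) ∧
    ∀ t', R.eff t' j → ∀ w', SLt w' w → ¬ trig t' w'

/-- The Gödel number of the sentence of a trigger, as a function of the Gödel number of the formula
that is diagonalized. -/
noncomputable def code (t : τ) : CodeTm := (R.tmpl t).codeTm index

/-- The matrix of a trigger with its variables exchanged. -/
def witSwap (t : τ) : Fml := (R.wit t).subst (consSubst (.var 1) fun _ => .var 0)

/-- The formula for the moves of the race; the variable with index `1` stands for the Gödel number of
the formula that is diagonalized. -/
noncomputable def stepF (j k : Option W) : Fml :=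
  .ex (disj (fun t => k = some (R.target t) ∧ R.eff t j) fun t =>
    .and ((R.code t).app (.var 2) (R.witSwap t))
      (.and (conj (fun t' => R.eff t' j ∧ index t' < index t) fun t' =>
          (R.code t').app (.var 2) (neg (R.witSwap t')))
        (conj (fun t' => R.eff t' j) fun t' =>
          (R.code t').app (.var 2) (ball (.var 1) (neg (R.wit t'))))))

omit [Fintype W] [Fintype τ] in
theorem isDelta0_witSwap (t : τ) : IsDelta0 (R.witSwap t) := (R.wit_delta0 t).subst _

omit [Fintype W] [Fintype τ] in
theorem freeBelow_witSwap (t : τ) {n : ℕ} : (R.witSwap t).FreeBelow (n + 2) :=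
  (R.wit_freeBelow t).subst fun i _ => by
    cases i <;> simp [consSubst, Tm.FreeBelow]

theorem isSigma_stepF (j k : Option W) : IsSigma (R.stepF j k) :=
  .ex (isSigma_disj fun t _ => .and (CodeTm.isSigma_app _ _ (.delta0 (R.isDelta0_witSwap t)))
    (.and (isSigma_conj fun t' _ => CodeTm.isSigma_app _ _
        (.delta0 (.imp (R.isDelta0_witSwap t') .bot)))
      (isSigma_conj fun t' _ => CodeTm.isSigma_app _ _
        (.delta0 (.ball _ (.imp (R.wit_delta0 t') .bot))))))

theorem freeBelow_stepF (j k : Option W) : (R.stepF j k).FreeBelow 2 := by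
  have h2 : (Tm.var 2).FreeBelow 3 := Nat.lt_succ_self 2
  refine freeBelow_disj (n := 3) fun t _ => ⟨?_, ?_, ?_⟩
  · exact CodeTm.freeBelow_app _ h2 (R.freeBelow_witSwap t)
  · exact freeBelow_conj fun t' _ => CodeTm.freeBelow_app _ h2 ⟨R.freeBelow_witSwap t', trivial⟩
  · refine freeBelow_conj fun t' _ => CodeTm.freeBelow_app _ h2 (freeBelow_ball ?_ ⟨?_, trivial⟩)
    · exact Nat.succ_lt_succ (Nat.succ_pos _)
    · exact (R.wit_freeBelow t').mono (by omega)

/-- The formula saying that the state `i` is reached. -/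
noncomputable def reachF (i : W) : Fml :=
  .or (R.stepF none (some i)) (disj (· < i) fun j =>
    open Classical in if _h : j < i then .and (reachF j) (R.stepF (some j) (some i)) else .bot)
termination_by wellFounded_lt.wrap i
decreasing_by exact _h

theorem isSigma_reachF (i : W) : IsSigma (R.reachF i) := by
  induction i using WellFoundedLT.induction with
  | ind i ih =>
    rw [reachF]
    refine .or (R.isSigma_stepF _ _) (isSigma_disj fun j hj => ?_)
    rw [dif_pos hj]
    exact .and (ih j hj) (R.isSigma_stepF _ _)

theorem freeBelow_reachF (i : W) : (R.reachF i).FreeBelow 2 := by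
  induction i using WellFoundedLT.induction with
  | ind i ih =>
    rw [reachF]
    refine ⟨R.freeBelow_stepF _ _, freeBelow_disj fun j hj => ?_⟩
    rw [dif_pos hj]
    exact ⟨ih j hj, R.freeBelow_stepF _ _⟩

/-- The formula that is diagonalized: the state with the index given by the variable with index `0`
is reached. -/
noncomputable def body : Fml :=
  disj (fun _ : W => True) fun i => .and (.eq (.var 0) (num (index i))) (R.reachF i)

/-- The sentence saying that the state `i` is reached in the race. -/
noncomputable def reached (i : W) : Fml := fixed R.body (index i)

theorem isSigma_reached (i : W) : IsSigma (R.reached i) :=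
  isSigma_fixed (isSigma_disj fun i _ => .and (.delta0 (.eq _ _)) (R.isSigma_reachF i)) _

theorem freeBelow_body : R.body.FreeBelow 2 :=
  freeBelow_disj fun i _ => ⟨⟨Nat.zero_lt_two, num_freeBelow _ _⟩, R.freeBelow_reachF i⟩

theorem isSentence_reached (i : W) : (R.reached i).IsSentence :=
  isSentence_fixed R.freeBelow_body _

section Semantics

variable {M : Type} [ArithStr M]

/-- `w` is a witness of the trigger `t`. -/
def Trig (M : Type) [ArithStr M] (t : τ) (w : M) : Prop :=
  (R.wit t).Sat (scons w fun _ => numeral M ((R.tmpl t).fill R.reached).code)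

theorem sat_wit (t : τ) (w : M) (e : ℕ → M) :
    (R.wit t).Sat (scons w (scons (numeral M ((R.tmpl t).fill R.reached).code) e)) ↔
      R.Trig M t w :=
  Fml.sat_congr (R.wit_freeBelow t) fun i hi => by
    rcases i with _ | _ | i
    · rfl
    · rfl
    · omega

theorem sat_witSwap (t : τ) (w : M) (e : ℕ → M) :
    (R.witSwap t).Sat (scons (numeral M ((R.tmpl t).fill R.reached).code) (scons w e)) ↔
      R.Trig M t w := by
  rw [witSwap, Fml.sat_subst, Trig]
  refine Fml.sat_congr (R.wit_freeBelow t) fun i _ => ?_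
  cases i <;> rfl

theorem eval_code (t : τ) :
    (R.code t).eval R.body.code = ((R.tmpl t).fill R.reached).code :=
  Template.eval_codeTm index R.body (R.tmpl t)

/-- The trigger `t` has a witness. -/
theorem sat_boxOf_wit (t : τ) (e : ℕ → M) :
    (boxOf (.ex (R.wit t)) ((R.tmpl t).fill R.reached)).Sat e ↔ ∃ w, R.Trig M t w := by
  rw [sat_boxOf]
  exact exists_congr fun w => R.sat_wit t w e

variable [IsDelta0Model M]

theorem sat_stepF {j k : Option W} {e : ℕ → M} (he : e 1 = numeral M R.body.code) :
    (R.stepF j k).Sat e ↔ R.Step (R.Trig M) j k := by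
  have h2 : ∀ w : M, (Tm.var 2).val (scons w e) = numeral M R.body.code := fun _ => he
  refine exists_congr fun w => sat_disj.trans (exists_congr fun t => and_congr Iff.rfl ?_)
  refine and_congr ?_ (and_congr (sat_conj.trans (forall₂_congr fun t' _ => ?_))
    (sat_conj.trans (forall₂_congr fun t' _ => ?_)))
  · rw [CodeTm.sat_app _ _ (h2 w), eval_code, sat_witSwap]
  · rw [CodeTm.sat_app _ _ (h2 w), eval_code, sat_neg, sat_witSwap]
  · rw [CodeTm.sat_app _ _ (h2 w), eval_code, sat_ball]
    refine forall₂_congr fun w' _ => ?_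
    rw [sat_neg, sat_wit]

theorem sat_reachF {i : W} {e : ℕ → M} (he : e 1 = numeral M R.body.code) :
    (R.reachF i).Sat e ↔ Relation.ReflTransGen (R.Step (R.Trig M)) none (some i) := by
  induction i using WellFoundedLT.induction with
  | ind i ih =>
    have h : (R.reachF i).Sat e ↔ R.Step (R.Trig M) none (some i) ∨ ∃ j, j < i ∧
        Relation.ReflTransGen (R.Step (R.Trig M)) none (some j) ∧
        R.Step (R.Trig M) (some j) (some i) := by
      rw [reachF, Fml.Sat, sat_disj, R.sat_stepF he]
      refine or_congr Iff.rfl (exists_congr fun j => and_congr_right fun hj => ?_)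
      rw [dif_pos hj, Fml.Sat, ih j hj, R.sat_stepF he]
    rw [h, Relation.ReflTransGen.cases_tail_iff]
    constructor
    · rintro (h | ⟨j, -, hr, hs⟩)
      · exact .inr ⟨none, .refl, h⟩
      · exact .inr ⟨some j, hr, hs⟩
    · rintro (h | ⟨_ | j, hr, hs⟩)
      · cases h
      · exact .inl hs
      · refine .inr ⟨j, ?_, hr, hs⟩
        obtain ⟨w, t, ⟨ht, he⟩, -⟩ := hs
        rw [Option.some.inj ht]
        exact R.lt_target he

theorem sat_reached (i : W) (e : ℕ → M) :
    (R.reached i).Sat e ↔ Relation.ReflTransGen (R.Step (R.Trig M)) none (some i) := by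
  have h1 : ∀ x y : M, scons x (scons y e) 1 = y := fun _ _ => rfl
  rw [reached, sat_fixed, body, sat_disj]
  simp only [true_and, Fml.Sat, val_num, Tm.val]
  constructor
  · rintro ⟨j, hj, h⟩
    rw [index_injective (numeral_injective hj)]
    exact (R.sat_reachF (h1 _ _)).1 h
  · exact fun h => ⟨i, rfl, (R.sat_reachF (h1 _ _)).2 h⟩

/-- Every state has at most one successor. -/
theorem step_rightUnique : Relator.RightUnique (R.Step (R.Trig M)) := by
  rintro j k k' ⟨w, t, ⟨rfl, ht⟩, hw, hmin, hlt⟩ ⟨w', t', ⟨rfl, ht'⟩, hw', hmin', hlt'⟩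
  rcases IsDelta0Model.trichotomy w w' with h | rfl | h
  · exact absurd hw (hlt' t ht w h)
  · rcases lt_trichotomy (index t) (index t') with h | h | h
    · exact absurd hw (hmin' t ⟨ht, h⟩)
    · rw [index_injective h]
    · exact absurd hw' (hmin t' ⟨ht', h⟩)
  · exact absurd hw' (hlt t' ht' w' h)

/-- A state with an effective trigger that has a witness has a successor, by the least number
principle. -/
theorem exists_step {t : τ} {j : Option W} {w : M} (ht : R.eff t j) (hw : R.Trig M t w) :
    ∃ k, R.Step (R.Trig M) j k := by
  let D : Fml := disj (fun t => R.eff t j) fun t =>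
    (R.wit t).subst (consSubst (.var 0) fun _ => num ((R.tmpl t).fill R.reached).code)
  have hD : IsDelta0 D := isDelta0_disj fun t _ => (R.wit_delta0 t).subst _
  have hsat : ∀ (w : M) (e : ℕ → M), D.Sat (scons w e) ↔ ∃ t, R.eff t j ∧ R.Trig M t w := by
    intro w e
    refine sat_disj.trans (exists_congr fun t => and_congr Iff.rfl ?_)
    rw [Fml.sat_subst, Trig]
    refine Fml.sat_congr (R.wit_freeBelow t) fun i _ => ?_
    cases i with
    | zero => rfl
    | succ i => exact val_num _ _
  obtain ⟨w, hw, hmin⟩ := IsDelta0Model.least hD (fun _ => w) ((hsat w _).2 ⟨t, ht, hw⟩)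
  simp only [hsat] at hw hmin
  have hwf := (InvImage.wf (index (ι := τ)) Nat.lt_wfRel.wf).has_min
    {t | R.eff t j ∧ R.Trig M t w} hw
  obtain ⟨t, ⟨ht, hw⟩, hmin'⟩ := hwf
  exact ⟨_, w, t, ⟨rfl, ht⟩, hw, fun t' h' h => hmin' t' ⟨h'.1, h⟩ h'.2,
    fun t' h' w' hlt h => hmin w' hlt ⟨t', h', h⟩⟩

end Semantics

end Race

/-! ### Finite Kripke models of `iGLC` -/

/-- The modal relation of a frame for `iGLC`, on a set of worlds ordered by the intuitionistic
relation. It is contained in the strict order, and precomposing it with the order does not enlarge it. -/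
structure ModalRel (W : Type) [PartialOrder W] where
  /-- The modal relation. -/
  rel : W → W → Prop
  lt {i j : W} : rel i j → i < j
  of_le_of_rel {i j k : W} : i ≤ j → rel j k → rel i k

/-- Forcing in a Kripke model. -/
def Forces {W : Type} [PartialOrder W] (R : ModalRel W) (V : ℕ → W → Prop) : MFml → W → Prop
  | .letter p, i => V p i
  | .bot, _ => False
  | .and A B, i => Forces R V A i ∧ Forces R V B i
  | .or A B, i => Forces R V A i ∨ Forces R V B i
  | .imp A B, i => ∀ j, i ≤ j → Forces R V A j → Forces R V B j
  | .box A, i => ∀ j, R.rel i j → Forces R V A j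

theorem Forces.mono {W : Type} [PartialOrder W] {R : ModalRel W} {V : ℕ → W → Prop}
    (hV : ∀ p i j, i ≤ j → V p i → V p j) {A : MFml} {i j : W} (hij : i ≤ j)
    (h : Forces R V A i) : Forces R V A j := by
  induction A with
  | letter p => exact hV p i j hij h
  | bot => exact h
  | and A B ihA ihB => exact ⟨ihA h.1, ihB h.2⟩
  | or A B ihA ihB => exact h.imp ihA ihB
  | imp A B _ _ => exact fun k hk => h k (hij.trans hk)
  | box A _ => exact fun k hk => h k (R.of_le_of_rel hij hk)

/-! ### Kripke completeness of `iGLC` -/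

/-- Derivability in `iGLC` from a set of assumptions, to which necessitation does not apply. -/
inductive MProv (Γ : Set MFml) : MFml → Prop
  | thm {A : MFml} : IGLC A → MProv Γ A
  | hyp {A : MFml} : A ∈ Γ → MProv Γ A
  | mp {A B : MFml} : MProv Γ A → MProv Γ (.imp A B) → MProv Γ B

theorem IGLC.of_intTaut {A : MFml} (h : IntTaut A) : IGLC A := .of_iGL (.of_iK (.taut h))

namespace MProv

variable {Γ Δ : Set MFml} {A B C : MFml}

theorem taut (h : IntTaut A) : MProv Γ A := .thm (.of_intTaut h)

theorem deduction (h : MProv (insert A Γ) B) : MProv Γ (.imp A B) := by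
  induction h with
  | thm h => exact .mp (.thm h) (.taut (.imp_k _ _))
  | @hyp B h =>
    rcases h with rfl | h
    · exact .mp (.taut (.imp_k B B)) (.mp (.taut (.imp_k B (.imp B B))) (.taut (.imp_s _ _ _)))
    · exact .mp (.hyp h) (.taut (.imp_k _ _))
  | mp _ _ h₁ h₂ => exact .mp h₁ (.mp h₂ (.taut (.imp_s _ _ _)))

theorem of_empty (h : MProv ∅ A) : IGLC A := by
  induction h with
  | thm h => exact h
  | hyp h => exact absurd h (Set.notMem_empty _)
  | mp _ _ h₁ h₂ => exact .mp h₁ h₂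

theorem box (h : MProv Δ A) (hΔ : ∀ B ∈ Δ, MProv Γ (.box B)) : MProv Γ (.box A) := by
  induction h with
  | thm h => exact .thm (.nec h)
  | hyp h => exact hΔ _ h
  | mp _ _ h₁ h₂ => exact .mp h₁ (.mp h₂ (.thm (.of_iGL (.of_iK (.distrib _ _)))))

theorem loeb (h : MProv Γ (.box (.imp (.box A) A))) : MProv Γ (.box A) :=
  .mp h (.thm (.of_iGL (.loeb A)))

end MProv

/-- A set of modal sentences that is closed under immediate subformulas. -/
structure SubClosed (Φ : Set MFml) : Prop where
  and {A B : MFml} : .and A B ∈ Φ → A ∈ Φ ∧ B ∈ Φ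
  or {A B : MFml} : .or A B ∈ Φ → A ∈ Φ ∧ B ∈ Φ
  imp {A B : MFml} : .imp A B ∈ Φ → A ∈ Φ ∧ B ∈ Φ
  box {A : MFml} : .box A ∈ Φ → A ∈ Φ

theorem SubClosed.union {Φ Ψ : Set MFml} (h : SubClosed Φ) (h' : SubClosed Ψ) :
    SubClosed (Φ ∪ Ψ) where
  and hA := hA.elim (fun hA => ⟨.inl (h.and hA).1, .inl (h.and hA).2⟩)
    fun hA => ⟨.inr (h'.and hA).1, .inr (h'.and hA).2⟩
  or hA := hA.elim (fun hA => ⟨.inl (h.or hA).1, .inl (h.or hA).2⟩)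
    fun hA => ⟨.inr (h'.or hA).1, .inr (h'.or hA).2⟩
  imp hA := hA.elim (fun hA => ⟨.inl (h.imp hA).1, .inl (h.imp hA).2⟩)
    fun hA => ⟨.inr (h'.imp hA).1, .inr (h'.imp hA).2⟩
  box hA := hA.elim (fun hA => .inl (h.box hA)) fun hA => .inr (h'.box hA)

theorem exists_subClosed (A : MFml) : ∃ Φ : Set MFml, Φ.Finite ∧ SubClosed Φ ∧ A ∈ Φ := by
  have key : ∀ {Φ : Set MFml} (A : MFml), SubClosed Φ →
      (∀ B C, A = .and B C → B ∈ Φ ∧ C ∈ Φ) → (∀ B C, A = .or B C → B ∈ Φ ∧ C ∈ Φ) →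
      (∀ B C, A = .imp B C → B ∈ Φ ∧ C ∈ Φ) → (∀ B, A = .box B → B ∈ Φ) →
      SubClosed (insert A Φ) := by
    intro Φ A h h₁ h₂ h₃ h₄
    refine ⟨?_, ?_, ?_, ?_⟩
    · rintro B C (hA | hA)
      · exact ⟨.inr (h₁ B C hA.symm).1, .inr (h₁ B C hA.symm).2⟩
      · exact ⟨.inr (h.and hA).1, .inr (h.and hA).2⟩
    · rintro B C (hA | hA)
      · exact ⟨.inr (h₂ B C hA.symm).1, .inr (h₂ B C hA.symm).2⟩
      · exact ⟨.inr (h.or hA).1, .inr (h.or hA).2⟩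
    · rintro B C (hA | hA)
      · exact ⟨.inr (h₃ B C hA.symm).1, .inr (h₃ B C hA.symm).2⟩
      · exact ⟨.inr (h.imp hA).1, .inr (h.imp hA).2⟩
    · rintro B (hA | hA)
      · exact .inr (h₄ B hA.symm)
      · exact .inr (h.box hA)
  have hempty : SubClosed ∅ := ⟨False.elim, False.elim, False.elim, False.elim⟩
  induction A with
  | letter p => exact ⟨_, Set.finite_empty.insert _, key _ hempty (by simp) (by simp) (by simp)
      (by simp), Set.mem_insert _ _⟩
  | bot => exact ⟨_, Set.finite_empty.insert _, key _ hempty (by simp) (by simp) (by simp)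
      (by simp), Set.mem_insert _ _⟩
  | and A B ihA ihB =>
    obtain ⟨Φ, hf, hc, hm⟩ := ihA
    obtain ⟨Ψ, hf', hc', hm'⟩ := ihB
    exact ⟨_, (hf.union hf').insert _, key (.and A B) (hc.union hc')
      (by rintro B C ⟨⟩; exact ⟨.inl hm, .inr hm'⟩) (by simp) (by simp) (by simp),
      Set.mem_insert _ _⟩
  | or A B ihA ihB =>
    obtain ⟨Φ, hf, hc, hm⟩ := ihA
    obtain ⟨Ψ, hf', hc', hm'⟩ := ihB
    exact ⟨_, (hf.union hf').insert _, key (.or A B) (hc.union hc') (by simp)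
      (by rintro B C ⟨⟩; exact ⟨.inl hm, .inr hm'⟩) (by simp) (by simp),
      Set.mem_insert _ _⟩
  | imp A B ihA ihB =>
    obtain ⟨Φ, hf, hc, hm⟩ := ihA
    obtain ⟨Ψ, hf', hc', hm'⟩ := ihB
    exact ⟨_, (hf.union hf').insert _, key (.imp A B) (hc.union hc') (by simp) (by simp)
      (by rintro B C ⟨⟩; exact ⟨.inl hm, .inr hm'⟩) (by simp),
      Set.mem_insert _ _⟩
  | box A ih =>
    obtain ⟨Φ, hf, hc, hm⟩ := ih
    exact ⟨_, hf.insert _, key (.box A) hc (by simp) (by simp) (by simp)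
      (by rintro B ⟨⟩; exact hm), Set.mem_insert _ _⟩

/-- The worlds of the canonical model: the prime theories relative to `Φ`. -/
structure IsWorld (Φ Γ : Set MFml) : Prop where
  subset : Γ ⊆ Φ
  closed {A : MFml} : A ∈ Φ → MProv Γ A → A ∈ Γ
  bot : ¬ MProv Γ .bot
  or {A B : MFml} : .or A B ∈ Γ → A ∈ Γ ∨ B ∈ Γ

theorem exists_world {Φ : Set MFml} (hfin : Φ.Finite) (hΦ : SubClosed Φ) {Δ : Set MFml}
    (hΔ : Δ ⊆ Φ) {B : MFml} (hB : ¬ MProv Δ B) : ∃ Γ, IsWorld Φ Γ ∧ Δ ⊆ Γ ∧ B ∉ Γ := by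
  obtain ⟨Γ, ⟨hmem, hmax⟩⟩ := (hfin.finite_subsets.subset
    (show {Γ | Γ ⊆ Φ ∧ Δ ⊆ Γ ∧ ¬ MProv Γ B} ⊆ {Γ | Γ ⊆ Φ} from fun _ h => h.1)).exists_maximal
    ⟨Δ, hΔ, subset_rfl, hB⟩
  obtain ⟨hΓΦ, hΔΓ, hΓB⟩ := hmem
  have hins : ∀ A ∈ Φ, A ∉ Γ → MProv Γ (.imp A B) := by
    intro A hA hAΓ
    by_contra h
    refine hAΓ (hmax (y := insert A Γ) ⟨Set.insert_subset hA hΓΦ,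
      hΔΓ.trans (Set.subset_insert _ _), fun h' => h h'.deduction⟩ (Set.subset_insert _ _)
      (Set.mem_insert _ _))
  refine ⟨Γ, ⟨hΓΦ, ?_, ?_, ?_⟩, hΔΓ, fun h => hΓB (.hyp h)⟩
  · intro A hA hp
    by_contra hn
    exact hΓB (.mp hp (hins A hA hn))
  · exact fun h => hΓB (.mp h (.taut (.bot_elim B)))
  · intro A C hAC
    by_contra! hn
    obtain ⟨hA, hC⟩ := hΦ.or (hΓΦ hAC)
    exact hΓB (.mp (.hyp hAC) (.mp (hins C hC hn.2) (.mp (hins A hA hn.1)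
      (.taut (.or_elim A C B)))))

/-- The modal relation of the canonical model. -/
def canonicalRel (Φ : Set MFml) : ModalRel {Γ : Set MFml // IsWorld Φ Γ} where
  rel Γ Δ := Γ ≤ Δ ∧ (∀ B, .box B ∈ Γ.1 → B ∈ Δ.1) ∧ ∃ C, .box C ∈ Δ.1 ∧ .box C ∉ Γ.1
  lt := fun ⟨h, _, _, hC, hC'⟩ => lt_of_le_of_ne h fun he => hC' (he ▸ hC)
  of_le_of_rel := fun h ⟨h₁, h₂, C, hC, hC'⟩ =>
    ⟨h.trans h₁, fun B hB => h₂ B (h hB), C, hC, fun h' => hC' (h h')⟩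

theorem forces_canonical_iff {Φ : Set MFml} (hfin : Φ.Finite) (hΦ : SubClosed Φ) (A : MFml)
    (hA : A ∈ Φ) (Γ : {Γ : Set MFml // IsWorld Φ Γ}) :
    Forces (canonicalRel Φ) (fun p Γ => .letter p ∈ Γ.1) A Γ ↔ A ∈ Γ.1 := by
  induction A generalizing Γ with
  | letter p => rfl
  | bot => exact ⟨False.elim, fun h => Γ.2.bot (.hyp h)⟩
  | and A B ihA ihB =>
    obtain ⟨hA', hB'⟩ := hΦ.and hA
    rw [Forces, ihA hA', ihB hB']
    constructor
    · exact fun h => Γ.2.closed hA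
        (.mp (.hyp h.2) (.mp (.hyp h.1) (.taut (.and_intro A B))))
    · exact fun h => ⟨Γ.2.closed hA' (.mp (.hyp h) (.taut (.and_left A B))),
        Γ.2.closed hB' (.mp (.hyp h) (.taut (.and_right A B)))⟩
  | or A B ihA ihB =>
    obtain ⟨hA', hB'⟩ := hΦ.or hA
    rw [Forces, ihA hA', ihB hB']
    refine ⟨fun h => Γ.2.closed hA ?_, Γ.2.or⟩
    rcases h with h | h
    · exact .mp (.hyp h) (.taut (.or_left A B))
    · exact .mp (.hyp h) (.taut (.or_right A B))
  | imp A B ihA ihB =>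
    obtain ⟨hA', hB'⟩ := hΦ.imp hA
    constructor
    · intro h
      by_contra hn
      obtain ⟨Δ, hΔ, hsub, hB⟩ := exists_world hfin hΦ (Δ := insert A Γ.1)
        (Set.insert_subset hA' Γ.2.subset) (B := B) fun hp => hn (Γ.2.closed hA hp.deduction)
      refine hB ((ihB hB' ⟨Δ, hΔ⟩).1 (h ⟨Δ, hΔ⟩ ?_ ((ihA hA' ⟨Δ, hΔ⟩).2 ?_)))
      · exact (Set.subset_insert _ _).trans hsub
      · exact hsub (Set.mem_insert _ _)
    · intro h Δ hΔ hAΔ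
      exact (ihB hB' Δ).2 (Δ.2.closed hB' (.mp (.hyp ((ihA hA' Δ).1 hAΔ)) (.hyp (hΔ h))))
  | box B ih =>
    have hB' := hΦ.box hA
    constructor
    · intro h
      by_contra hn
      have hnot : ¬ MProv (insert (.box B) (Γ.1 ∪ {C | .box C ∈ Γ.1})) B := by
        refine fun hp => hn (Γ.2.closed hA (hp.deduction.box ?_).loeb)
        rintro C (hC | hC)
        · exact .mp (.hyp hC) (.thm (.completeness C))
        · exact .hyp hC
      obtain ⟨Δ, hΔ, hsub, hBΔ⟩ := exists_world hfin hΦ (Set.insert_subset hA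
        (Set.union_subset Γ.2.subset fun C hC => hΦ.box (Γ.2.subset hC))) hnot
      refine hBΔ ((ih hB' ⟨Δ, hΔ⟩).1 (h ⟨Δ, hΔ⟩ ⟨?_, ?_, B, ?_, hn⟩))
      · exact fun C hC => hsub (.inr (.inl hC))
      · exact fun C hC => hsub (.inr (.inr hC))
      · exact hsub (.inl rfl)
    · exact fun h Δ hΔ => (ih hB' Δ).2 (hΔ.2.1 B h)

/-- Completeness of `iGLC` for finite Kripke models. -/
theorem exists_countermodel {A : MFml} (hA : ¬ IGLC A) :
    ∃ (W : Type) (_ : PartialOrder W) (_ : Finite W) (R : ModalRel W) (V : ℕ → W → Prop),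
      (∀ p i j, i ≤ j → V p i → V p j) ∧ ∃ k, ¬ Forces R V A k := by
  obtain ⟨Φ, hfin, hΦ, hAΦ⟩ := exists_subClosed A
  obtain ⟨Γ, hΓ, -, hAΓ⟩ := exists_world hfin hΦ (Set.empty_subset Φ) fun h => hA h.of_empty
  have : Finite {Γ : Set MFml // IsWorld Φ Γ} :=
    Set.Finite.to_subtype (hfin.finite_subsets.subset fun Γ (h : IsWorld Φ Γ) => h.subset)
  exact ⟨_, inferInstance, this, canonicalRel Φ, fun p Γ => .letter p ∈ Γ.1,
    fun p i j h hi => h hi, ⟨Γ, hΓ⟩, fun h => hAΓ ((forces_canonical_iff hfin hΦ A hAΦ _).1 h)⟩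

/-! ### Solovay's argument in a Heyting algebra -/

/-- The modal operators that preserve `⊤` and distribute over implication. -/
structure IsBox {H : Type} [HeytingAlgebra H] (f : H → H) : Prop where
  top : f ⊤ = ⊤
  himp (a b : H) : f (a ⇨ b) ≤ f a ⇨ f b

namespace IsBox

variable {H : Type} [HeytingAlgebra H] {f : H → H} (hf : IsBox f)
include hf

theorem mono {a b : H} (h : a ≤ b) : f a ≤ f b := by
  have := hf.himp a b
  rw [himp_eq_top_iff.2 h, hf.top] at this
  exact himp_eq_top_iff.1 (top_le_iff.1 this)

theorem inf_le (a b : H) : f a ⊓ f b ≤ f (a ⊓ b) := by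
  rw [← le_himp_iff]
  exact (hf.mono (le_himp_iff.2 le_rfl)).trans (hf.himp b (a ⊓ b))

end IsBox

/-- The value of a modal sentence in a Heyting algebra with an operator. -/
def interp {H : Type} [HeytingAlgebra H] (box : H → H) (v : ℕ → H) : MFml → H
  | .letter p => v p
  | .bot => ⊥
  | .and A B => interp box v A ⊓ interp box v B
  | .or A B => interp box v A ⊔ interp box v B
  | .imp A B => interp box v A ⇨ interp box v B
  | .box A => box (interp box v A)

open Classical in
/-- The join of the values at the worlds that satisfy `p`. -/
noncomputable def supOn {H W : Type} [HeytingAlgebra H] [Fintype W] (s : W → H) (p : W → Prop) :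
    H :=
  (Finset.univ.filter p).sup s

section SupOn

variable {H W : Type} [HeytingAlgebra H] [Fintype W] {s : W → H} {p q : W → Prop}

theorem supOn_le {a : H} : supOn s p ≤ a ↔ ∀ i, p i → s i ≤ a := by
  simp [supOn, Finset.sup_le_iff]

theorem le_supOn {i : W} (h : p i) : s i ≤ supOn s p := supOn_le.1 le_rfl i h

theorem supOn_mono (h : ∀ i, p i → q i) : supOn s p ≤ supOn s q :=
  supOn_le.2 fun i hi => le_supOn (h i hi)

theorem supOn_inf_le {a b : H} : supOn s p ⊓ a ≤ b ↔ ∀ i, p i → s i ⊓ a ≤ b := by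
  simp only [← le_himp_iff, supOn_le]

theorem inf_le_of_inf_le_supOn {a b c : H} (h : c ⊓ a ≤ supOn s p)
    (hp : ∀ i, p i → s i ⊓ a ≤ b) : c ⊓ a ≤ b :=
  (le_inf h inf_le_right).trans (supOn_inf_le.2 hp)

end SupOn

/-- What the arithmetical sentences of the Solovay construction for a finite Kripke frame satisfy, in
the algebra of sentences modulo provable equivalence. The element `s i` says that the race reaches
the world `i`. -/
structure IsSolovay {H W : Type} [HeytingAlgebra H] [PartialOrder W] [Fintype W] (box tri : H → H)
    (R : ModalRel W) (s : W → H) : Prop where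
  box_isBox : IsBox box
  tri_isBox : IsBox tri
  le_box (a : H) : a ≤ box a
  tri_slp (a : H) : tri a ⇨ a ≤ a
  box_tri (p : W → Prop) : box (tri (supOn s p)) ≤ box (supOn s p)
  comparable {i j : W} : ¬ (i ≤ j ∨ j ≤ i) → s i ⊓ s j ≤ ⊥
  tri_move {i k : W} : i < k →
    s i ⊓ tri (supOn s (fun _ => True) ⇨ supOn s (¬ · ≤ k)) ≤ supOn s (i < ·)
  box_move {i k : W} : R.rel i k →
    s i ⊓ box (supOn s (fun _ => True) ⇨ supOn s (¬ · ≤ k)) ≤ supOn s (i < ·)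
  box_start (k : W) :
    box (supOn s (fun _ => True) ⇨ supOn s (¬ · ≤ k)) ≤ supOn s fun _ => True
  le_reason (i : W) : s i ≤ box (supOn s (fun _ => True) ⇨ supOn s (¬ · ≤ i)) ⊔
    tri (supOn s (fun _ => True) ⇨ supOn s (¬ · ≤ i))
  le_tri_reason {j i : W} : j < i → ¬ R.rel j i →
    s j ⊓ s i ≤ tri (supOn s (fun _ => True) ⇨ supOn s (¬ · ≤ i))
  sound {a : H} : box a = ⊤ → a = ⊤
  exists_of_supOn_eq_top {p : W → Prop} : supOn s p = ⊤ → ∃ i, p i ∧ s i = ⊤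

namespace IsSolovay

variable {H W : Type} [HeytingAlgebra H] [PartialOrder W] [Fintype W] {box tri : H → H}
  {R : ModalRel W} {s : W → H} (hs : IsSolovay box tri R s)
include hs

/-- The completeness principle for `tri` follows from the strong Löb principle. -/
theorem le_tri (a : H) : a ≤ tri a := by
  have h : a ≤ tri (a ⊓ tri a) ⇨ a ⊓ tri a := by
    rw [le_himp_iff]
    exact le_inf inf_le_left (inf_le_right.trans (hs.tri_isBox.mono inf_le_left))
  exact (h.trans (hs.tri_slp _)).trans inf_le_right

theorem inf_le_of_comparable {i j : W} {a : H} (h : i ≤ j ∨ j ≤ i → s i ⊓ s j ≤ a) :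
    s i ⊓ s j ≤ a := by
  by_cases hij : i ≤ j ∨ j ≤ i
  · exact h hij
  · exact (hs.comparable hij).trans bot_le

theorem inf_himp_le (i : W) :
    s i ⊓ (supOn s (fun _ => True) ⇨ supOn s (¬ · ≤ i)) ≤ s i ⊓ supOn s (i < ·) := by
  have h₁ : s i ≤ supOn s fun _ => True := le_supOn trivial
  have h₂ : s i ⊓ (supOn s (fun _ => True) ⇨ supOn s (¬ · ≤ i)) ≤ supOn s (¬ · ≤ i) :=
    (inf_le_inf_right _ h₁).trans _root_.inf_himp_le
  refine le_inf inf_le_left ((le_inf h₂ inf_le_left).trans (supOn_inf_le.2 fun j hj => ?_))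
  refine hs.inf_le_of_comparable fun hc => inf_le_left.trans (le_supOn ?_)
  exact lt_of_le_of_ne (hc.resolve_left hj) fun he => hj he.ge

/-- If the world `i` is reached, then provably the race goes on to a world above `i`. -/
theorem le_box_supOn_gt (i : W) : s i ≤ box (supOn s (i < ·)) := by
  have h := hs.inf_himp_le i
  have hbox : s i ⊓ box (supOn s (fun _ => True) ⇨ supOn s (¬ · ≤ i)) ≤ box (supOn s (i < ·)) :=
    (inf_le_inf_right _ (hs.le_box _)).trans ((hs.box_isBox.inf_le _ _).trans
      (hs.box_isBox.mono (h.trans inf_le_right)))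
  have htri : s i ⊓ tri (supOn s (fun _ => True) ⇨ supOn s (¬ · ≤ i)) ≤
      box (supOn s (i < ·)) :=
    calc _ ≤ tri (supOn s (i < ·)) :=
          (inf_le_inf_right _ (hs.le_tri _)).trans ((hs.tri_isBox.inf_le _ _).trans
            (hs.tri_isBox.mono (h.trans inf_le_right)))
      _ ≤ box (tri (supOn s (i < ·))) := hs.le_box _
      _ ≤ _ := hs.box_tri _
  calc s i ≤ s i ⊓ (box (supOn s (fun _ => True) ⇨ supOn s (¬ · ≤ i)) ⊔
        tri (supOn s (fun _ => True) ⇨ supOn s (¬ · ≤ i))) := le_inf le_rfl (hs.le_reason i)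
    _ ≤ _ := by rw [inf_sup_left]; exact sup_le hbox htri

/-- If the world `i` is reached, then provably the race goes on to a modal successor of `i`: the
other worlds above `i` are excluded one after the other, the minimal ones first, because the race
gets from `i` to them by moves of the triangle only. -/
theorem le_box_supOn_rel (i : W) : s i ≤ box (supOn s (R.rel i)) := by
  classical
  have key : ∀ D : Finset W, (∀ j ∈ D, i < j ∧ ¬ R.rel i j) →
      (∀ j ∈ D, ∀ l, j < l → R.rel i l ∨ l ∈ D) →
      s i ≤ box (supOn s fun l => R.rel i l ∨ l ∈ D) → s i ≤ box (supOn s (R.rel i)) := by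
    intro D
    induction D using Finset.strongInduction with
    | H D ih =>
      intro hD hup hi
      rcases D.eq_empty_or_nonempty with rfl | hne
      · simpa using hi
      obtain ⟨j, hj, hmin⟩ := D.exists_minimal hne
      refine ih (D.erase j) (Finset.erase_ssubset hj) (fun l hl => hD l (Finset.mem_of_mem_erase hl))
        (fun l hl m hlm => ?_) ?_
      · refine (hup l (Finset.mem_of_mem_erase hl) m hlm).imp id fun hm => ?_
        refine Finset.mem_erase.2 ⟨?_, hm⟩
        rintro rfl
        exact hlm.not_ge (hmin (Finset.mem_of_mem_erase hl) hlm.le)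
      · set X := supOn s fun l => R.rel i l ∨ l ∈ D.erase j with hX
        have hsj : s j ⊓ s i ≤ tri X := by
          have h₁ := hs.le_tri_reason (hD j hj).1 (hD j hj).2
          calc s j ⊓ s i ≤ tri (s j) ⊓ tri (supOn s (fun _ => True) ⇨ supOn s (¬ · ≤ j)) :=
                le_inf (inf_le_left.trans (hs.le_tri _)) (by rwa [inf_comm])
            _ ≤ tri (s j ⊓ _) := hs.tri_isBox.inf_le _ _
            _ ≤ tri (supOn s (j < ·)) := hs.tri_isBox.mono ((hs.inf_himp_le j).trans inf_le_right)
            _ ≤ tri X := hs.tri_isBox.mono (supOn_mono fun l hl => (hup j hj l hl).imp id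
                fun h => Finset.mem_erase.2 ⟨hl.ne', h⟩)
        have hall : supOn s (fun l => R.rel i l ∨ l ∈ D) ⊓ s i ≤ tri X := by
          refine supOn_inf_le.2 fun l hl => ?_
          by_cases hlj : l = j
          · rw [hlj]; exact hsj
          · refine inf_le_left.trans (le_trans (le_supOn ?_) (hs.le_tri X))
            exact hl.imp id fun h => Finset.mem_erase.2 ⟨hlj, h⟩
        calc s i ≤ box (supOn s fun l => R.rel i l ∨ l ∈ D) ⊓ box (s i) :=
              le_inf hi (hs.le_box _)
          _ ≤ box (tri X) := (hs.box_isBox.inf_le _ _).trans (hs.box_isBox.mono hall)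
          _ ≤ box X := hs.box_tri _
  refine key (Finset.univ.filter fun j => i < j ∧ ¬ R.rel i j) (by simp) ?_
    ((hs.le_box_supOn_gt i).trans (hs.box_isBox.mono (supOn_mono fun l hl => ?_)))
  · intro j hj l hl
    simp only [Finset.mem_filter, Finset.mem_univ, true_and] at hj ⊢
    by_cases h : R.rel i l
    · exact .inl h
    · exact .inr ⟨hj.1.trans hl, h⟩
  · by_cases h : R.rel i l
    · exact .inl h
    · exact .inr (by simpa using ⟨hl, h⟩)

/-- Once the race has left the initial state, a modal sentence is equivalent to the statement that
the race reaches a world that forces it. -/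
theorem interp_iff {V : ℕ → W → Prop} (hV : ∀ p i j, i ≤ j → V p i → V p j) (B : MFml) :
    (∀ i, Forces R V B i → s i ≤ interp box (fun p => supOn s (V p)) B) ∧
      ∀ i, s i ⊓ interp box (fun p => supOn s (V p)) B ≤ supOn s (Forces R V B) := by
  have hmono := fun (A : MFml) (i j : W) (h : i ≤ j) => Forces.mono (R := R) hV (A := A) h
  induction B with
  | letter p => exact ⟨fun i hi => le_supOn hi, fun i => inf_le_right⟩
  | bot => exact ⟨fun i => False.elim, fun i => inf_le_right.trans bot_le⟩
  | and B C ihB ihC =>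
    refine ⟨fun i hi => le_inf (ihB.1 i hi.1) (ihC.1 i hi.2), fun i => ?_⟩
    calc _ ≤ supOn s (Forces R V B) ⊓ supOn s (Forces R V C) :=
          le_inf ((inf_le_inf_left _ inf_le_left).trans (ihB.2 i))
            ((inf_le_inf_left _ inf_le_right).trans (ihC.2 i))
      _ ≤ _ := ?_
    refine supOn_inf_le.2 fun j hj => ?_
    rw [inf_comm]
    refine supOn_inf_le.2 fun k hk => hs.inf_le_of_comparable fun hc => ?_
    rcases hc with h | h
    · exact inf_le_right.trans (le_supOn ⟨hj, hmono C _ _ h hk⟩)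
    · exact inf_le_left.trans (le_supOn ⟨hmono B _ _ h hj, hk⟩)
  | or B C ihB ihC =>
    refine ⟨fun i hi => hi.elim (fun h => (ihB.1 i h).trans le_sup_left)
      fun h => (ihC.1 i h).trans le_sup_right, fun i => ?_⟩
    rw [interp, inf_sup_left]
    exact sup_le ((ihB.2 i).trans (supOn_mono fun j hj => .inl hj))
      ((ihC.2 i).trans (supOn_mono fun j hj => .inr hj))
  | imp B C ihB ihC =>
    constructor
    · intro i hi
      rw [interp, le_himp_iff]
      refine (le_inf (ihB.2 i) inf_le_left).trans (supOn_inf_le.2 fun j hj => ?_)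
      refine hs.inf_le_of_comparable fun hc => ?_
      rcases hc with h | h
      · exact inf_le_right.trans (ihC.1 i (hi i le_rfl (hmono B _ _ h hj)))
      · exact inf_le_left.trans (ihC.1 j (hi j h hj))
    · intro i
      induction i using WellFoundedGT.induction with
      | ind i ih =>
        by_cases hi : Forces R V (.imp B C) i
        · exact inf_le_left.trans (le_supOn hi)
        simp only [Forces, not_forall] at hi
        obtain ⟨k, hik, hkB, hkC⟩ := hi
        rcases hik.eq_or_lt with rfl | hik
        · refine inf_le_of_inf_le_supOn (p := (i < ·)) ?_ ih
          -- Here `B` holds, hence so does `C`, and the race has gone on to a world that forces `C`.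
          have h : s i ⊓ interp box (fun p => supOn s (V p)) (.imp B C) ≤
              supOn s (Forces R V C) := by
            refine (le_inf inf_le_left ?_).trans (ihC.2 i)
            exact (inf_le_inf_right _ (ihB.1 i hkB)).trans _root_.inf_himp_le
          refine (le_inf h inf_le_left).trans (supOn_inf_le.2 fun j hj => ?_)
          refine hs.inf_le_of_comparable fun hc => inf_le_left.trans (le_supOn ?_)
          have hji : ¬ j ≤ i := fun h => hkC (hmono C _ _ h hj)
          exact lt_of_le_of_ne (hc.resolve_left hji) fun he => hji he.ge
        · refine le_trans ?_ (hs.tri_slp _)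
          rw [le_himp_iff, inf_assoc]
          refine inf_le_of_inf_le_supOn (p := (i < ·)) ?_ fun j hj =>
            (inf_le_inf_left _ inf_le_left).trans (ih j hj)
          refine (inf_le_inf_left _ (inf_le_right.trans (hs.tri_isBox.mono ?_))).trans
            (hs.tri_move hik)
          refine le_himp_iff.2 (inf_le_left.trans (supOn_mono fun l hl hlk => ?_))
          exact hkC (hl k hlk hkB)
  | box B ih =>
    constructor
    · exact fun i hi => (hs.le_box_supOn_rel i).trans
        (hs.box_isBox.mono (supOn_le.2 fun j hj => ih.1 j (hi j hj)))
    · intro i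
      induction i using WellFoundedGT.induction with
      | ind i ih' =>
        by_cases hi : Forces R V (.box B) i
        · exact inf_le_left.trans (le_supOn hi)
        simp only [Forces, not_forall] at hi
        obtain ⟨k, hik, hkB⟩ := hi
        refine inf_le_of_inf_le_supOn (p := (i < ·)) ?_ ih'
        refine (inf_le_inf_left _ (hs.box_isBox.mono ?_)).trans (hs.box_move hik)
        rw [le_himp_iff, inf_comm]
        refine supOn_inf_le.2 fun j _ => (ih.2 j).trans (supOn_mono fun l hl hlk => ?_)
        exact hkB (hmono B _ _ hlk hl)

theorem ne_top (i : W) : s i ≠ ⊤ := by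
  induction i using WellFoundedGT.induction with
  | ind i ih =>
    intro h
    obtain ⟨j, hj, hj'⟩ := hs.exists_of_supOn_eq_top
      (hs.sound (top_le_iff.1 (h ▸ hs.le_box_supOn_rel i)))
    exact ih j (R.lt hj) hj'

/-- A modal sentence that fails at some world is not valid under the Solovay interpretation. -/
theorem interp_ne_top {V : ℕ → W → Prop} (hV : ∀ p i j, i ≤ j → V p i → V p j) {A : MFml} {k : W}
    (hk : ¬ Forces R V A k) : interp box (fun p => supOn s (V p)) A ≠ ⊤ := by
  intro h
  have h₁ : supOn s (fun _ => True) ≤ supOn s (¬ · ≤ k) := by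
    refine supOn_le.2 fun i _ => ?_
    have := (hs.interp_iff hV A).2 i
    rw [h, inf_top_eq] at this
    exact this.trans (supOn_mono fun l hl hlk => hk (hl.mono hV hlk))
  have h₂ := hs.box_start k
  rw [himp_eq_top_iff.2 h₁, hs.box_isBox.top, top_le_iff] at h₂
  obtain ⟨i, -, hi⟩ := hs.exists_of_supOn_eq_top h₂
  exact hs.ne_top i hi

end IsSolovay

/-! ### The Solovay sentences of a finite frame -/

section Frame

variable {W : Type} [PartialOrder W] [Fintype W] (R : ModalRel W)

open Classical in
/-- The disjunction of the holes that satisfy `p`. -/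
noncomputable def Template.disj (p : W → Prop) : Template W :=
  Template.bigOr (Finset.univ.filter p).toList

omit [PartialOrder W] in
theorem Template.fill_disj (S : W → Fml) (p : W → Prop) :
    (Template.disj p).fill S = Race.disj p S :=
  Template.fill_bigOr S _

/-- The race on a frame, for the predicates `∃ w, p` and `∃ w, q`. A proof, in the sense of the first
predicate, of `X → Z`, where `X` says that some world is reached and `Z` that some world not below
`k` is reached, makes the race move to `k` if `k` is a modal successor of the current world; a proof
in the sense of the second predicate does so if `k` is above the current world. -/
noncomputable def frameRace {p q : Fml} (hp : IsDelta0 p) (hq : IsDelta0 q) (hpf : p.FreeBelow 2)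
    (hqf : q.FreeBelow 2) : Race W (Bool × W) where
  target t := t.2
  eff t i := ∀ j, i = some j → if t.1 then R.rel j t.2 else j < t.2
  tmpl t := .imp (.disj fun _ => True) (.disj (¬ · ≤ t.2))
  wit t := if t.1 then p else q
  wit_delta0 t := by split_ifs <;> assumption
  wit_freeBelow t := by split_ifs <;> assumption
  lt_target {t i} h := by
    have := h i rfl
    split_ifs at this
    exacts [R.lt this, this]

/-- What `iIΣ₁` proves about the Solovay sentences `S` of a frame. -/
structure IsSolovayFamily (P Q : Fml) (S : W → Fml) : Prop where
  isSigma (i : W) : IsSigma (S i)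
  isSentence (i : W) : (S i).IsSentence
  comparable {i j : W} : ¬ (i ≤ j ∨ j ≤ i) → ISigma1Proves (.imp (.and (S i) (S j)) .bot)
  tri_move {i k : W} : i < k → ISigma1Proves (.imp (.and (S i) (boxOf Q
    (.imp (Race.disj (fun _ => True) S) (Race.disj (¬ · ≤ k) S)))) (Race.disj (i < ·) S))
  box_move {i k : W} : R.rel i k → ISigma1Proves (.imp (.and (S i) (boxOf P
    (.imp (Race.disj (fun _ => True) S) (Race.disj (¬ · ≤ k) S)))) (Race.disj (i < ·) S))
  box_start (k : W) : ISigma1Proves (.imp (boxOf P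
    (.imp (Race.disj (fun _ => True) S) (Race.disj (¬ · ≤ k) S))) (Race.disj (fun _ => True) S))
  le_reason (i : W) : ISigma1Proves (.imp (S i) (.or
    (boxOf P (.imp (Race.disj (fun _ => True) S) (Race.disj (¬ · ≤ i) S)))
    (boxOf Q (.imp (Race.disj (fun _ => True) S) (Race.disj (¬ · ≤ i) S)))))
  le_tri_reason {j i : W} : j < i → ¬ R.rel j i → ISigma1Proves (.imp (.and (S j) (S i))
    (boxOf Q (.imp (Race.disj (fun _ => True) S) (Race.disj (¬ · ≤ i) S))))

theorem exists_isSolovayFamily {P Q : Fml} (hP : IsSigma1 P) (hQ : IsSigma1 Q)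
    (hPf : P.FreeBelow 1) (hQf : Q.FreeBelow 1) : ∃ S, IsSolovayFamily R P Q S := by
  have hbP := isSigma_boxOf hP
  have hbQ := isSigma_boxOf hQ
  obtain ⟨p, hp, rfl⟩ := hP
  obtain ⟨q, hq, rfl⟩ := hQ
  let C := frameRace R hp hq hPf hQf
  have hX : ∀ r : W → Prop, IsSigma (Race.disj r C.reached) := fun r =>
    Race.isSigma_disj fun i _ => C.isSigma_reached i
  have hfill : ∀ b k, (C.tmpl (b, k)).fill C.reached =
      .imp (Race.disj (fun _ => True) C.reached) (Race.disj (¬ · ≤ k) C.reached) := fun b k => by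
    simp only [C, frameRace, Template.fill, Template.fill_disj]
  have hsX : ∀ (M : Type) [ArithStr M] [IsDelta0Model M] (e : ℕ → M) (r : W → Prop),
      (Race.disj r C.reached).Sat e ↔
        ∃ i, r i ∧ Relation.ReflTransGen (C.Step (C.Trig M)) none (some i) := by
    intro M _ _ e r
    simp only [Race.sat_disj, C.sat_reached]
  have htrigP : ∀ (M : Type) [ArithStr M] [IsDelta0Model M] (e : ℕ → M) (k : W),
      (boxOf (.ex p) (.imp (Race.disj (fun _ => True) C.reached)
        (Race.disj (¬ · ≤ k) C.reached))).Sat e ↔ ∃ w, C.Trig M (true, k) w := by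
    intro M _ _ e k
    rw [← hfill true]
    exact C.sat_boxOf_wit (true, k) e
  have htrigQ : ∀ (M : Type) [ArithStr M] [IsDelta0Model M] (e : ℕ → M) (k : W),
      (boxOf (.ex q) (.imp (Race.disj (fun _ => True) C.reached)
        (Race.disj (¬ · ≤ k) C.reached))).Sat e ↔ ∃ w, C.Trig M (false, k) w := by
    intro M _ _ e k
    rw [← hfill false]
    exact C.sat_boxOf_wit (false, k) e
  have hmove : ∀ (M : Type) [ArithStr M] [IsDelta0Model M] (t : Bool × W) (i : W) (w : M),
      C.eff t (some i) → C.Trig M t w →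
      Relation.ReflTransGen (C.Step (C.Trig M)) none (some i) →
      ∃ j, i < j ∧ Relation.ReflTransGen (C.Step (C.Trig M)) none (some j) := by
    intro M _ _ t i w ht hw hi
    obtain ⟨k, hk⟩ := C.exists_step ht hw
    obtain ⟨w', t', ⟨rfl, he⟩, -⟩ := id hk
    exact ⟨_, C.lt_target he, hi.tail hk⟩
  -- The race only moves upwards.
  have hup : ∀ (M : Type) [ArithStr M] (i : W) (x : Option W),
      Relation.ReflTransGen (C.Step (C.Trig M)) (some i) x → ∃ j, x = some j ∧ i ≤ j := by
    intro M _ i x h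
    induction h with
    | refl => exact ⟨i, rfl, le_rfl⟩
    | tail _ h ih =>
      obtain ⟨j, rfl, hj⟩ := ih
      obtain ⟨w, t, ⟨rfl, he⟩, -⟩ := h
      exact ⟨_, rfl, hj.trans (C.lt_target he).le⟩
  -- The last move to a world that is reached.
  have hlast : ∀ (M : Type) [ArithStr M] (i : W),
      Relation.ReflTransGen (C.Step (C.Trig M)) none (some i) →
      ∃ j b w, Relation.ReflTransGen (C.Step (C.Trig M)) none j ∧
        C.Step (C.Trig M) j (some i) ∧ C.eff (b, i) j ∧ C.Trig M (b, i) w := by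
    intro M _ i h
    rcases Relation.ReflTransGen.cases_tail h with h | ⟨j, hj, hji⟩
    · cases h
    · obtain ⟨w, ⟨b, k⟩, ⟨hk, he⟩, hw, -⟩ := id hji
      obtain rfl : i = k := Option.some.inj hk
      exact ⟨j, b, w, hj, hji, he, hw⟩
  refine ⟨C.reached, ⟨C.isSigma_reached, C.isSentence_reached, ?_, ?_, ?_, ?_, ?_, ?_⟩⟩
  · intro i j hij
    refine iSigma1Proves_imp (.and (C.isSigma_reached i) (C.isSigma_reached j)) (.delta0 .bot)
      fun M _ _ e h => hij ?_
    simp only [Fml.Sat, C.sat_reached] at h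
    rcases Relation.ReflTransGen.total_of_right_unique C.step_rightUnique h.1 h.2 with h | h
    · obtain ⟨_, ⟨⟩, h⟩ := hup M i _ h
      exact .inl h
    · obtain ⟨_, ⟨⟩, h⟩ := hup M j _ h
      exact .inr h
  · intro i k hik
    refine iSigma1Proves_imp (.and (C.isSigma_reached i) (hbQ _)) (hX _) fun M _ _ e h => ?_
    rw [Fml.Sat, htrigQ, C.sat_reached] at h
    obtain ⟨hi, w, hw⟩ := h
    exact (hsX M e _).2 (hmove M (false, k) i w (by rintro j ⟨⟩; simpa using hik) hw hi)
  · intro i k hik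
    refine iSigma1Proves_imp (.and (C.isSigma_reached i) (hbP _)) (hX _) fun M _ _ e h => ?_
    rw [Fml.Sat, htrigP, C.sat_reached] at h
    obtain ⟨hi, w, hw⟩ := h
    exact (hsX M e _).2 (hmove M (true, k) i w (by rintro j ⟨⟩; simpa using hik) hw hi)
  · intro k
    refine iSigma1Proves_imp (hbP _) (hX _) fun M _ _ e h => ?_
    obtain ⟨w, hw⟩ := (htrigP M e k).1 h
    obtain ⟨j, hj⟩ := C.exists_step (j := none) (t := (true, k)) (fun _ h => by cases h) hw
    obtain ⟨w', t', ⟨rfl, he⟩, -⟩ := id hj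
    exact (hsX M e _).2 ⟨_, trivial, .single hj⟩
  · intro i
    refine iSigma1Proves_imp (C.isSigma_reached i) (.or (hbP _) (hbQ _)) fun M _ _ e h => ?_
    rw [Fml.Sat, htrigP, htrigQ]
    obtain ⟨-, b, w, -, -, -, hw⟩ := hlast M i ((C.sat_reached i e).1 h)
    cases b
    · exact .inr ⟨w, hw⟩
    · exact .inl ⟨w, hw⟩
  · intro j i hji hr
    refine iSigma1Proves_imp (.and (C.isSigma_reached j) (C.isSigma_reached i)) (hbQ _)
      fun M _ _ e h => ?_
    rw [Fml.Sat, C.sat_reached, C.sat_reached] at h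
    rw [htrigQ]
    obtain ⟨k, b, w, hk, hki, he, hw⟩ := hlast M i h.2
    have hjk : Relation.ReflTransGen (C.Step (C.Trig M)) (some j) k := by
      rcases Relation.ReflTransGen.total_of_right_unique C.step_rightUnique h.1 hk with h' | h'
      · exact h'
      · rcases Relation.ReflTransGen.cases_head h' with rfl | ⟨l, hkl, hlj⟩
        · exact .refl
        · rw [← C.step_rightUnique hki hkl] at hlj
          obtain ⟨_, ⟨⟩, h'⟩ := hup M i _ hlj
          exact absurd hji h'.not_gt
    obtain ⟨l, rfl, hl⟩ := hup M j k hjk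
    cases b
    · exact ⟨w, hw⟩
    · have h' : R.rel l i := by simpa using he l rfl
      exact absurd (R.of_le_of_rel hl h') hr

end Frame

/-! ### The algebra of sentences of a theory -/

section Lindenbaum

variable (Ax : Set Fml)

/-- Sentences, preordered by derivability. -/
def sentenceSetoid : Setoid {A : Fml // A.IsSentence} where
  r A B := Derives Ax [A.1] B.1 ∧ Derives Ax [B.1] A.1
  iseqv := ⟨fun A => ⟨.hyp (by simp), .hyp (by simp)⟩, fun h => ⟨h.2, h.1⟩, fun h h' =>
    ⟨h.1.cut (h'.1.weaken (by simp)), h'.2.cut (h.2.weaken (by simp))⟩⟩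

/-- The Heyting algebra of sentences modulo provable equivalence. -/
def Lindenbaum : Type := Quotient (sentenceSetoid Ax)

/-- The class of a sentence. -/
def Lindenbaum.mk {A : Fml} (hA : A.IsSentence) : Lindenbaum Ax :=
  Quotient.mk (sentenceSetoid Ax) ⟨A, hA⟩

theorem Lindenbaum.ind {p : Lindenbaum Ax → Prop}
    (h : ∀ (A : Fml) (hA : A.IsSentence), p (Lindenbaum.mk Ax hA)) (a : Lindenbaum Ax) : p a :=
  Quotient.ind (fun A => h A.1 A.2) a

variable {Ax} in
/-- A binary operation on sentences that respects derivability, on classes. -/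
def Lindenbaum.map₂ (f : Fml → Fml → Fml)
    (hf : ∀ {A B}, A.IsSentence → B.IsSentence → (f A B).IsSentence)
    (h : ∀ {A A' B B'}, Derives Ax [A] A' → Derives Ax [A'] A → Derives Ax [B] B' →
      Derives Ax [B'] B → Derives Ax [f A B] (f A' B')) :
    Lindenbaum Ax → Lindenbaum Ax → Lindenbaum Ax :=
  Quotient.map₂ (sa := sentenceSetoid Ax) (sb := sentenceSetoid Ax) (sc := sentenceSetoid Ax)
    (fun A B => ⟨f A.1 B.1, hf A.2 B.2⟩)
    fun _ _ h₁ _ _ h₂ => ⟨h h₁.1 h₁.2 h₂.1 h₂.2, h h₁.2 h₁.1 h₂.2 h₂.1⟩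

theorem Derives.of_singleton {Ax : Set Fml} {Γ : List Fml} {A B : Fml} (h : Derives Ax [A] B)
    (hA : Derives Ax Γ A) : Derives Ax Γ B :=
  hA.cut (h.weaken (by simp))

theorem isSentence_bot : Fml.bot.IsSentence := trivial

theorem isSentence_top : (Fml.imp .bot .bot).IsSentence := ⟨trivial, trivial⟩

instance : LE (Lindenbaum Ax) where
  le := Quotient.lift₂ (s₁ := sentenceSetoid Ax) (s₂ := sentenceSetoid Ax)
    (fun A B => Derives Ax [A.1] B.1) fun _ _ _ _ h₁ h₂ => propext
      ⟨fun h => h₂.1.of_singleton (h.of_singleton h₁.2),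
        fun h => h₂.2.of_singleton (h.of_singleton h₁.1)⟩

variable {Ax}

theorem Lindenbaum.mk_le_mk {A B : Fml} {hA : A.IsSentence} {hB : B.IsSentence} :
    mk Ax hA ≤ mk Ax hB ↔ Derives Ax [A] B := Iff.rfl

/-- The operation on classes that is given by implication. -/
def Lindenbaum.himp : Lindenbaum Ax → Lindenbaum Ax → Lindenbaum Ax :=
  Lindenbaum.map₂ .imp (fun h h' => ⟨h, h'⟩) fun {A A' B B'} _ h h' _ =>
    .impI (h'.of_singleton (.impE (A := A) (.hyp (by simp))
      (h.of_singleton (.hyp (by simp)))))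

instance : HeytingAlgebra (Lindenbaum Ax) where
  le_refl a := by
    induction a using Lindenbaum.ind with
    | h A hA => exact .hyp (A := A) (by simp)
  le_trans a b c := by
    induction a using Lindenbaum.ind
    induction b using Lindenbaum.ind
    induction c using Lindenbaum.ind
    exact fun h h' => Derives.of_singleton h' h
  le_antisymm a b := by
    induction a using Lindenbaum.ind
    induction b using Lindenbaum.ind
    exact fun h h' => Quotient.sound (s := sentenceSetoid Ax) ⟨h, h'⟩
  sup := Lindenbaum.map₂ .or (fun h h' => ⟨h, h'⟩) fun {A A' B B'} h _ h' _ =>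
    .orE (A := A) (B := B) (.hyp (by simp)) (.orI₁ (h.of_singleton (.hyp (by simp))))
      (.orI₂ (h'.of_singleton (.hyp (by simp))))
  le_sup_left a b := by
    induction a using Lindenbaum.ind with
    | h A hA => induction b using Lindenbaum.ind with
      | h B hB => exact .orI₁ (.hyp (A := A) (by simp))
  le_sup_right a b := by
    induction a using Lindenbaum.ind with
    | h A hA => induction b using Lindenbaum.ind with
      | h B hB => exact .orI₂ (.hyp (A := B) (by simp))
  sup_le a b c := by
    induction a using Lindenbaum.ind with
    | h A hA => induction b using Lindenbaum.ind with
      | h B hB => induction c using Lindenbaum.ind with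
        | h C hC =>
          intro h h'
          exact .orE (A := A) (B := B) (.hyp (by simp))
            (Derives.of_singleton h (.hyp (by simp))) (Derives.of_singleton h' (.hyp (by simp)))
  inf := Lindenbaum.map₂ .and (fun h h' => ⟨h, h'⟩) fun {A A' B B'} h _ h' _ =>
    .andI (h.of_singleton (.andE₁ (B := B) (.hyp (by simp))))
      (h'.of_singleton (.andE₂ (A := A) (.hyp (by simp))))
  inf_le_left a b := by
    induction a using Lindenbaum.ind with
    | h A hA => induction b using Lindenbaum.ind with
      | h B hB => exact .andE₁ (B := B) (.hyp (by simp))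
  inf_le_right a b := by
    induction a using Lindenbaum.ind with
    | h A hA => induction b using Lindenbaum.ind with
      | h B hB => exact .andE₂ (A := A) (.hyp (by simp))
  le_inf a b c := by
    induction a using Lindenbaum.ind
    induction b using Lindenbaum.ind
    induction c using Lindenbaum.ind
    exact fun h h' => .andI h h'
  top := Lindenbaum.mk Ax isSentence_top
  le_top a := by
    induction a using Lindenbaum.ind
    exact .impI (.hyp (by simp))
  bot := Lindenbaum.mk Ax isSentence_bot
  bot_le a := by
    induction a using Lindenbaum.ind
    exact .botE (.hyp (by simp))
  himp := Lindenbaum.himp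
  le_himp_iff a b c := by
    induction a using Lindenbaum.ind with
    | h A hA => induction b using Lindenbaum.ind with
      | h B hB => induction c using Lindenbaum.ind with
        | h C hC =>
          constructor
          · intro h
            exact .impE (A := B) (Derives.of_singleton h (.andE₁ (B := B) (.hyp (by simp))))
              (.andE₂ (A := A) (.hyp (by simp)))
          · intro h
            exact .impI (Derives.of_singleton h (.andI (.hyp (by simp)) (.hyp (by simp))))
  compl a := Lindenbaum.himp a (Lindenbaum.mk Ax isSentence_bot)
  himp_bot _ := rfl

end Lindenbaum

/-! ### Arithmetical soundness and completeness of `iGLC` -/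

section Lindenbaum

variable {Ax : Set Fml}

namespace Lindenbaum

theorem mk_eq_top {A : Fml} {hA : A.IsSentence} : mk Ax hA = ⊤ ↔ Derives Ax [] A := by
  rw [← top_le_iff]
  exact ⟨fun h => .cut (.impI (.hyp (by simp))) h, fun h => h.of_nil⟩

theorem mk_le_mk_iff {A B : Fml} {hA : A.IsSentence} {hB : B.IsSentence} :
    mk Ax hA ≤ mk Ax hB ↔ Derives Ax [] (.imp A B) :=
  mk_le_mk.trans derives_imp_iff.symm

theorem derives_of_bigOr {l : List Fml} {C : Fml} :
    Derives Ax [bigOr l] C ↔ ∀ A ∈ l, Derives Ax [A] C := by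
  induction l with
  | nil => exact ⟨fun _ => by simp, fun _ => .botE (.hyp (by simp [bigOr]))⟩
  | cons A l ih =>
    rw [List.forall_mem_cons, ← ih]
    constructor
    · exact fun h => ⟨h.of_singleton (.orI₁ (.hyp (by simp))),
        h.of_singleton (.orI₂ (.hyp (List.mem_singleton.2 rfl)))⟩
    · exact fun h => .orE (A := A) (B := bigOr l) (.hyp (by simp [bigOr]))
        (h.1.of_singleton (.hyp (by simp))) (h.2.of_singleton (.hyp (by simp)))

theorem mk_disj {W : Type} [Fintype W] {S : W → Fml} (hS : ∀ i, (S i).IsSentence)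
    (p : W → Prop) :
    mk Ax (A := Race.disj p S) (Race.isSentence_disj hS) =
      supOn (fun i => mk Ax (hS i)) p := by
  refine eq_of_forall_ge_iff fun c => ?_
  induction c using Lindenbaum.ind with
  | h C hC =>
    rw [supOn_le]
    refine derives_of_bigOr.trans ?_
    simp only [List.mem_map, Finset.mem_toList, Finset.mem_filter, Finset.mem_univ, true_and,
      forall_exists_index, and_imp, forall_apply_eq_imp_iff₂]
    rfl

end Lindenbaum

end Lindenbaum

/-- The axioms of a theory. -/
abbrev ArithTheory.axioms (T : ArithTheory) : Set Fml := {B | TrueInN (boxOf T.ax B)}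

theorem isSentence_realize {P : Fml} (hP : P.FreeBelow 1) {σ : ℕ → Fml} (hσ : IsRealization σ)
    (A : MFml) : (realize P σ A).IsSentence := by
  induction A with
  | letter p => exact hσ p
  | bot => trivial
  | and A B ihA ihB => exact ⟨ihA, ihB⟩
  | or A B ihA ihB => exact ⟨ihA, ihB⟩
  | imp A B ihA ihB => exact ⟨ihA, ihB⟩
  | box A _ => exact isSentence_boxOf hP _

section Provability

variable {T : ArithTheory} (hT : T.ExtendsISigma1)
include hT

theorem IsProvabilityPredicate.proves_box {P : Fml} (hP : IsProvabilityPredicate T P) {A : Fml}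
    (hA : A.IsSentence) (h : T.Proves A) : T.Proves (boxOf P A) :=
  hT _ (iSigma1Proves_of_trueInN (isSigma_boxOf hP.sigma1 A) (isSentence_boxOf hP.freeBelow A)
    (hP.of_proves A hA h))

theorem IsProvabilityPredicate.box_mono {P : Fml} (hP : IsProvabilityPredicate T P) {A B : Fml}
    (hA : A.IsSentence) (hB : B.IsSentence) (h : Derives T.axioms [A] B) :
    Derives T.axioms [boxOf P A] (boxOf P B) :=
  derives_imp_iff.1 (.impE (hT _ (hP.distrib A B hA hB))
    (hP.proves_box hT (A := .imp A B) ⟨hA, hB⟩ h.impI))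

/-- The operator on the algebra of sentences that is given by a provability predicate. -/
def IsProvabilityPredicate.op {P : Fml} (hP : IsProvabilityPredicate T P) :
    Lindenbaum T.axioms → Lindenbaum T.axioms :=
  Quotient.map (sa := sentenceSetoid T.axioms) (sb := sentenceSetoid T.axioms)
    (fun A => ⟨boxOf P A.1, isSentence_boxOf hP.freeBelow A.1⟩)
    fun A B h => ⟨hP.box_mono hT A.2 B.2 h.1, hP.box_mono hT B.2 A.2 h.2⟩

theorem IsProvabilityPredicate.isBox_op {P : Fml} (hP : IsProvabilityPredicate T P) :
    IsBox (hP.op hT) where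
  top := Lindenbaum.mk_eq_top.2 (hP.proves_box hT isSentence_top (.impI (.hyp (by simp))))
  himp a b := by
    induction a using Lindenbaum.ind with
    | h A hA => induction b using Lindenbaum.ind with
      | h B hB => exact Lindenbaum.mk_le_mk_iff.2 (hT _ (hP.distrib A B hA hB))

theorem mk_realize {P : Fml} (hP : IsProvabilityPredicate T P) {σ : ℕ → Fml}
    (hσ : IsRealization σ) (A : MFml) :
    Lindenbaum.mk T.axioms (isSentence_realize hP.freeBelow hσ A) =
      interp (hP.op hT) (fun p => Lindenbaum.mk T.axioms (hσ p)) A := by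
  induction A with
  | letter p => rfl
  | bot => rfl
  | and A B ihA ihB => rw [interp, ← ihA, ← ihB]; rfl
  | or A B ihA ihB => rw [interp, ← ihA, ← ihB]; rfl
  | imp A B ihA ihB => rw [interp, ← ihA, ← ihB]; rfl
  | box A ih => rw [interp, ← ih]; rfl

end Provability

/-- Soundness of `iGLC` in a Heyting algebra with an operator. -/
theorem IGLC.interp_eq_top {H : Type} [HeytingAlgebra H] {box : H → H} (hbox : IsBox box)
    (hcp : ∀ a, a ≤ box a) (hloeb : ∀ a, box (box a ⇨ a) ≤ box a) (v : ℕ → H) {A : MFml}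
    (h : IGLC A) : interp box v A = ⊤ := by
  have mp : ∀ {A B : MFml}, interp box v A = ⊤ → interp box v (.imp A B) = ⊤ →
      interp box v B = ⊤ := by
    intro A B hA hAB
    rwa [interp, hA, top_himp] at hAB
  have nec : ∀ {A : MFml}, interp box v A = ⊤ → interp box v (.box A) = ⊤ := by
    intro A hA
    rw [interp, hA, hbox.top]
  have htaut : ∀ {A : MFml}, IntTaut A → interp box v A = ⊤ := by
    intro A h
    induction h with
    | imp_k A B => simp only [interp, himp_eq_top_iff]; exact le_himp
    | imp_s A B C =>
      simp only [interp, himp_eq_top_iff, le_himp_iff]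
      generalize interp box v A = a, interp box v B = b, interp box v C = c
      have h₁ : (a ⇨ b ⇨ c) ⊓ (a ⇨ b) ⊓ a ≤ b :=
        (inf_le_inf_right _ inf_le_right).trans himp_inf_le
      have h₂ : (a ⇨ b ⇨ c) ⊓ (a ⇨ b) ⊓ a ≤ b ⇨ c :=
        (inf_le_inf_right _ inf_le_left).trans himp_inf_le
      exact (le_inf h₂ h₁).trans himp_inf_le
    | and_left A B => simp only [interp, himp_eq_top_iff]; exact inf_le_left
    | and_right A B => simp only [interp, himp_eq_top_iff]; exact inf_le_right
    | and_intro A B => simp only [interp, himp_eq_top_iff, le_himp_iff]; exact le_rfl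
    | or_left A B => simp only [interp, himp_eq_top_iff]; exact le_sup_left
    | or_right A B => simp only [interp, himp_eq_top_iff]; exact le_sup_right
    | or_elim A B C =>
      simp only [interp, himp_eq_top_iff, le_himp_iff]
      rw [inf_sup_left]
      exact sup_le ((inf_le_inf_right _ inf_le_left).trans himp_inf_le)
        ((inf_le_inf_right _ inf_le_right).trans himp_inf_le)
    | bot_elim A => simp only [interp, himp_eq_top_iff]; exact bot_le
    | mp _ _ h₁ h₂ => exact mp h₁ h₂
  have hK : ∀ {A : MFml}, IK A → interp box v A = ⊤ := by
    intro A h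
    induction h with
    | taut h => exact htaut h
    | distrib A B => simp only [interp, himp_eq_top_iff]; exact hbox.himp _ _
    | mp _ _ h₁ h₂ => exact mp h₁ h₂
    | nec _ h => exact nec h
  have hGL : ∀ {A : MFml}, IGL A → interp box v A = ⊤ := by
    intro A h
    induction h with
    | of_iK h => exact hK h
    | loeb A => simp only [interp, himp_eq_top_iff]; exact hloeb _
    | mp _ _ h₁ h₂ => exact mp h₁ h₂
    | nec _ h => exact nec h
  induction h with
  | of_iGL h => exact hGL h
  | completeness A => simp only [interp, himp_eq_top_iff]; exact hcp _
  | mp _ _ h₁ h₂ => exact mp h₁ h₂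
  | nec _ h => exact nec h

section Main

variable {T : ArithTheory} (hT : T.ExtendsISigma1) {P Q : Fml}
include hT

theorem le_op (hP : IsProvabilityPredicate T P) (hCP : ProvesCP T P) (a : Lindenbaum T.axioms) :
    a ≤ hP.op hT a := by
  induction a using Lindenbaum.ind with
  | h A hA => exact Lindenbaum.mk_le_mk_iff.2 (hCP A hA)

/-- Löb's principle for a provability predicate that satisfies the completeness principle. -/
theorem op_loeb (hP : IsProvabilityPredicate T P) (hCP : ProvesCP T P)
    (a : Lindenbaum T.axioms) : hP.op hT (hP.op hT a ⇨ a) ≤ hP.op hT a := by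
  have hbox := hP.isBox_op hT
  obtain ⟨r, hr⟩ : ∃ r, r = hP.op hT (r ⇨ a) := by
    induction a using Lindenbaum.ind with
    | h A hA =>
      obtain ⟨R, -, hR, h₁, h₂⟩ := exists_loeb_fixedPoint hP.sigma1 hP.freeBelow A
      refine ⟨Lindenbaum.mk T.axioms hR, le_antisymm ?_ ?_⟩
      · exact Lindenbaum.mk_le_mk_iff.2 (hT _ h₁)
      · exact Lindenbaum.mk_le_mk_iff.2 (hT _ h₂)
  have hra : r ≤ hP.op hT a :=
    (le_inf hr.le (le_op hT hP hCP r)).trans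
      ((hbox.inf_le _ _).trans (hbox.mono himp_inf_le))
  calc hP.op hT (hP.op hT a ⇨ a) ≤ hP.op hT (r ⇨ a) := hbox.mono (himp_le_himp_right hra)
    _ = r := hr.symm
    _ ≤ hP.op hT a := hra

theorem proves_realize_of_iGLC (hP : IsProvabilityPredicate T P) (hCP : ProvesCP T P) {A : MFml}
    (hA : IGLC A) {σ : ℕ → Fml} (hσ : IsRealization σ) : T.Proves (realize P σ A) := by
  have h := hA.interp_eq_top (hP.isBox_op hT) (le_op hT hP hCP) (op_loeb hT hP hCP)
    fun p => Lindenbaum.mk T.axioms (hσ p)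
  rw [← mk_realize hT hP hσ] at h
  exact (Lindenbaum.mk_eq_top (hA := isSentence_realize hP.freeBelow hσ A)).1 h

/-- The classes of a `Σ`-sentence and of an equivalent `Σ₁`-sentence agree. -/
theorem mk_eq_mk_of_sat {A B : Fml} (hA : IsSigma A) (hB : IsSigma B) (hA' : A.IsSentence)
    (hB' : B.IsSentence) (h : ∀ (M : Type) [ArithStr M] [IsDelta0Model M] (e : ℕ → M),
      A.Sat e ↔ B.Sat e) : Lindenbaum.mk T.axioms hA' = Lindenbaum.mk T.axioms hB' :=
  le_antisymm
    (Lindenbaum.mk_le_mk_iff.2 (hT _ (iSigma1Proves_imp hA hB fun M _ _ e => (h M e).1)))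
    (Lindenbaum.mk_le_mk_iff.2 (hT _ (iSigma1Proves_imp hB hA fun M _ _ e => (h M e).2)))

variable (hsound : T.Sigma1Sound)
include hsound

/-- The Solovay sentences of a frame, in the algebra of sentences of the theory. -/
theorem IsSolovayFamily.isSolovay {W : Type} [PartialOrder W] [Fintype W] {R : ModalRel W}
    {S : W → Fml} (hS : IsSolovayFamily R P Q S) (hPQ : IsGoodPair T P Q) (hCP : ProvesCP T P) :
    IsSolovay (hPQ.left.op hT) (hPQ.right.op hT) R
      fun i => Lindenbaum.mk T.axioms (hS.isSentence i) := by
  have hX : ∀ p : W → Prop, (Race.disj p S).IsSentence := fun p =>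
    Race.isSentence_disj hS.isSentence
  have hXs : ∀ p : W → Prop, IsSigma (Race.disj p S) := fun p =>
    Race.isSigma_disj fun i _ => hS.isSigma i
  have le : ∀ {A B : Fml} {hA : A.IsSentence} {hB : B.IsSentence}, ISigma1Proves (.imp A B) →
      Lindenbaum.mk T.axioms hA ≤ Lindenbaum.mk T.axioms hB := fun h =>
    Lindenbaum.mk_le_mk_iff.2 (hT _ h)
  constructor
  case box_isBox => exact hPQ.left.isBox_op hT
  case tri_isBox => exact hPQ.right.isBox_op hT
  case le_box => exact le_op hT hPQ.left hCP
  case tri_slp =>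
    intro a
    induction a using Lindenbaum.ind with
    | h A hA => exact Lindenbaum.mk_le_mk_iff.2 (hPQ.slp A hA)
  case box_tri =>
    intro p
    rw [← Lindenbaum.mk_disj hS.isSentence p]
    obtain ⟨S', hS₁, hS', he⟩ := (hXs p).exists_isSigma1 (hX p)
    rw [mk_eq_mk_of_sat hT (hXs p) hS₁.isSigma (hX p) hS' he]
    exact Lindenbaum.mk_le_mk_iff.2 (hPQ.box_tri S' hS₁ hS')
  case comparable => exact fun h => le (hS.comparable h)
  case sound =>
    intro a ha
    induction a using Lindenbaum.ind with
    | h A hA =>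
      refine Lindenbaum.mk_eq_top.2 (hPQ.sound A hA (hsound _ ?_ ?_ (Lindenbaum.mk_eq_top.1 ha)))
      · obtain ⟨p, hp, hP⟩ := hPQ.left.sigma1
        exact ⟨p.subst _, hp.subst _, by rw [boxOf, hP]; rfl⟩
      · exact isSentence_boxOf hPQ.left.freeBelow A
  case exists_of_supOn_eq_top =>
    intro p hp
    rw [← Lindenbaum.mk_disj hS.isSentence p] at hp
    obtain ⟨S', hS₁, hS', he⟩ := (hXs p).exists_isSigma1 (hX p)
    rw [mk_eq_mk_of_sat hT (hXs p) hS₁.isSigma (hX p) hS' he, Lindenbaum.mk_eq_top] at hp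
    have htrue := (he ℕ fun _ => 0).2 (trueInN_iff.1 (hsound S' hS₁ hS' hp) fun _ => 0)
    obtain ⟨i, hi, hSi⟩ := Race.sat_disj.1 htrue
    refine ⟨i, hi, Lindenbaum.mk_eq_top.2 (hT _ (iSigma1Proves_of_trueInN (hS.isSigma i)
      (hS.isSentence i) (((hS.isSentence i).trueInN_iff _).2 hSi)))⟩
  all_goals simp only [← Lindenbaum.mk_disj hS.isSentence]
  case tri_move => exact fun h => le (hS.tri_move h)
  case box_move => exact fun h => le (hS.box_move h)
  case box_start => exact fun k => le (hS.box_start k)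
  case le_reason => exact fun i => le (hS.le_reason i)
  case le_tri_reason => exact fun h h' => le (hS.le_tri_reason h h')

theorem iGLC_of_proves_realize (hPQ : IsGoodPair T P Q) (hCP : ProvesCP T P) {A : MFml}
    (hA : ∀ σ, IsSigma1Realization σ → T.Proves (realize P σ A)) : IGLC A := by
  by_contra hn
  obtain ⟨W, _, _, R, V, hV, k, hk⟩ := exists_countermodel hn
  have := Fintype.ofFinite W
  obtain ⟨S, hS⟩ := exists_isSolovayFamily R hPQ.left.sigma1 hPQ.right.sigma1 hPQ.left.freeBelow
    hPQ.right.freeBelow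
  have hX : ∀ p : W → Prop, (Race.disj p S).IsSentence := fun p =>
    Race.isSentence_disj hS.isSentence
  have hXs : ∀ p : W → Prop, IsSigma (Race.disj p S) := fun p =>
    Race.isSigma_disj fun i _ => hS.isSigma i
  choose σ hσ₁ hσ he using fun p => (hXs (V p)).exists_isSigma1 (hX (V p))
  refine (hS.isSolovay hT hsound hPQ hCP).interp_ne_top hV hk ?_
  have h := Lindenbaum.mk_eq_top (hA := isSentence_realize hPQ.left.freeBelow hσ A).2
    (hA σ fun p => ⟨hσ p, hσ₁ p⟩)
  rw [mk_realize hT hPQ.left hσ] at h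
  convert h using 2
  funext p
  rw [← Lindenbaum.mk_disj hS.isSentence]
  exact mk_eq_mk_of_sat hT (hXs _) (hσ₁ p).isSigma (hX _) (hσ p) (he p)

end Main

end IntArith

theorem theorem3 (T : IntArith.ArithTheory) (hT : T.ExtendsISigma1) (hsound : T.Sigma1Sound)
    (P Q : IntArith.Fml) (hPQ : IntArith.IsGoodPair T P Q) (hCP : IntArith.ProvesCP T P) :
    IntArith.logicOf T P = {A : IntArith.MFml | IntArith.IGLC A} ∧
      IntArith.sigma1LogicOf T P = {A : IntArith.MFml | IntArith.IGLC A} := by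
  have hsub : IntArith.logicOf T P ⊆ IntArith.sigma1LogicOf T P :=
    fun A hA σ hσ => hA σ fun p => (hσ p).1
  have hsnd : {A : IntArith.MFml | IntArith.IGLC A} ⊆ IntArith.logicOf T P :=
    fun A hA σ hσ => IntArith.proves_realize_of_iGLC hT hPQ.left hCP hA hσ
  have hcmp : IntArith.sigma1LogicOf T P ⊆ {A : IntArith.MFml | IntArith.IGLC A} :=
    fun A hA => IntArith.iGLC_of_proves_realize hT hsound hPQ hCP hA
  exact ⟨(hsub.trans hcmp).antisymm hsnd, hcmp.antisymm (hsnd.trans hsub)⟩
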